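/- For $\tau$ in the upper half-plane $\mathbb{H}$, put $q=e^{2\pi i\tau}$, let $\theta(\xi,\tau)=\sum_{\nu\in\mathbb{Z}+1/2}(-1)^{\nu-1/2}q^{\nu^2/2}e^{2\pi i\nu\xi}$, and let $$F(\xi,\alpha,\tau)=\frac{\theta'(0,\tau)\,\theta(\xi+\alpha,\tau)}{\theta(\xi,\tau)\,\theta(\alpha,\tau)}=\sum_{n\ge 0}f_n(\xi,\tau)(2\pi i\alpha)^{n-1}$$ be the Kronecker function and its expansion at $\alpha=0$, where $\theta'=\partial\theta/\partial\xi$. With $r_\tau(\xi)=\operatorname{Im}\xi/\operatorname{Im}\tau$ put $\omega_n(\xi,\tau)=\sum_{k=0}^n\frac{r_\tau(\xi)^k}{k!}f_{n-k}(\xi,\tau)$. For integers $n_1,\dots,n_r\ge 0$ with $r\ge1$, the A-elliptic multiple zeta value $A(n_1,\dots,n_r;\tau)$ of length $r$ is the coefficient $A_0$ in the expansion, as $\varepsilon\to0^+$, $$\int_{1-\varepsilon\ge t_1\ge\cdots\ge t_r\ge\varepsilon}\omega_{n_1}(t_1,\tau)\cdots\omega_{n_r}(t_r,\tau)\,dt_1\cdots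 dt_r=\sum_{k=0}^{r}A_k\log(-2\pi i\varepsilon)^k+O(\varepsilon^{\nu}),\qquad \nu>0,$$ with the principal branch of the logarithm. Its depth is the number of non-zero $n_i$. For $n,r\ge1$ put $A_{n,r}(\tau)=A(n,\underbrace{0,\dots,0}_{r-1};\tau)$, and for $r\ge 2$ put $$\hat A_{1,r}(\tau)=A_{1,r}(\tau)-\frac{(2\pi i)^{r-2}}{(r-1)!}A_{1,2}(\tau).$$ For $f:\mathbb{H}\to\mathbb{C}$, $k\in\mathbb{Z}$ and $\gamma=\begin{pmatrix}a&b\\c&d\end{pmatrix}\in\mathrm{SL}_2(\mathbb{Z})$ write $(f|_k\gamma)(\tau)=(c\tau+d)^{-k}f\big(\frac{a\tau+b}{c\tau+d}\big)$. A vector-valued modular form of weight $k$ for $\mathrm{SL}_2(\mathbb{Z})$ is a holomorphic function $F:\mathbb{H}\to\mathbb{C}^d$ such that $F|_k\gamma=\rho(\gamma)F$ for all $\gamma\in\mathrm{SL}_2(\mathbb{Z})$, for some representation $\rho$ of $\mathrm{SL}_2(\mathbb{Z})$ on $\mathbb{C}^d$, and such that for all $C,\varepsilon>0$ one has $F(\tau)=O(e^{\varepsilon\operatorname{Im}\tau})$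 as $\operatorname{Im}\tau\to\infty$ with $|\operatorname{Re}\tau|\le C$. **Theorem.** 1. For all $n\ge2$ and $r\ge1$ the vector space $\langle A_{n,r}|_{1-r}\gamma:\gamma\in\mathrm{SL}_2(\mathbb{Z})\rangle_{\mathbb{C}}$ is finite-dimensional. 2. For all $r\ge2$ the vector space $\langle \hat A_{1,r}|_{1-r}\gamma:\gamma\in\mathrm{SL}_2(\mathbb{Z})\rangle_{\mathbb{C}}$ is finite-dimensional. 3. Consequently, for $n\ge2$ and $r\ge1$, the function $A_{n,r}$ is a component of a vector-valued modular form of weight $1-r$ for $\mathrm{SL}_2(\mathbb{Z})$. More generally so is every depth-one A-elliptic multiple zeta value $A(0,\dots,0,n,0,\dots,0;\tau)$ of length $r$ with non-zero entry $n\ge2$. For $r\ge2$ the function $\hat A_{1,r}$ is also a component of a vector-valued modular form of weight $1-r$. -/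

import Mathlib

open Complex Filter Topology Asymptotics
open UpperHalfPlane hiding I
open scoped Real ModularForm MatrixGroups Manifold Polynomial Nat

noncomputable section

/-- The odd Jacobi theta function `θ(ξ, τ) = ∑_{ν ∈ ℤ + 1/2} (-1)^(ν - 1/2) q^(ν²/2) u^ν`, with
`q = exp(2πiτ)` and `u = exp(2πiξ)`; the sum runs over `m ∈ ℤ` with `ν = m + 1/2`. -/
def oddTheta (ξ : ℂ) (τ : ℍ) : ℂ :=
  ∑' m : ℤ, (-1 : ℂ) ^ m * cexp (π * I * τ * ((m : ℂ) + 1 / 2) ^ 2)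
    * cexp (2 * π * I * ξ * ((m : ℂ) + 1 / 2))

/-- The value `θ'(0, τ)` of the `ξ`-derivative. -/
def oddThetaDerivZero (τ : ℍ) : ℂ := deriv (fun ξ : ℂ => oddTheta ξ τ) 0

/-- The Kronecker function `F(ξ, α, τ) = θ'(0, τ) θ(ξ + α, τ) / (θ(ξ, τ) θ(α, τ))`. -/
def kroneckerF (ξ α : ℂ) (τ : ℍ) : ℂ :=
  oddThetaDerivZero τ * oddTheta (ξ + α) τ / (oddTheta ξ τ * oddTheta α τ)

/-- The function `α ↦ α F(ξ, α, τ)` with its removable singularity at `α = 0` filled in: the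
factor `θ(α, τ) / α` of the denominator takes the value `θ'(0, τ)` at `α = 0`. -/
def kroneckerReg (ξ : ℂ) (τ : ℍ) (α : ℂ) : ℂ :=
  oddThetaDerivZero τ * oddTheta (ξ + α) τ
    / (oddTheta ξ τ * dslope (fun z : ℂ => oddTheta z τ) 0 α)

/-- The coefficients `f_n(ξ, τ)` of the expansion
`F(ξ, α, τ) = ∑_{n ≥ 0} f_n(ξ, τ) (2πiα)^(n - 1)` at `α = 0`. -/
def kroneckerCoeff (n : ℕ) (ξ : ℂ) (τ : ℍ) : ℂ :=
  (2 * π * I) ^ (1 - (n : ℤ)) * (iteratedDeriv n (kroneckerReg ξ τ) 0 / (n ! : ℂ))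

/-- The real number `r_τ(ξ) = Im ξ / Im τ`. -/
def rTau (ξ : ℂ) (τ : ℍ) : ℝ := ξ.im / τ.im

/-- The coefficients `ω_n(ξ, τ) = ∑_{k ≤ n} r_τ(ξ)^k / k! · f_{n-k}(ξ, τ)` of
`exp(2πi r_τ(ξ) α) F(ξ, α, τ) = ∑_{n ≥ 0} ω_n(ξ, τ) (2πiα)^(n - 1)`. -/
def kroneckerOmega (n : ℕ) (ξ : ℂ) (τ : ℍ) : ℂ :=
  ∑ k ∈ Finset.range (n + 1), ((rTau ξ τ : ℂ) ^ k / (k ! : ℂ)) * kroneckerCoeff (n - k) ξ τ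

/-- The iterated integral `∫ g_1(t_1) ⋯ g_r(t_r) dt_1 ⋯ dt_r` over `b ≥ t_1 ≥ ⋯ ≥ t_r ≥ a`,
for a list of functions `g_1, …, g_r`. -/
def iterIntegral (a : ℝ) : List (ℝ → ℂ) → ℝ → ℂ
  | [], _ => 1
  | g :: l, b => ∫ t in a..b, g t * iterIntegral a l t

/-- `a` is the constant coefficient `A_0` of an expansion
`J(ε) = O(ε^ν) + ∑_{k ≤ r} A_k log(-2πiε)^k` as `ε → 0⁺`, for some `ν > 0`. The principal
logarithm is the branch with `2 log(±i) = ±πi`. -/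
def IsRegularizedValue (r : ℕ) (J : ℝ → ℂ) (a : ℂ) : Prop :=
  ∃ P : ℂ[X], P.natDegree ≤ r ∧ P.coeff 0 = a ∧ ∃ ν : ℝ, 0 < ν ∧
    (fun ε : ℝ => J ε - P.eval (Complex.log (-(2 * π * I * ε)))) =O[𝓝[>] (0 : ℝ)]
      fun ε : ℝ => ε ^ ν

open Classical in
/-- The A-elliptic multiple zeta value `A(n_1, …, n_r; τ)`: the regularized iterated integral of
`ω_{n_1}(t_1, τ) dt_1 ⋯ ω_{n_r}(t_r, τ) dt_r` over the straight path `[0, 1]`. -/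
def ellMZVA (l : List ℕ) (τ : ℍ) : ℂ :=
  if h : ∃ a : ℂ, IsRegularizedValue l.length
      (fun ε : ℝ => iterIntegral ε
        (l.map fun (n : ℕ) (t : ℝ) => kroneckerOmega n (t : ℂ) τ) (1 - ε)) a
  then h.choose else 0

/-- `A_{n,r}(τ) = A(n, 0, …, 0; τ)` with `r - 1` zeros, for `r ≥ 1`. -/
def depthOneA (n r : ℕ) : ℍ → ℂ := ellMZVA (n :: List.replicate (r - 1) 0)

/-- `Â_{1,r}(τ) = A_{1,r}(τ) - (2πi)^(r-2) / (r-1)! · A_{1,2}(τ)`, for `r ≥ 2`. -/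
def depthOneHatA (r : ℕ) : ℍ → ℂ := fun τ =>
  depthOneA 1 r τ - (2 * π * I) ^ ((r : ℤ) - 2) / ((r - 1) ! : ℂ) * depthOneA 1 2 τ

/-- The complex span of the translates `f|_k γ`, `γ ∈ SL₂(ℤ)`. -/
def slashSpan (k : ℤ) (f : ℍ → ℂ) : Submodule ℂ (ℍ → ℂ) :=
  Submodule.span ℂ (Set.range fun γ : SL(2, ℤ) => f ∣[k] γ)

/-- `F : ℍ → ℂ^d` is a vector-valued modular form of weight `k` for `SL₂(ℤ)`: it is holomorphic,
satisfies `F|_k γ = ρ(γ) F` for a representation `ρ` of `SL₂(ℤ)` on `ℂ^d`, and grows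
subexponentially at the cusp. As `F` need not be periodic, the growth as `Im τ → ∞` is taken on
vertical strips `|Re τ| ≤ C`. -/
structure IsVectorValuedModularForm (k : ℤ) {d : ℕ} (F : ℍ → Fin d → ℂ) : Prop where
  holomorphic : ∀ i : Fin d, MDifferentiable 𝓘(ℂ) 𝓘(ℂ) fun τ : ℍ => F τ i
  modular : ∃ ρ : Representation ℂ SL(2, ℤ) (Fin d → ℂ), ∀ (γ : SL(2, ℤ)) (i : Fin d),
    (fun τ : ℍ => F τ i) ∣[k] γ = fun τ : ℍ => ρ γ (F τ) i
  growth : ∀ (i : Fin d) (C : ℝ) (ε : ℝ), 0 < ε →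
    (fun τ : ℍ => F τ i) =O[atImInfty ⊓ 𝓟 {τ : ℍ | |τ.re| ≤ C}]
      fun τ : ℍ => Real.exp (ε * τ.im)

/-- `f` is a component of a vector-valued modular form of weight `k` for `SL₂(ℤ)`. -/
def IsComponentOfVVMF (k : ℤ) (f : ℍ → ℂ) : Prop :=
  ∃ (d : ℕ) (F : ℍ → Fin d → ℂ), IsVectorValuedModularForm k F ∧ ∃ i : Fin d, ∀ τ : ℍ, F τ i = f τ

/-! ### The definitions are meaningful -/

theorem oddTheta_zero (τ : ℍ) : oddTheta 0 τ = 0 := by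
  have h : oddTheta 0 τ = -oddTheta 0 τ := by
    conv_lhs => rw [oddTheta, ← (Equiv.subLeft (-1 : ℤ)).tsum_eq]
    rw [oddTheta, ← tsum_neg]
    refine tsum_congr fun m => ?_
    have h1 : ((-1 : ℂ)) ^ (-1 - m : ℤ) = -(-1 : ℂ) ^ m := by
      rw [zpow_sub₀ (by norm_num), zpow_neg_one]
      rcases Int.even_or_odd m with hm | hm
      · rw [hm.neg_one_zpow]; norm_num
      · rw [hm.neg_one_zpow]; norm_num
    simp only [Equiv.subLeft_apply, h1]
    push_cast
    have h2 : ((-1 - m : ℂ) + 1 / 2) ^ 2 = ((m : ℂ) + 1 / 2) ^ 2 := by ring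
    rw [h2]
    simp
  exact self_eq_neg.mp h

/-- Away from `α = 0`, the function `kroneckerReg` is `α F(ξ, α, τ)`. -/
theorem kroneckerReg_eq (ξ α : ℂ) (τ : ℍ) (hα : α ≠ 0) :
    kroneckerReg ξ τ α = α * kroneckerF ξ α τ := by
  rw [kroneckerReg, kroneckerF, dslope_of_ne _ hα, slope_def_field, oddTheta_zero, sub_zero,
    sub_zero]
  field_simp

/-- The regularized value does not depend on the chosen expansion. -/
theorem IsRegularizedValue.unique {r : ℕ} {J : ℝ → ℂ} {a b : ℂ}
    (ha : IsRegularizedValue r J a) (hb : IsRegularizedValue r J b) : a = b := by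
  obtain ⟨P, -, rfl, ν, hν, hP⟩ := ha
  obtain ⟨Q, -, rfl, μ, hμ, hQ⟩ := hb
  have hpow : ∀ x : ℝ, 0 < x → Tendsto (fun ε : ℝ => ε ^ x) (𝓝[>] 0) (𝓝 0) := fun x hx => by
    have := (Real.continuousAt_rpow_const 0 x (Or.inr hx.le)).tendsto
    rw [Real.zero_rpow hx.ne'] at this
    exact this.mono_left nhdsWithin_le_nhds
  have hsub : Tendsto (fun ε : ℝ => (Q - P).eval (Complex.log (-(2 * π * I * ε))))
      (𝓝[>] (0 : ℝ)) (𝓝 0) := by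
    have h := (hP.trans_tendsto (hpow ν hν)).sub (hQ.trans_tendsto (hpow μ hμ))
    rw [sub_zero] at h
    refine h.congr fun ε => ?_
    simp
  have hlog : Tendsto (fun ε : ℝ => ‖Complex.log (-(2 * π * I * ε))‖) (𝓝[>] (0 : ℝ)) atTop := by
    have h1 : Tendsto (fun ε : ℝ => -Real.log (2 * π * ε)) (𝓝[>] (0 : ℝ)) atTop := by
      refine tendsto_neg_atBot_atTop.comp (Real.tendsto_log_nhdsGT_zero.comp ?_)
      refine tendsto_nhdsWithin_iff.mpr ⟨?_, ?_⟩
      · have : Tendsto (fun ε : ℝ => 2 * π * ε) (𝓝 0) (𝓝 (2 * π * 0)) :=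
          (continuous_const.mul continuous_id).tendsto 0
        rw [mul_zero] at this
        exact this.mono_left nhdsWithin_le_nhds
      · filter_upwards [self_mem_nhdsWithin] with ε hε
        exact mul_pos Real.two_pi_pos hε
    refine tendsto_atTop_mono' _ ?_ h1
    filter_upwards [self_mem_nhdsWithin] with ε hε
    have hε' : (0 : ℝ) < ε := hε
    refine le_trans ?_ (Complex.abs_re_le_norm _)
    rw [Complex.log_re]
    have : ‖-(2 * π * I * (ε : ℂ))‖ = 2 * π * ε := by
      simp [abs_of_pos Real.pi_pos, abs_of_pos hε']
    rw [this]
    exact neg_le_abs _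
  have hconst : ¬ 0 < (Q - P).degree := fun hd =>
    not_tendsto_nhds_of_tendsto_atTop ((Q - P).tendsto_norm_atTop hd hlog) 0
      (by simpa using hsub.norm)
  rw [Polynomial.eq_C_of_degree_le_zero (not_lt.mp hconst)] at hsub
  simp only [Polynomial.eval_C] at hsub
  have := tendsto_nhds_unique hsub tendsto_const_nhds
  rw [Polynomial.coeff_sub] at this
  exact (sub_eq_zero.mp this.symm).symm

end

/-! ### Iterated derivatives and the slash action -/

section Bol

open Derivative

/-! On the real axis `r_τ` vanishes, so `ω_n` is the Kronecker coefficient `f_n`. Kronecker's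
Lambert series turns it, on `(0, 1)`, into a constant minus `2πi/(n-1)! · ∑ k^(n-1) (e(mt) + (-1)^n
e(-mt)) q^(mk)`, with a further pole term `-2πi/(1 - e(t))`, independent of `τ`, when `n = 1`. The
entries `0` only contribute a polynomial weight `t^q (1-t)^s`. Integration by parts therefore writes
a depth-one value as a constant plus a combination of Eichler series `∑ k^(n-1) m^(-b) q^(mk)` with
`1 ≤ b ≤ r - 1`, and the two signs of the frequency cancel unless `n + b` is even
(`exists_integral_omegaSeries`).

With `D = (2πi)⁻¹ d/dτ`, the `b`-th derivative of such a series is, up to a scalar, the Eisenstein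
series `E` of weight `n + b` without its constant term. Put `p = r - 1 ≥ b`. By `bol_identity`,
`D^(p+1)` carries the weight `-p` action to the weight `p + 2` action, and `D^(p+1)` of the series
is a multiple of `D^(p+1-b) E`. Translates of derivatives of `E` are combinations of `τ^a D^l E`
with `a`, `l` bounded (`iterate_D_slash_mem_quasiSpan`). So all translates lie among the
`(p+1)`-fold primitives of one finite-dimensional space, which are again finite-dimensional because
`D` kills only constants (`HasTameTranslates.of_iterate_D`). Multiplication by `τ` and taking
primitives preserve subexponential growth, so a basis of the span of translates that contains the
function is a vector-valued modular form.

For `n = 1` only `b = 1` is bad: it would need the non-modular weight two Eisenstein series. Its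
coefficient depends only on the end point values of the weight polynomial, and the correction in `Â`
cancels exactly this term.

Kronecker's formula is proved without product expansions: the Laurent coefficients of theta times
Lambert series obey the first-order recursion of a translated theta series (`theta_mul_lambert`);
analytic continuation to `α = 0` then gives `kroneckerReg_eventuallyEq`. -/

theorem mdifferentiable_iterate_D {f : ℍ → ℂ} (hf : MDiff f) (n : ℕ) : MDiff (D^[n] f) := by
  induction n with
  | zero => exact hf
  | succ n ih =>
    rw [Function.iterate_succ_apply']
    exact normalizedDerivOfComplex_mdifferentiable ih

theorem mdifferentiable_const_mul {f : ℍ → ℂ} (c : ℂ) (hf : MDiff f) : MDiff (c • f) :=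
  hf.const_smul c

theorem iterate_D_add {f g : ℍ → ℂ} (hf : MDiff f) (hg : MDiff g) (n : ℕ) :
    D^[n] (f + g) = D^[n] f + D^[n] g := by
  induction n with
  | zero => rfl
  | succ n ih =>
    simp only [Function.iterate_succ_apply', ih]
    exact normalizedDerivOfComplex_add _ _ (mdifferentiable_iterate_D hf n)
      (mdifferentiable_iterate_D hg n)

theorem iterate_D_smul {f : ℍ → ℂ} (hf : MDiff f) (c : ℂ) (n : ℕ) :
    D^[n] (c • f) = c • D^[n] f := by
  induction n with
  | zero => rfl
  | succ n ih =>
    simp only [Function.iterate_succ_apply', ih]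
    exact normalizedDerivOfComplex_smul _ _ (mdifferentiable_iterate_D hf n)

theorem D_const (c : ℂ) : D (fun _ : ℍ => c) = 0 := normalizedDerivOfComplex_const c

theorem D_zero : D (0 : ℍ → ℂ) = 0 := D_const 0

theorem iterate_D_zero (n : ℕ) : D^[n] (0 : ℍ → ℂ) = 0 := by
  induction n with
  | zero => rfl
  | succ n ih => rw [Function.iterate_succ_apply', ih, D_zero]

/-- The inclusion of the upper half-plane as a function. -/
def coeFun : ℍ → ℂ := fun τ => (τ : ℂ)

theorem mdifferentiable_coeFun : MDiff coeFun := UpperHalfPlane.mdifferentiable_coe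

theorem D_coeFun : D coeFun = fun _ => (2 * π * I)⁻¹ := by
  ext z
  have h : (coeFun ∘ ofComplex) =ᶠ[𝓝 (z : ℂ)] id := by
    filter_upwards [isOpen_upperHalfPlaneSet.mem_nhds z.im_pos] with w hw
    simp [coeFun, ofComplex_apply_of_im_pos hw]
  simp [normalizedDerivOfComplex, h.deriv_eq]

/-- The automorphy factor `τ ↦ cτ + d`. -/
def autFactor (γ : SL(2, ℤ)) : ℍ → ℂ := fun τ => denom γ τ

theorem autFactor_eq (γ : SL(2, ℤ)) :
    autFactor γ = (γ 1 0 : ℂ) • coeFun + fun _ => (γ 1 1 : ℂ) := by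
  ext τ
  simp [autFactor, coeFun, ModularGroup.denom_apply]

theorem autFactor_ne_zero (γ : SL(2, ℤ)) (τ : ℍ) : autFactor γ τ ≠ 0 := denom_ne_zero _ _

theorem mdifferentiable_autFactor (γ : SL(2, ℤ)) : MDiff (autFactor γ) := by
  rw [autFactor_eq]
  exact (mdifferentiable_const_mul _ mdifferentiable_coeFun).add mdifferentiable_const

theorem D_autFactor (γ : SL(2, ℤ)) :
    D (autFactor γ) = fun _ => (γ 1 0 : ℂ) * (2 * π * I)⁻¹ := by
  rw [autFactor_eq, normalizedDerivOfComplex_add _ _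
    (mdifferentiable_const_mul _ mdifferentiable_coeFun) mdifferentiable_const,
    normalizedDerivOfComplex_smul _ _ mdifferentiable_coeFun, D_coeFun, D_const]
  ext; simp

theorem slash_pred (k : ℤ) (f : ℍ → ℂ) (γ : SL(2, ℤ)) :
    f ∣[k - 1] γ = autFactor γ * f ∣[k] γ := by
  ext τ
  have h := autFactor_ne_zero γ τ
  simp only [ModularForm.SL_slash_apply, Pi.mul_apply]
  change _ * autFactor γ τ ^ _ = autFactor γ τ * (_ * autFactor γ τ ^ _)
  rw [show -(k - 1) = -k + 1 by ring, zpow_add₀ h, zpow_one]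
  ring

theorem slash_sub_natCast (k : ℤ) (n : ℕ) (f : ℍ → ℂ) (γ : SL(2, ℤ)) :
    f ∣[k - n] γ = autFactor γ ^ n * f ∣[k] γ := by
  induction n with
  | zero => simp
  | succ n ih =>
    rw [show k - ((n + 1 : ℕ) : ℤ) = (k - n) - 1 by push_cast; ring, slash_pred, ih, pow_succ']
    ring

theorem mdifferentiable_slash {f : ℍ → ℂ} (hf : MDiff f) (k : ℤ) (γ : SL(2, ℤ)) :
    MDiff (f ∣[k] γ) := by
  rw [ModularForm.SL_slash]
  exact hf.slash k _

/-- The chain rule for the slash action, multiplied by `cτ + d`: this lowers the weight on the right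
from `k + 2` to `k + 1` and leaves no denominators. -/
theorem D_slash {f : ℍ → ℂ} (hf : MDiff f) (k : ℤ) (γ : SL(2, ℤ)) :
    autFactor γ * D (f ∣[k] γ) =
      D f ∣[k + 1] γ - (k * ((γ 1 0 : ℂ) * (2 * π * I)⁻¹)) • f ∣[k] γ := by
  rw [normalizedDerivOfComplex_SL_slash hf, show k + 1 = k + 2 - 1 by ring, slash_pred]
  ext τ
  have h := autFactor_ne_zero γ τ
  simp only [autFactor] at h
  simp only [Pi.mul_apply, Pi.sub_apply, Pi.smul_apply, smul_eq_mul, autFactor]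
  field_simp

/-- The Leibniz rule stops after two terms because `cτ + d` is affine in `τ`. -/
theorem iterate_D_autFactor_mul (γ : SL(2, ℤ)) {g : ℍ → ℂ} (hg : MDiff g) (n : ℕ) :
    D^[n + 1] (autFactor γ * g) = autFactor γ * D^[n + 1] g
      + ((n + 1) * ((γ 1 0 : ℂ) * (2 * π * I)⁻¹)) • D^[n] g := by
  have key : ∀ h : ℍ → ℂ, MDiff h →
      D (autFactor γ * h) = autFactor γ * D h + ((γ 1 0 : ℂ) * (2 * π * I)⁻¹) • h := by
    intro h hh
    rw [normalizedDerivOfComplex_mul _ _ (mdifferentiable_autFactor γ) hh, D_autFactor]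
    ext; simp; ring
  induction n with
  | zero => simpa using key g hg
  | succ n ih =>
    have h1 := mdifferentiable_iterate_D hg (n + 1)
    have h0 := mdifferentiable_iterate_D hg n
    rw [Function.iterate_succ_apply', ih,
      normalizedDerivOfComplex_add _ _ ((mdifferentiable_autFactor γ).mul h1)
        (mdifferentiable_const_mul _ h0),
      key _ h1, normalizedDerivOfComplex_smul _ _ h0, ← Function.iterate_succ_apply' D (n + 1),
      ← Function.iterate_succ_apply' D n]
    ext; simp; ring

/-- Bol's identity. -/
theorem bol_identity {f : ℍ → ℂ} (hf : MDiff f) (p : ℕ) (γ : SL(2, ℤ)) :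
    D^[p + 1] (f ∣[-(p : ℤ)] γ) = (D^[p + 1] f) ∣[(p : ℤ) + 2] γ := by
  induction p with
  | zero =>
    ext τ
    have := congrFun (normalizedDerivOfComplex_SL_slash (k := 0) hf (γ := γ)) τ
    simpa using this
  | succ p ih =>
    have hs := mdifferentiable_slash hf (-(p : ℤ)) γ
    -- The Leibniz rule contributes `(p + 2) c/(2πi)` times the `(p+1)`-st derivative, and `D_slash`
    -- in weight `p + 2` contributes its negative; the cancellation is special to this weight.
    rw [show -((p + 1 : ℕ) : ℤ) = -(p : ℤ) - 1 by push_cast; ring, slash_pred,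
      iterate_D_autFactor_mul γ hs, Function.iterate_succ_apply' D (p + 1), ih,
      D_slash (mdifferentiable_iterate_D hf (p + 1)), ← Function.iterate_succ_apply' D (p + 1)]
    have : ((p + 1 : ℕ) : ℤ) + 2 = (p : ℤ) + 2 + 1 := by push_cast; ring
    rw [this]
    ext; simp; ring

/-! ### Quasimodularity of the derivatives of a modular form -/

/-- The span of the functions `τ^a (D^l E)` with `a ≤ A` and `l ≤ L`. -/
def quasiSpan (E : ℍ → ℂ) (A L : ℕ) : Submodule ℂ (ℍ → ℂ) :=
  Submodule.span ℂ ((fun x : ℕ × ℕ => coeFun ^ x.1 * D^[x.2] E) '' (Set.Iic A ×ˢ Set.Iic L))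

instance (E : ℍ → ℂ) (A L : ℕ) : FiniteDimensional ℂ (quasiSpan E A L) :=
  FiniteDimensional.span_of_finite ℂ (((Set.finite_Iic A).prod (Set.finite_Iic L)).image _)

theorem mem_quasiSpan (E : ℍ → ℂ) {A L a l : ℕ} (ha : a ≤ A) (hl : l ≤ L) :
    coeFun ^ a * D^[l] E ∈ quasiSpan E A L :=
  Submodule.subset_span ⟨(a, l), ⟨ha, hl⟩, rfl⟩

theorem quasiSpan_mono (E : ℍ → ℂ) {A L A' L' : ℕ} (hA : A ≤ A') (hL : L ≤ L') :
    quasiSpan E A L ≤ quasiSpan E A' L' :=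
  Submodule.span_mono <| Set.image_mono <|
    Set.prod_mono (Set.Iic_subset_Iic.2 hA) (Set.Iic_subset_Iic.2 hL)

theorem mdifferentiable_of_mem_quasiSpan {E : ℍ → ℂ} (hE : MDiff E) {A L : ℕ} {f : ℍ → ℂ}
    (hf : f ∈ quasiSpan E A L) : MDiff f := by
  induction hf using Submodule.span_induction with
  | mem x h =>
    obtain ⟨⟨a, l⟩, -, rfl⟩ := h
    exact (mdifferentiable_coeFun.pow a).mul (mdifferentiable_iterate_D hE l)
  | zero => exact mdifferentiable_const
  | add x y _ _ hx hy => exact hx.add hy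
  | smul c x _ hx => exact mdifferentiable_const_mul c hx

theorem autFactor_mul_mem_quasiSpan (γ : SL(2, ℤ)) {E : ℍ → ℂ} {A L : ℕ} {f : ℍ → ℂ}
    (hf : f ∈ quasiSpan E A L) : autFactor γ * f ∈ quasiSpan E (A + 1) L := by
  induction hf using Submodule.span_induction with
  | mem x h =>
    obtain ⟨⟨a, l⟩, ⟨ha, hl⟩, rfl⟩ := h
    have : autFactor γ * (coeFun ^ a * D^[l] E) =
        (γ 1 0 : ℂ) • (coeFun ^ (a + 1) * D^[l] E) + (γ 1 1 : ℂ) • (coeFun ^ a * D^[l] E) := by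
      rw [autFactor_eq]; ext; simp; ring
    simp only [Set.mem_Iic] at ha hl
    rw [this]
    exact add_mem (Submodule.smul_mem _ _ (mem_quasiSpan E (by omega) hl))
      (Submodule.smul_mem _ _ (mem_quasiSpan E (by omega) hl))
  | zero => simp
  | add x y _ _ hx hy => rw [mul_add]; exact add_mem hx hy
  | smul c x _ hx => rw [mul_smul_comm]; exact Submodule.smul_mem _ _ hx

theorem autFactor_pow_mul_mem_quasiSpan (γ : SL(2, ℤ)) {E : ℍ → ℂ} {A L : ℕ} {f : ℍ → ℂ}
    (hf : f ∈ quasiSpan E A L) (n : ℕ) : autFactor γ ^ n * f ∈ quasiSpan E (A + n) L := by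
  induction n with
  | zero => simpa using hf
  | succ n ih =>
    rw [pow_succ', mul_assoc]
    exact autFactor_mul_mem_quasiSpan γ ih

theorem D_mem_quasiSpan {E : ℍ → ℂ} (hE : MDiff E) {A L : ℕ} {f : ℍ → ℂ}
    (hf : f ∈ quasiSpan E A L) : D f ∈ quasiSpan E A (L + 1) := by
  induction hf using Submodule.span_induction with
  | mem x h =>
    obtain ⟨⟨a, l⟩, ⟨ha, hl⟩, rfl⟩ := h
    simp only [Set.mem_Iic] at ha hl
    have : D (coeFun ^ a * D^[l] E) = (a * (2 * π * I)⁻¹ : ℂ) • (coeFun ^ (a - 1) * D^[l] E)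
        + coeFun ^ a * D^[l + 1] E := by
      rw [normalizedDerivOfComplex_mul _ _ (mdifferentiable_coeFun.pow a)
        (mdifferentiable_iterate_D hE l), normalizedDerivOfComplex_pow _ _ mdifferentiable_coeFun,
        D_coeFun, Function.iterate_succ_apply']
      ext; simp; ring
    rw [this]
    exact add_mem (Submodule.smul_mem _ _ (mem_quasiSpan E (by omega) (by omega)))
      (mem_quasiSpan E ha (by omega))
  | zero => rw [D_zero]; exact zero_mem _
  | add x y hx' hy' hx hy =>
    rw [normalizedDerivOfComplex_add _ _ (mdifferentiable_of_mem_quasiSpan hE hx')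
      (mdifferentiable_of_mem_quasiSpan hE hy')]
    exact add_mem hx hy
  | smul c x hx' hx =>
    rw [normalizedDerivOfComplex_smul _ _ (mdifferentiable_of_mem_quasiSpan hE hx')]
    exact Submodule.smul_mem _ _ hx

/-- The translates of a derivative of a modular form are quasimodular. -/
theorem iterate_D_slash_mem_quasiSpan {E : ℍ → ℂ} (hE : MDiff E) {k : ℤ} {γ : SL(2, ℤ)}
    (hγ : E ∣[k] γ = E) (i : ℕ) : (D^[i] E) ∣[k + i] γ ∈ quasiSpan E i i := by
  induction i with
  | zero =>
    have := mem_quasiSpan E (le_refl 0) (le_refl 0)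
    simpa [hγ] using this
  | succ i ih =>
    -- The natural weight of `D^i E` is `k + 2i`, where negative powers of `cτ + d` occur; in weight
    -- `k + i` they are cleared, at the price of degree `i` in `τ`.
    have h := D_slash (mdifferentiable_iterate_D hE i) (k + i) γ
    rw [eq_sub_iff_add_eq, ← Function.iterate_succ_apply' D] at h
    rw [show k + ((i + 1 : ℕ) : ℤ) = k + i + 1 by push_cast; ring, ← h]
    exact add_mem (autFactor_mul_mem_quasiSpan γ (D_mem_quasiSpan hE ih))
      (Submodule.smul_mem _ _ (quasiSpan_mono E (by omega) (by omega) ih))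

/-- Lowering the weight by `n` more multiplies by `(cτ + d)^n`, hence costs `n` more powers of `τ`.
-/
theorem iterate_D_slash_mem_quasiSpan' {E : ℍ → ℂ} (hE : MDiff E) {k : ℤ} {γ : SL(2, ℤ)}
    (hγ : E ∣[k] γ = E) (i n : ℕ) : (D^[i] E) ∣[k + i - n] γ ∈ quasiSpan E (i + n) i := by
  rw [slash_sub_natCast]
  exact autFactor_pow_mul_mem_quasiSpan γ (iterate_D_slash_mem_quasiSpan hE hγ i) n

end Bol

/-! ### Holomorphic functions of subexponential growth -/

section Tame

open Derivative

theorem isBigO_strip_iff {f : ℍ → ℂ} {g : ℍ → ℝ} {C : ℝ} :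
    f =O[atImInfty ⊓ 𝓟 {τ : ℍ | |τ.re| ≤ C}] g ↔
      ∃ M Y : ℝ, ∀ τ : ℍ, |τ.re| ≤ C → Y ≤ τ.im → ‖f τ‖ ≤ M * ‖g τ‖ := by
  simp only [isBigO_iff, eventually_inf_principal]
  refine exists_congr fun M => ?_
  rw [Filter.Eventually, atImInfty_mem]
  simp only [Set.mem_ofPred_eq]
  exact exists_congr fun Y => forall_congr' fun τ => forall_comm

/-- The holomorphic functions on the upper half-plane which grow subexponentially in vertical
strips. -/
def tameSubmodule : Submodule ℂ (ℍ → ℂ) where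
  carrier := {f | MDiff f ∧ ∀ (C ε : ℝ), 0 < ε →
    f =O[atImInfty ⊓ 𝓟 {τ : ℍ | |τ.re| ≤ C}] fun τ : ℍ => Real.exp (ε * τ.im)}
  zero_mem' := ⟨mdifferentiable_const, fun _ _ _ => isBigO_zero _ _⟩
  add_mem' := fun hf hg => ⟨hf.1.add hg.1, fun C ε hε => (hf.2 C ε hε).add (hg.2 C ε hε)⟩
  smul_mem' := fun c _ hf => ⟨mdifferentiable_const_mul c hf.1,
    fun C ε hε => (hf.2 C ε hε).const_smul_left c⟩

theorem linear_le_exp {ε : ℝ} (hε : 0 < ε) (C y : ℝ) (hC : 0 ≤ C) :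
    C + y ≤ (C + 1 / ε) * Real.exp (ε * |y|) := by
  have h1 : ε * |y| + 1 ≤ Real.exp (ε * |y|) := Real.add_one_le_exp _
  have h0 : 0 ≤ ε * |y| := by positivity
  have h2 : |y| = 1 / ε * (ε * |y|) := by field_simp
  have h3 : |y| ≤ 1 / ε * Real.exp (ε * |y|) := by
    rw [h2]
    refine mul_le_mul_of_nonneg_left ?_ (by positivity)
    rw [← h2]; linarith
  have h4 : C ≤ C * Real.exp (ε * |y|) := le_mul_of_one_le_right hC (by linarith)
  nlinarith [le_abs_self y]

theorem norm_coe_le_of_abs_re_le {C : ℝ} {τ : ℍ} (h : |τ.re| ≤ C) : ‖(τ : ℂ)‖ ≤ C + τ.im := by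
  have := Complex.norm_le_abs_re_add_abs_im (τ : ℂ)
  rw [UpperHalfPlane.coe_re, UpperHalfPlane.coe_im, abs_of_pos τ.im_pos] at this
  linarith

/-- On a vertical strip `‖τ‖ ≤ C + Im τ`. Half of `ε` absorbs this linear factor, the other half
bounds `f`. -/
theorem coeFun_mul_mem_tame {f : ℍ → ℂ} (hf : f ∈ tameSubmodule) :
    coeFun * f ∈ tameSubmodule := by
  refine ⟨mdifferentiable_coeFun.mul hf.1, fun C ε hε => ?_⟩
  obtain ⟨M, Y, h⟩ := isBigO_strip_iff.1 (hf.2 C (ε / 2) (by positivity))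
  refine isBigO_strip_iff.2 ⟨(|C| + 1 / (ε / 2)) * M, Y, fun τ hre him => ?_⟩
  have h1 := h τ hre him
  have h2 := linear_le_exp (half_pos hε) |C| τ.im (abs_nonneg C)
  have h3 := norm_coe_le_of_abs_re_le (hre.trans (le_abs_self C))
  rw [Real.norm_of_nonneg (Real.exp_nonneg _)] at h1 ⊢
  rw [abs_of_pos τ.im_pos] at h2
  rw [Pi.mul_apply, norm_mul]
  calc ‖coeFun τ‖ * ‖f τ‖ ≤ ((|C| + 1 / (ε / 2)) * Real.exp (ε / 2 * τ.im)) *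
        (M * Real.exp (ε / 2 * τ.im)) :=
        mul_le_mul (h3.trans h2) h1 (norm_nonneg _) (by positivity)
    _ = (|C| + 1 / (ε / 2)) * M * Real.exp (ε * τ.im) := by
        rw [show ε * τ.im = ε / 2 * τ.im + ε / 2 * τ.im by ring, Real.exp_add]; ring

theorem coeFun_pow_mul_mem_tame {f : ℍ → ℂ} (hf : f ∈ tameSubmodule) (n : ℕ) :
    coeFun ^ n * f ∈ tameSubmodule := by
  induction n with
  | zero => simpa using hf
  | succ n ih => rw [pow_succ', mul_assoc]; exact coeFun_mul_mem_tame ih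

theorem quasiSpan_le_tame {E : ℍ → ℂ} (hE : ∀ l, D^[l] E ∈ tameSubmodule) (A L : ℕ) :
    quasiSpan E A L ≤ tameSubmodule := by
  refine Submodule.span_le.2 ?_
  rintro _ ⟨⟨a, l⟩, -, rfl⟩
  exact coeFun_pow_mul_mem_tame (hE l) a

/-- Mean value inequality on the rectangle between a fixed height `y₀` and the height of `τ`: the
bound for the derivative is largest at the top, and the distance to the base point is again linear
in `Im τ`. -/
theorem mem_tame_of_D_mem_tame {f : ℍ → ℂ} (hf : MDiff f) (hD : D f ∈ tameSubmodule) :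
    f ∈ tameSubmodule := by
  refine ⟨hf, fun C ε hε => ?_⟩
  obtain ⟨M, Y, h⟩ := isBigO_strip_iff.1 (hD.2 |C| (ε / 2) (by positivity))
  set y₀ := max Y 1 with hy₀
  have hy₀pos : 0 < y₀ := lt_of_lt_of_le one_pos (le_max_right _ _)
  set τ₀ : ℍ := ⟨⟨0, y₀⟩, hy₀pos⟩ with hτ₀
  have hd : ∀ z : ℂ, 0 < z.im → DifferentiableAt ℂ (f ∘ ofComplex) z := fun z hz =>
    (UpperHalfPlane.mdifferentiable_iff.1 hf).differentiableAt
      (isOpen_upperHalfPlaneSet.mem_nhds hz)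
  have hpi : ‖(2 * π * I : ℂ)‖ = 2 * π := by simp [abs_of_pos Real.pi_pos]
  have key : ∀ τ : ℍ, |τ.re| ≤ C → y₀ ≤ τ.im →
      ‖f τ - f τ₀‖ ≤ 2 * π * |M| * Real.exp (ε / 2 * τ.im) * ‖(τ : ℂ) - τ₀‖ := by
    intro τ hre him
    set S : Set ℂ := {z | z.re ∈ Set.Icc (-|C|) |C| ∧ z.im ∈ Set.Icc y₀ τ.im} with hS
    have hconv : Convex ℝ S := by
      have h1 := (convex_Icc (-|C|) |C|).linear_preimage Complex.reLm
      have h2 := (convex_Icc y₀ τ.im).linear_preimage Complex.imLm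
      exact h1.inter h2
    have hb : ∀ z ∈ S, ‖deriv (f ∘ ofComplex) z‖ ≤ 2 * π * |M| * Real.exp (ε / 2 * τ.im) := by
      rintro z ⟨hz1, hz2⟩
      have hzpos : 0 < z.im := hy₀pos.trans_le hz2.1
      have h1 := h ⟨z, hzpos⟩ (abs_le.2 hz1) ((le_max_left _ _).trans hz2.1)
      have h2 : deriv (f ∘ ofComplex) z = 2 * π * I * D f ⟨z, hzpos⟩ := by
        simp [normalizedDerivOfComplex, field]
      rw [h2, norm_mul, hpi, mul_assoc, mul_assoc]
      rw [← mul_assoc]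
      refine mul_le_mul_of_nonneg_left (h1.trans ?_) (by positivity)
      rw [Real.norm_of_nonneg (Real.exp_nonneg _)]
      have h3 : Real.exp (ε / 2 * z.im) ≤ Real.exp (ε / 2 * τ.im) :=
        Real.exp_le_exp.2 (mul_le_mul_of_nonneg_left hz2.2 (by positivity))
      exact mul_le_mul (le_abs_self M) h3 (Real.exp_nonneg _) (abs_nonneg _)
    have hτS : (τ : ℂ) ∈ S := ⟨abs_le.1 (hre.trans (le_abs_self C)), him, le_rfl⟩
    have hτ₀S : (τ₀ : ℂ) ∈ S := ⟨⟨by simp [hτ₀], by simp [hτ₀]⟩, le_rfl, him⟩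
    have := hconv.norm_image_sub_le_of_norm_deriv_le (f := f ∘ ofComplex)
      (fun z hz => hd z (hy₀pos.trans_le hz.2.1)) hb hτ₀S hτS
    simpa using this
  refine isBigO_strip_iff.2 ⟨‖f τ₀‖ + 2 * π * |M| * (|C| + y₀ + 1 / (ε / 2)), y₀,
    fun τ hre him => ?_⟩
  have h1 := key τ hre him
  have h2 := linear_le_exp (half_pos hε) (|C| + y₀) τ.im (by positivity)
  have h3 := norm_coe_le_of_abs_re_le (hre.trans (le_abs_self C))
  have h4 : ‖(τ₀ : ℂ)‖ ≤ y₀ := by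
    have := norm_coe_le_of_abs_re_le (C := 0) (τ := τ₀) (by simp [hτ₀])
    simpa [hτ₀] using this
  rw [Real.norm_of_nonneg (Real.exp_nonneg _)]
  rw [abs_of_pos τ.im_pos] at h2
  have h5 : ‖(τ : ℂ) - τ₀‖ ≤ (|C| + y₀ + 1 / (ε / 2)) * Real.exp (ε / 2 * τ.im) := by
    refine (norm_sub_le _ _).trans (le_trans ?_ h2)
    linarith
  have h6 : ‖f τ‖ ≤ ‖f τ₀‖ + ‖f τ - f τ₀‖ := by
    have := norm_add_le (f τ₀) (f τ - f τ₀)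
    simpa using this
  have h7 : 1 ≤ Real.exp (ε * τ.im) := Real.one_le_exp (by have := τ.im_pos; positivity)
  calc ‖f τ‖ ≤ ‖f τ₀‖ * Real.exp (ε * τ.im) + 2 * π * |M| * Real.exp (ε / 2 * τ.im) *
        ((|C| + y₀ + 1 / (ε / 2)) * Real.exp (ε / 2 * τ.im)) := by
        refine h6.trans (add_le_add (le_mul_of_one_le_right (norm_nonneg _) h7) (h1.trans ?_))
        exact mul_le_mul_of_nonneg_left h5 (by positivity)
    _ = _ := by
        rw [show ε * τ.im = ε / 2 * τ.im + ε / 2 * τ.im by ring, Real.exp_add]; ring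

/-! ### Iterated primitives of a finite-dimensional space -/

/-- The holomorphic functions with derivative in a given space. -/
def primitives (U : Submodule ℂ (ℍ → ℂ)) : Submodule ℂ (ℍ → ℂ) where
  carrier := {f | MDiff f ∧ D f ∈ U}
  zero_mem' := ⟨mdifferentiable_const, by rw [D_zero]; exact zero_mem _⟩
  add_mem' := fun hf hg => ⟨hf.1.add hg.1, by
    rw [normalizedDerivOfComplex_add _ _ hf.1 hg.1]; exact add_mem hf.2 hg.2⟩
  smul_mem' := fun c f hf => ⟨mdifferentiable_const_mul c hf.1, by
    rw [normalizedDerivOfComplex_smul _ _ hf.1]; exact Submodule.smul_mem _ _ hf.2⟩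

theorem eq_const_of_D_eq_zero {f : ℍ → ℂ} (hf : MDiff f) (h : D f = 0) :
    ∃ c : ℂ, f = fun _ => c := by
  have hd := UpperHalfPlane.mdifferentiable_iff.1 hf
  have hconv : Convex ℝ {z : ℂ | 0 < z.im} := convex_halfSpace_im_gt 0
  refine ⟨f UpperHalfPlane.I, funext fun τ => ?_⟩
  have := hconv.norm_image_sub_le_of_norm_deriv_le (f := f ∘ ofComplex) (C := 0)
    (fun z hz => hd.differentiableAt (isOpen_upperHalfPlaneSet.mem_nhds hz))
    (fun z hz => by
      have := congrFun h ⟨z, hz⟩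
      simp [normalizedDerivOfComplex] at this
      simp [this]) (UpperHalfPlane.I.im_pos) τ.im_pos
  simp only [Function.comp_apply, ofComplex_apply, zero_mul, norm_le_zero_iff] at this
  exact sub_eq_zero.1 this

/-- `D` maps the primitives into `U`, and its kernel is contained in the line of constants. -/
theorem finiteDimensional_primitives (U : Submodule ℂ (ℍ → ℂ)) [FiniteDimensional ℂ U] :
    FiniteDimensional ℂ (primitives U) := by
  let T : primitives U →ₗ[ℂ] U :=
    { toFun := fun f => ⟨D f, f.2.2⟩
      map_add' := fun f g => Subtype.ext (normalizedDerivOfComplex_add _ _ f.2.1 g.2.1)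
      map_smul' := fun c f => Subtype.ext (normalizedDerivOfComplex_smul _ _ f.2.1) }
  have hker : T.ker ≤ Submodule.span ℂ {⟨fun _ => 1, mdifferentiable_const, by
      rw [D_const]; exact zero_mem _⟩} := by
    intro f hf
    obtain ⟨c, hc⟩ := eq_const_of_D_eq_zero f.2.1 (congrArg Subtype.val hf)
    refine Submodule.mem_span_singleton.2 ⟨c, Subtype.ext ?_⟩
    rw [hc]; ext; simp
  have : FiniteDimensional ℂ T.ker := Submodule.finiteDimensional_of_le hker
  have : FiniteDimensional ℂ T.range := inferInstance
  have : FiniteDimensional ℂ (primitives U ⧸ T.ker) := Module.Finite.equiv T.quotKerEquivRange.symm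
  exact Module.Finite.of_submodule_quotient T.ker

theorem iterate_primitives_finiteDimensional (n : ℕ) (U : Submodule ℂ (ℍ → ℂ))
    (hU : FiniteDimensional ℂ U) : FiniteDimensional ℂ ↥(primitives^[n] U) := by
  induction n with
  | zero => exact hU
  | succ n ih => rw [Function.iterate_succ_apply']; exact finiteDimensional_primitives _

theorem iterate_primitives_le_tame (n : ℕ) {U : Submodule ℂ (ℍ → ℂ)} (hU : U ≤ tameSubmodule) :
    primitives^[n] U ≤ tameSubmodule := by
  induction n with
  | zero => exact hU
  | succ n ih =>
    rw [Function.iterate_succ_apply']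
    exact fun f hf => mem_tame_of_D_mem_tame hf.1 (ih hf.2)

theorem mem_iterate_primitives (n : ℕ) {U : Submodule ℂ (ℍ → ℂ)} {f : ℍ → ℂ} (hf : MDiff f)
    (h : D^[n] f ∈ U) : f ∈ primitives^[n] U := by
  induction n generalizing U with
  | zero => exact h
  | succ n ih =>
    rw [Function.iterate_succ_apply]
    refine ih ⟨mdifferentiable_iterate_D hf n, ?_⟩
    rwa [← Function.iterate_succ_apply' D]

/-! ### Functions whose translates span a finite-dimensional space -/

/-- The translates of `f` in weight `k` lie in a finite-dimensional space of holomorphic functions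
of subexponential growth. -/
def HasTameTranslates (k : ℤ) (f : ℍ → ℂ) : Prop :=
  ∃ W : Submodule ℂ (ℍ → ℂ), FiniteDimensional ℂ W ∧ W ≤ tameSubmodule ∧
    ∀ γ : SL(2, ℤ), f ∣[k] γ ∈ W

theorem HasTameTranslates.add {k : ℤ} {f g : ℍ → ℂ} (hf : HasTameTranslates k f)
    (hg : HasTameTranslates k g) : HasTameTranslates k (f + g) := by
  obtain ⟨W, hW, hW', h⟩ := hf
  obtain ⟨V, hV, hV', h'⟩ := hg
  refine ⟨W ⊔ V, inferInstance, sup_le hW' hV', fun γ => ?_⟩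
  rw [SlashAction.add_slash]
  exact Submodule.add_mem_sup (h γ) (h' γ)

theorem HasTameTranslates.smul {k : ℤ} {f : ℍ → ℂ} (hf : HasTameTranslates k f) (c : ℂ) :
    HasTameTranslates k (c • f) := by
  obtain ⟨W, hW, hW', h⟩ := hf
  refine ⟨W, hW, hW', fun γ => ?_⟩
  rw [ModularForm.SL_smul_slash]
  exact W.smul_mem c (h γ)

theorem HasTameTranslates.sum {k : ℤ} {ι : Type*} (s : Finset ι) {f : ι → ℍ → ℂ}
    (h0 : HasTameTranslates k 0) (hf : ∀ i ∈ s, HasTameTranslates k (f i)) :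
    HasTameTranslates k (∑ i ∈ s, f i) := by
  classical
  induction s using Finset.induction_on with
  | empty => simpa using h0
  | insert a s ha ih =>
    rw [Finset.sum_insert ha]
    exact (hf a (by simp)).add (ih fun i hi => hf i (by simp [hi]))

/-- Bol's identity moves the question to weight `p + 2`, where the translates of `D^i E` lie in a
`quasiSpan` that does not depend on `γ`; `p + 1` primitives lead back to `f`. -/
theorem HasTameTranslates.of_iterate_D {p : ℕ} {f E : ℍ → ℂ} (hf : MDiff f)
    (hE : ∀ l, D^[l] E ∈ tameSubmodule) {k : ℤ} (hEk : ∀ γ : SL(2, ℤ), E ∣[k] γ = E) {c : ℂ}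
    {i n : ℕ} (h : D^[p + 1] f = c • D^[i] E) (hk : k + i - n = p + 2) :
    HasTameTranslates (-(p : ℤ)) f := by
  refine ⟨primitives^[p + 1] (quasiSpan E (i + n) i),
    iterate_primitives_finiteDimensional _ _ inferInstance,
    iterate_primitives_le_tame _ (quasiSpan_le_tame hE _ _), fun γ =>
    mem_iterate_primitives _ (mdifferentiable_slash hf _ _) ?_⟩
  rw [bol_identity hf, h, ModularForm.SL_smul_slash, ← hk]
  exact Submodule.smul_mem _ _ (iterate_D_slash_mem_quasiSpan' (hE 0).1 (hEk γ) i n)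

theorem HasTameTranslates.const (p : ℕ) (c : ℂ) : HasTameTranslates (-(p : ℤ)) fun _ => c := by
  -- Derivatives of a constant vanish, so `E = 0` serves; `k = p + 2` is chosen only to balance the
  -- weights.
  refine HasTameTranslates.of_iterate_D (E := 0) (k := p + 2) (c := 0) (i := 0) (n := 0)
    mdifferentiable_const (fun l => ?_) (fun γ => ?_) ?_ (by simp)
  · rw [iterate_D_zero]; exact zero_mem _
  · simp
  · rw [Function.iterate_succ_apply, D_const, iterate_D_zero]; simp

end Tame

/-! ### Vector-valued modular forms from finite-dimensional spaces of translates -/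

section VectorValued

theorem mem_slashSpan_self (k : ℤ) (f : ℍ → ℂ) : f ∈ slashSpan k f :=
  Submodule.subset_span ⟨1, by simp⟩

theorem slash_mem_slashSpan {k : ℤ} {f g : ℍ → ℂ} (hg : g ∈ slashSpan k f) (γ : SL(2, ℤ)) :
    g ∣[k] γ ∈ slashSpan k f := by
  induction hg using Submodule.span_induction with
  | mem x h =>
    obtain ⟨δ, rfl⟩ := h
    rw [← SlashAction.slash_mul]
    exact Submodule.subset_span ⟨_, rfl⟩
  | zero => rw [SlashAction.zero_slash]; exact zero_mem _
  | add x y _ _ hx hy => rw [SlashAction.add_slash]; exact add_mem hx hy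
  | smul c x _ hx => rw [ModularForm.SL_smul_slash]; exact Submodule.smul_mem _ _ hx

theorem HasTameTranslates.slashSpan_le {k : ℤ} {f : ℍ → ℂ} {W : Submodule ℂ (ℍ → ℂ)}
    (h : ∀ γ : SL(2, ℤ), f ∣[k] γ ∈ W) : slashSpan k f ≤ W :=
  Submodule.span_le.2 (Set.range_subset_iff.2 h)

theorem HasTameTranslates.finiteDimensional {k : ℤ} {f : ℍ → ℂ} (hf : HasTameTranslates k f) :
    FiniteDimensional ℂ (slashSpan k f) := by
  obtain ⟨W, hW, -, h⟩ := hf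
  exact Submodule.finiteDimensional_of_le (slashSpan_le h)

/-- The action of `SL₂(ℤ)` on the span of the translates. -/
noncomputable def slashSpanMap (k : ℤ) (f : ℍ → ℂ) (γ : SL(2, ℤ)) :
    slashSpan k f →ₗ[ℂ] slashSpan k f where
  toFun g := ⟨(g : ℍ → ℂ) ∣[k] γ, slash_mem_slashSpan g.2 γ⟩
  map_add' _ _ := Subtype.ext (SlashAction.add_slash _ _ _ _)
  map_smul' _ _ := Subtype.ext (ModularForm.SL_smul_slash _ _ _ _)

/-- The slash operation is a right action, which reverses the order of the factors. -/
theorem slashSpanMap_mul (k : ℤ) (f : ℍ → ℂ) (γ δ : SL(2, ℤ)) :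
    slashSpanMap k f (γ * δ) = slashSpanMap k f δ * slashSpanMap k f γ :=
  LinearMap.ext fun g => Subtype.ext (SlashAction.slash_mul k γ δ (g : ℍ → ℂ))

theorem slashSpanMap_one (k : ℤ) (f : ℍ → ℂ) : slashSpanMap k f 1 = 1 :=
  LinearMap.ext fun g => Subtype.ext (SlashAction.slash_one k (g : ℍ → ℂ))

/-- This makes the given function itself, and not just a combination of components, a component of
the vector. -/
theorem exists_basis_apply_eq {V : Type*} [AddCommGroup V] [Module ℂ V] [FiniteDimensional ℂ V]
    {v : V} (hv : v ≠ 0) : ∃ (d : ℕ) (b : Module.Basis (Fin d) ℂ V) (i : Fin d), b i = v := by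
  have hs : LinearIndepOn ℂ id ({v} : Set V) := LinearIndepOn.singleton hv
  let b := Module.Basis.extend hs
  have hfin : Finite (hs.extend (Set.subset_univ _)) := Module.Finite.finite_basis b
  have := Fintype.ofFinite (hs.extend (Set.subset_univ _))
  refine ⟨_, b.reindex (Fintype.equivFin _), Fintype.equivFin _
    ⟨v, Module.Basis.subset_extend hs rfl⟩, ?_⟩
  simp [b]

theorem HasTameTranslates.isComponentOfVVMF {k : ℤ} {f : ℍ → ℂ} (hf : HasTameTranslates k f) :
    IsComponentOfVVMF k f := by
  -- The zero function belongs to no basis; it is a component of the zero form for the trivial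
  -- representation.
  by_cases h0 : f = 0
  · subst h0
    refine ⟨1, fun _ _ => 0, ⟨fun _ => mdifferentiable_const, ⟨1, fun γ i => ?_⟩,
      fun i C ε hε => isBigO_zero _ _⟩, 0, fun _ => rfl⟩
    rw [show (fun _ : ℍ => (0 : ℂ)) = 0 from rfl, SlashAction.zero_slash]
    rfl
  have hfd := hf.finiteDimensional
  obtain ⟨d, b, i, hi⟩ := exists_basis_apply_eq
    (v := (⟨f, mem_slashSpan_self k f⟩ : slashSpan k f)) (fun h => h0 (congrArg Subtype.val h))
  obtain ⟨W, -, hWt, hW⟩ := hf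
  have htame : ∀ j, (b j : ℍ → ℂ) ∈ tameSubmodule := fun j => hWt (slashSpan_le hW (b j).2)
  refine ⟨d, fun τ j => (b j : ℍ → ℂ) τ, ⟨fun j => (htame j).1, ⟨?_, ?_⟩,
    fun j C ε hε => (htame j).2 C ε hε⟩, i, fun τ => by simp only [hi]⟩
  · exact
    -- The transpose turns the right action into a representation. It is also the matrix that
    -- expresses each `b j ∣[k] γ` through the vector of basis functions.
    { toFun := fun γ => Matrix.toLin' (LinearMap.toMatrix b b (slashSpanMap k f γ)).transpose
      map_one' := by
        rw [slashSpanMap_one, LinearMap.toMatrix_one, Matrix.transpose_one, Matrix.toLin'_one]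
        rfl
      map_mul' := fun γ δ => by
        rw [slashSpanMap_mul, LinearMap.toMatrix_mul, Matrix.transpose_mul, Matrix.toLin'_mul]
        rfl }
  · intro γ j
    have h := b.sum_repr (slashSpanMap k f γ (b j))
    have h' := congrArg Subtype.val h
    ext τ
    have h'' := congrFun h' τ
    simp only [AddSubmonoidClass.coe_finsetSum, Submodule.coe_smul, Finset.sum_apply,
      Pi.smul_apply, smul_eq_mul] at h''
    refine h''.symm.trans ?_
    simp [Matrix.mulVec, dotProduct, LinearMap.toMatrix_apply]

end VectorValued

/-! ### `q`-series with polynomially bounded coefficients -/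

section QSeries

open Derivative
open scoped ArithmeticFunction.sigma

/-- The function `e(x) = exp(2πix)`. -/
noncomputable def expTwoPi (x : ℂ) : ℂ := cexp (2 * π * I * x)

theorem expTwoPi_add (x y : ℂ) : expTwoPi (x + y) = expTwoPi x * expTwoPi y := by
  rw [expTwoPi, mul_add, Complex.exp_add]; rfl

theorem expTwoPi_nat_mul (n : ℕ) (x : ℂ) : expTwoPi (n * x) = expTwoPi x ^ n := by
  rw [expTwoPi, expTwoPi, ← Complex.exp_nat_mul]; ring_nf

theorem norm_expTwoPi (x : ℂ) : ‖expTwoPi x‖ = Real.exp (-(2 * π * x.im)) := by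
  rw [expTwoPi, Complex.norm_exp]; simp

theorem norm_expTwoPi_coe_lt_one (τ : ℍ) : ‖expTwoPi τ‖ < 1 :=
  UpperHalfPlane.norm_exp_two_pi_I_lt_one τ

theorem hasDerivAt_expTwoPi_mul (n x : ℂ) :
    HasDerivAt (fun x => expTwoPi (n * x)) (2 * π * I * n * expTwoPi (n * x)) x := by
  have h : HasDerivAt (fun x : ℂ => 2 * π * I * (n * x)) (2 * π * I * n) x := by
    simpa using ((hasDerivAt_id x).const_mul n).const_mul (2 * π * I : ℂ)
  have := h.cexp
  exact this.congr_deriv (mul_comm _ _)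

/-- A sequence of at most polynomial growth. -/
def PolyBounded (a : ℕ → ℂ) : Prop := ∃ (C : ℝ) (K : ℕ), ∀ N : ℕ, ‖a N‖ ≤ C * (N : ℝ) ^ K

theorem PolyBounded.natCast_mul {a : ℕ → ℂ} (ha : PolyBounded a) :
    PolyBounded fun N => (N : ℂ) * a N := by
  obtain ⟨C, K, h⟩ := ha
  refine ⟨C, K + 1, fun N => ?_⟩
  rw [norm_mul, Complex.norm_natCast]
  calc (N : ℝ) * ‖a N‖ ≤ N * (C * (N : ℝ) ^ K) := by gcongr; exact h N
    _ = _ := by ring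

theorem PolyBounded.natCast_pow_mul {a : ℕ → ℂ} (ha : PolyBounded a) (b : ℕ) :
    PolyBounded fun N => (N : ℂ) ^ b * a N := by
  induction b with
  | zero => simpa using ha
  | succ b ih => simpa [pow_succ', mul_assoc] using ih.natCast_mul

theorem PolyBounded.summable {a : ℕ → ℂ} (ha : PolyBounded a) {r : ℝ} (h0 : 0 ≤ r) (hr : r < 1) :
    Summable fun N => ‖a N‖ * r ^ N := by
  obtain ⟨C, K, h⟩ := ha
  have hs := (summable_pow_mul_geometric_of_norm_lt_one K
    (show ‖r‖ < 1 by rwa [Real.norm_of_nonneg h0])).mul_left C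
  refine Summable.of_nonneg_of_le (fun N => by positivity) (fun N => ?_) hs
  rw [← mul_assoc]
  exact mul_le_mul_of_nonneg_right (h N) (by positivity)

/-- The function `∑ a_N q^N`. -/
noncomputable def qSeries (a : ℕ → ℂ) (τ : ℍ) : ℂ := ∑' N : ℕ, a N * expTwoPi τ ^ N

theorem PolyBounded.summable_qSeries {a : ℕ → ℂ} (ha : PolyBounded a) (τ : ℍ) :
    Summable fun N => a N * expTwoPi τ ^ N := by
  refine Summable.of_norm ?_
  simpa using ha.summable (norm_nonneg _) (norm_expTwoPi_coe_lt_one τ)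

/-- On the half-plane `Im w > Im z / 2` the series is dominated by a convergent one, so it may be
differentiated termwise. -/
theorem PolyBounded.qSeries_local {a : ℕ → ℂ} (ha : PolyBounded a) {z : ℂ} (hz : 0 < z.im) :
    DifferentiableAt ℂ (fun w => ∑' N : ℕ, a N * expTwoPi w ^ N) z ∧
    HasSum (fun N : ℕ => 2 * π * I * (N * a N) * expTwoPi z ^ N)
      (deriv (fun w => ∑' N : ℕ, a N * expTwoPi w ^ N) z) := by
  have hU : IsOpen {w : ℂ | z.im / 2 < w.im} := isOpen_lt continuous_const Complex.continuous_im
  have hzU : z ∈ {w : ℂ | z.im / 2 < w.im} := by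
    simp only [Set.mem_ofPred_eq]; linarith
  have hu := ha.summable (r := Real.exp (-(2 * π * (z.im / 2)))) (Real.exp_nonneg _)
    (Real.exp_lt_one_iff.2 (by have := Real.pi_pos; nlinarith))
  have hder : ∀ (N : ℕ) (w : ℂ), HasDerivAt (fun w => a N * expTwoPi w ^ N)
      (2 * π * I * (N * a N) * expTwoPi w ^ N) w := fun N w => by
    have := (hasDerivAt_expTwoPi_mul N w).const_mul (a N)
    simp only [expTwoPi_nat_mul] at this
    exact this.congr_deriv (by ring)
  have hle : ∀ (N : ℕ) (w : ℂ), w ∈ {w : ℂ | z.im / 2 < w.im} →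
      ‖a N * expTwoPi w ^ N‖ ≤ ‖a N‖ * Real.exp (-(2 * π * (z.im / 2))) ^ N := fun N w hw => by
    rw [norm_mul, norm_pow, norm_expTwoPi]
    have hw' : z.im / 2 < w.im := hw
    gcongr
  have hdiff : ∀ N : ℕ, DifferentiableOn ℂ (fun w => a N * expTwoPi w ^ N)
      {w : ℂ | z.im / 2 < w.im} := fun N w _ => (hder N w).differentiableAt.differentiableWithinAt
  refine ⟨(differentiableOn_tsum_of_summable_norm hu hdiff hU hle).differentiableAt
    (hU.mem_nhds hzU), ?_⟩
  have := hasSum_deriv_of_summable_norm hu hdiff hU hle hzU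
  simpa only [(hder _ _).deriv] using this

theorem qSeries_comp_ofComplex_eventuallyEq (a : ℕ → ℂ) {z : ℂ} (hz : 0 < z.im) :
    (qSeries a ∘ ofComplex) =ᶠ[𝓝 z] fun w => ∑' N : ℕ, a N * expTwoPi w ^ N := by
  filter_upwards [isOpen_upperHalfPlaneSet.mem_nhds hz] with w hw
  simp [qSeries, ofComplex_apply_of_im_pos hw]

theorem PolyBounded.mdifferentiable_qSeries {a : ℕ → ℂ} (ha : PolyBounded a) :
    MDiff (qSeries a) := by
  rw [UpperHalfPlane.mdifferentiable_iff]
  intro z hz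
  exact ((ha.qSeries_local hz).1.congr_of_eventuallyEq
    (qSeries_comp_ofComplex_eventuallyEq a hz)).differentiableWithinAt

theorem PolyBounded.D_qSeries {a : ℕ → ℂ} (ha : PolyBounded a) :
    D (qSeries a) = qSeries fun N => N * a N := by
  ext τ
  rw [normalizedDerivOfComplex, (qSeries_comp_ofComplex_eventuallyEq a τ.im_pos).deriv_eq,
    ← (ha.qSeries_local τ.im_pos).2.tsum_eq, ← tsum_mul_left]
  refine tsum_congr fun N => ?_
  field_simp

theorem PolyBounded.iterate_D_qSeries {a : ℕ → ℂ} (ha : PolyBounded a) (b : ℕ) :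
    D^[b] (qSeries a) = qSeries fun N => (N : ℂ) ^ b * a N := by
  induction b with
  | zero => simp
  | succ b ih =>
    rw [Function.iterate_succ_apply', ih, (ha.natCast_pow_mul b).D_qSeries]
    simp [pow_succ', mul_assoc]

/-- The series is even bounded on `Im τ ≥ 1`, by the sum of the absolute values at height one. -/
theorem PolyBounded.qSeries_mem_tame {a : ℕ → ℂ} (ha : PolyBounded a) :
    qSeries a ∈ tameSubmodule := by
  refine ⟨ha.mdifferentiable_qSeries, fun C ε hε => isBigO_strip_iff.2
    ⟨∑' N : ℕ, ‖a N‖ * Real.exp (-(2 * π)) ^ N, 1, fun τ _ him => ?_⟩⟩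
  have hs := ha.summable (r := Real.exp (-(2 * π))) (Real.exp_nonneg _)
    (Real.exp_lt_one_iff.2 (by have := Real.pi_pos; linarith))
  have h1 : ‖qSeries a τ‖ ≤ ∑' N : ℕ, ‖a N‖ * Real.exp (-(2 * π)) ^ N := by
    refine tsum_of_norm_bounded hs.hasSum fun N => ?_
    rw [norm_mul, norm_pow, norm_expTwoPi, UpperHalfPlane.coe_im]
    have := Real.pi_pos
    have h2 : Real.exp (-(2 * π * τ.im)) ≤ Real.exp (-(2 * π)) := Real.exp_le_exp.2 (by nlinarith)
    gcongr
  refine h1.trans (le_mul_of_one_le_right (tsum_nonneg fun N => by positivity) ?_)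
  rw [Real.norm_of_nonneg (Real.exp_nonneg _)]
  exact Real.one_le_exp (by have := τ.im_pos; positivity)

/-! ### Eichler integrals of Eisenstein series -/

/-- The coefficients `∑_{mk = N} k^s m^(-b)`. -/
noncomputable def eichlerCoeff (s b N : ℕ) : ℂ :=
  ∑ x ∈ N.divisorsAntidiagonal, (x.2 : ℂ) ^ s * ((x.1 : ℂ) ^ b)⁻¹

theorem polyBounded_eichlerCoeff (s b : ℕ) : PolyBounded (eichlerCoeff s b) := by
  refine ⟨1, s + 1, fun N => ?_⟩
  refine (norm_sum_le _ _).trans ?_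
  have h : ∀ x ∈ N.divisorsAntidiagonal,
      ‖(x.2 : ℂ) ^ s * ((x.1 : ℂ) ^ b)⁻¹‖ ≤ (N : ℝ) ^ s := by
    intro x hx
    obtain ⟨hx1, hN⟩ := Nat.mem_divisorsAntidiagonal.1 hx
    have h1 : 1 ≤ x.1 := Nat.one_le_iff_ne_zero.2 fun h => hN (by rw [← hx1, h, zero_mul])
    have h2 : x.2 ≤ N := by rw [← hx1]; exact Nat.le_mul_of_pos_left _ h1
    rw [norm_mul, norm_pow, norm_inv, norm_pow, Complex.norm_natCast, Complex.norm_natCast]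
    have h3 : ((x.1 : ℝ) ^ b)⁻¹ ≤ 1 := inv_le_one_of_one_le₀ (one_le_pow₀ (by exact_mod_cast h1))
    calc (x.2 : ℝ) ^ s * ((x.1 : ℝ) ^ b)⁻¹ ≤ (N : ℝ) ^ s * 1 := by gcongr
      _ = _ := mul_one _
  refine (Finset.sum_le_card_nsmul _ _ _ h).trans ?_
  rw [nsmul_eq_mul, one_mul, pow_succ']
  gcongr
  rw [← Nat.map_div_right_divisors, Finset.card_map]
  exact Nat.card_divisors_le_self N

/-- With `N = mk` the factor `N^b` turns `k^s m^(-b)` into `k^(s+b)`. As `D` multiplies the `N`-th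
coefficient by `N`, this makes `D^b` of the Eichler series the non-constant part of an Eisenstein
series. -/
theorem natCast_pow_mul_eichlerCoeff (s b N : ℕ) :
    (N : ℂ) ^ b * eichlerCoeff s b N = (σ (s + b) N : ℂ) := by
  rw [eichlerCoeff, ArithmeticFunction.sigma_apply, Finset.mul_sum,
    Nat.sum_divisorsAntidiagonal' fun x y => (N : ℂ) ^ b * ((y : ℂ) ^ s * ((x : ℂ) ^ b)⁻¹)]
  push_cast
  refine Finset.sum_congr rfl fun k hk => ?_
  obtain ⟨hkN, hN⟩ := Nat.mem_divisors.1 hk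
  obtain ⟨m, rfl⟩ := hkN
  have hk0 : k ≠ 0 := fun h => hN (by simp [h])
  have hm0 : m ≠ 0 := fun h => hN (by simp [h])
  rw [Nat.mul_div_cancel_left _ (Nat.pos_of_ne_zero hk0)]
  have hm0' : (m : ℂ) ≠ 0 := Nat.cast_ne_zero.2 hm0
  push_cast
  rw [mul_pow, pow_add]
  field_simp

theorem hasSum_eichler (s b : ℕ) (τ : ℍ) :
    HasSum (fun x : ℕ+ × ℕ+ =>
      (x.2 : ℂ) ^ s * ((x.1 : ℂ) ^ b)⁻¹ * expTwoPi τ ^ (x.1 * x.2 : ℕ))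
      (qSeries (eichlerCoeff s b) τ) := by
  have hs : Summable fun x : ℕ+ × ℕ+ =>
      (x.2 : ℂ) ^ s * ((x.1 : ℂ) ^ b)⁻¹ * expTwoPi τ ^ (x.1 * x.2 : ℕ) := by
    have h := (summable_prod_mul_pow s (norm_expTwoPi_coe_lt_one τ)).norm
    refine Summable.of_norm_bounded h fun x => ?_
    rw [mul_right_comm, norm_mul]
    refine mul_le_of_le_one_right (norm_nonneg _) ?_
    rw [norm_inv, norm_pow, Complex.norm_natCast]
    exact inv_le_one_of_one_le₀ (one_le_pow₀ (Nat.one_le_cast.2 x.1.pos))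
  refine (Equiv.hasSum_iff sigmaAntidiagonalEquivProd).1 ?_
  have hs' := (Equiv.summable_iff sigmaAntidiagonalEquivProd).2 hs
  convert hs'.hasSum using 1
  rw [hs'.tsum_sigma, qSeries,
    ← tsum_zero_pnat_eq_tsum_nat ((polyBounded_eichlerCoeff s b).summable_qSeries τ)]
  simp only [eichlerCoeff, Nat.divisorsAntidiagonal_zero, Finset.sum_empty, zero_mul, zero_add]
  refine tsum_congr fun N => ?_
  rw [tsum_fintype, Finset.sum_mul]
  change _ = ∑ x : {x // x ∈ (N : ℕ).divisorsAntidiagonal}, _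
  rw [← Finset.sum_coe_sort]
  refine Finset.sum_congr rfl fun x _ => ?_
  have := (Nat.mem_divisorsAntidiagonal.1 x.2).1
  simp [sigmaAntidiagonalEquivProd, divisorsAntidiagonalFactors, this]

theorem eisenstein_eq_qSeries {k : ℕ} (hk : 3 ≤ k) (hk2 : Even k) : ∃ c : ℂ, c ≠ 0 ∧
    (ModularForm.E hk : ℍ → ℂ) = (fun _ => 1) + c • qSeries fun N => (σ (k - 1) N : ℂ) := by
  have hζ : riemannZeta k ≠ 0 := riemannZeta_ne_zero_of_one_lt_re <| by
    rw [Complex.natCast_re]; exact_mod_cast (by omega : 1 < k)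
  refine ⟨(riemannZeta k)⁻¹ * (-2 * π * I) ^ k / (k - 1)!, ?_, funext fun τ => ?_⟩
  · have : (-2 * π * I : ℂ) ≠ 0 := by simp [Real.pi_ne_zero]
    have h2 : ((k - 1)! : ℂ) ≠ 0 := Nat.cast_ne_zero.2 (Nat.factorial_ne_zero _)
    exact div_ne_zero (mul_ne_zero (inv_ne_zero hζ) (pow_ne_zero _ this)) h2
  · rw [EisensteinSeries.q_expansion_riemannZeta hk hk2]
    simp only [Pi.add_apply, Pi.smul_apply, smul_eq_mul, qSeries]
    rw [← tsum_zero_pnat_eq_tsum_nat]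
    · simp [expTwoPi]
    · exact EisensteinSeries.summable_sigma_mul_cexp_pow (by omega) τ

/-- After `b` derivatives the series is `c⁻¹ (E - 1)` with `E` of weight `s + b + 1`. Since `b ≤ p`,
at least one derivative is left to kill the constant, and the total `D^(p+1)` gives `c⁻¹ D^(p+1-b)
E`. The weights match: `(s + b + 1) + (p + 1 - b) - s = p + 2`. -/
theorem eichler_hasTameTranslates {s b p : ℕ} (hbp : b ≤ p) (hk : 3 ≤ s + b + 1)
    (hk2 : Even (s + b + 1)) : HasTameTranslates (-(p : ℤ)) (qSeries (eichlerCoeff s b)) := by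
  obtain ⟨c, hc, hE⟩ := eisenstein_eq_qSeries hk hk2
  have hpb := polyBounded_eichlerCoeff s b
  have hσ : PolyBounded fun N => (σ (s + b + 1 - 1) N : ℂ) := by
    have := hpb.natCast_pow_mul b
    simpa only [natCast_pow_mul_eichlerCoeff, Nat.add_sub_cancel] using this
  have hconst : MDiff (fun _ : ℍ => (1 : ℂ)) := mdifferentiable_const
  have hDE : ∀ l, D^[l] (ModularForm.E hk : ℍ → ℂ) = D^[l] (fun _ => 1)
      + c • D^[l] (qSeries fun N => (σ (s + b + 1 - 1) N : ℂ)) := fun l => by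
    rw [hE, iterate_D_add hconst (mdifferentiable_const_mul _ hσ.mdifferentiable_qSeries),
      iterate_D_smul hσ.mdifferentiable_qSeries]
  have hD1 : ∀ l, D^[l + 1] (fun _ : ℍ => (1 : ℂ)) = 0 := fun l => by
    rw [Function.iterate_succ_apply, D_const, iterate_D_zero]
  have hone : (fun _ : ℍ => (1 : ℂ)) ∈ tameSubmodule :=
    mem_tame_of_D_mem_tame hconst (by rw [D_const]; exact zero_mem _)
  refine HasTameTranslates.of_iterate_D (E := (ModularForm.E hk : ℍ → ℂ))
    (k := (s + b + 1 : ℕ)) (c := c⁻¹) (i := p + 1 - b) (n := s)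
    hpb.mdifferentiable_qSeries (fun l => ?_) (fun γ => ?_) ?_ ?_
  · rw [hDE, hσ.iterate_D_qSeries]
    refine add_mem ?_ (Submodule.smul_mem _ _ (hσ.natCast_pow_mul l).qSeries_mem_tame)
    cases l with
    | zero => exact hone
    | succ l => rw [hD1]; exact zero_mem _
  · exact SlashInvariantFormClass.slash_action_eq (ModularForm.E hk) _ ⟨γ, rfl⟩
  · obtain ⟨j, rfl⟩ : ∃ j, p = b + j := ⟨p - b, by omega⟩
    rw [show b + j + 1 - b = j + 1 by omega, hDE, hD1, zero_add, smul_smul, inv_mul_cancel₀ hc,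
      one_smul, show b + j + 1 = j + 1 + b by ring, Function.iterate_add_apply,
      hpb.iterate_D_qSeries]
    simp only [natCast_pow_mul_eichlerCoeff, show s + b + 1 - 1 = s + b by omega]
  · push_cast [Nat.cast_sub (show b ≤ p + 1 by omega)]
    ring

end QSeries

/-! ### Products of theta series with Lambert series -/

section ThetaLambert

theorem expTwoPi_ne_zero (x : ℂ) : expTwoPi x ≠ 0 := Complex.exp_ne_zero _

theorem expTwoPi_zero : expTwoPi 0 = 1 := by simp [expTwoPi]

theorem expTwoPi_int_mul (n : ℤ) (x : ℂ) : expTwoPi (n * x) = expTwoPi x ^ n := by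
  rw [expTwoPi, expTwoPi, ← Complex.exp_int_mul]; ring_nf

/-- The coefficients `(-1)^j q^((j+1/2)²/2)` of the theta function. -/
noncomputable def thetaCoeff (τ : ℍ) (j : ℤ) : ℂ :=
  (-1 : ℂ) ^ j * cexp (π * I * τ * ((j : ℂ) + 1 / 2) ^ 2)

theorem thetaCoeff_ne_zero (τ : ℍ) (j : ℤ) : thetaCoeff τ j ≠ 0 :=
  mul_ne_zero (zpow_ne_zero _ (by norm_num)) (Complex.exp_ne_zero _)

/-- The exponents `(j + 1/2)²/2` of `q` differ by `j + 1` in consecutive terms. -/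
theorem thetaCoeff_succ (τ : ℍ) (j : ℤ) :
    thetaCoeff τ (j + 1) = -(expTwoPi τ ^ (j + 1) * thetaCoeff τ j) := by
  rw [thetaCoeff, thetaCoeff, zpow_add₀ (by norm_num), zpow_one, ← expTwoPi_int_mul, expTwoPi]
  rw [show π * I * τ * (((j + 1 : ℤ) : ℂ) + 1 / 2) ^ 2 =
    2 * π * I * (((j + 1 : ℤ) : ℂ) * τ) + π * I * τ * ((j : ℂ) + 1 / 2) ^ 2 by push_cast; ring,
    Complex.exp_add]
  ring

/-- The shift by `1/2` produces the signs, the shift by `τ/2` the half-integral exponents.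
Summability and holomorphy are thereby inherited from `jacobiTheta₂`. -/
theorem thetaCoeff_mul_zpow (τ : ℍ) (ξ : ℂ) (j : ℤ) :
    thetaCoeff τ j * expTwoPi ξ ^ j =
      cexp (π * I * τ / 4) * jacobiTheta₂_term j (ξ + 1 / 2 + τ / 2) τ := by
  have h1 : (-1 : ℂ) ^ j = cexp (π * I * j) := by
    rw [← Complex.exp_pi_mul_I, ← Complex.exp_int_mul]; ring_nf
  rw [thetaCoeff, jacobiTheta₂_term, h1, ← expTwoPi_int_mul, expTwoPi, ← Complex.exp_add,
    ← Complex.exp_add, ← Complex.exp_add]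
  congr 1
  ring

theorem summable_thetaCoeff_mul_zpow (τ : ℍ) (ξ : ℂ) :
    Summable fun j : ℤ => thetaCoeff τ j * expTwoPi ξ ^ j := by
  simp only [thetaCoeff_mul_zpow]
  exact ((summable_jacobiTheta₂_term_iff _ _).2 τ.im_pos).mul_left _

theorem oddTheta_eq_tsum (ξ : ℂ) (τ : ℍ) :
    oddTheta ξ τ = expTwoPi (ξ / 2) * ∑' j : ℤ, thetaCoeff τ j * expTwoPi ξ ^ j := by
  rw [oddTheta, ← tsum_mul_left]
  refine tsum_congr fun m => ?_
  rw [thetaCoeff, ← expTwoPi_int_mul, expTwoPi, expTwoPi,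
    show 2 * π * I * ξ * ((m : ℂ) + 1 / 2) = 2 * π * I * (ξ / 2) + 2 * π * I * (m * ξ) by ring,
    Complex.exp_add]
  ring

theorem oddTheta_eq_jacobiTheta₂ (ξ : ℂ) (τ : ℍ) :
    oddTheta ξ τ = expTwoPi (ξ / 2) * (cexp (π * I * τ / 4) *
      jacobiTheta₂ (ξ + 1 / 2 + τ / 2) τ) := by
  rw [oddTheta_eq_tsum]
  simp only [thetaCoeff_mul_zpow, tsum_mul_left, jacobiTheta₂]

theorem differentiable_expTwoPi : Differentiable ℂ expTwoPi := fun x => by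
  have := (hasDerivAt_expTwoPi_mul 1 x).differentiableAt
  simpa using this

theorem differentiable_oddTheta (τ : ℍ) : Differentiable ℂ fun ξ => oddTheta ξ τ := by
  simp only [oddTheta_eq_jacobiTheta₂]
  have h1 : Differentiable ℂ fun ξ => expTwoPi (ξ / 2) :=
    differentiable_expTwoPi.comp (differentiable_id.div_const 2)
  have h2 : Differentiable ℂ fun ξ : ℂ => jacobiTheta₂ (ξ + 1 / 2 + τ / 2) τ := fun ξ =>
    (differentiableAt_jacobiTheta₂_fst (ξ + 1 / 2 + τ / 2) τ.im_pos).comp ξ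
      ((differentiableAt_id.add_const _).add_const _)
  exact h1.mul (h2.const_mul _)

theorem tsum_thetaCoeff (τ : ℍ) : ∑' j : ℤ, thetaCoeff τ j = 0 := by
  have := oddTheta_eq_tsum 0 τ
  simpa [oddTheta_zero, expTwoPi_zero] using this.symm

/-- The zero of theta at `ξ = τ`: the recursion shifts the series to the one at `ξ = 0`. It removes
the inhomogeneous term in `thetaLambertCoeff_succ`. -/
theorem tsum_thetaCoeff_mul_qpow (τ : ℍ) : ∑' j : ℤ, thetaCoeff τ j * expTwoPi τ ^ j = 0 := by
  have h : ∀ j : ℤ, thetaCoeff τ j * expTwoPi τ ^ j =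
      -(expTwoPi τ)⁻¹ * thetaCoeff τ (j + 1) := fun j => by
    rw [thetaCoeff_succ, zpow_add_one₀ (expTwoPi_ne_zero _)]
    have := expTwoPi_ne_zero (τ : ℂ)
    field_simp
  simp only [h]
  rw [tsum_mul_left]
  have h' := (Equiv.addRight (1 : ℤ)).tsum_eq (thetaCoeff τ)
  simp only [Equiv.coe_addRight] at h'
  rw [h', tsum_thetaCoeff, mul_zero]

/-! ### The Lambert series and its product with the theta series -/

variable (τ : ℍ) (z : ℂ)

/-- The coefficients `1 / (1 - z q^k)` of the Lambert series. -/
noncomputable def lambertCoeff (k : ℤ) : ℂ := (1 - z * expTwoPi τ ^ k)⁻¹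

variable {τ z}

theorem one_sub_norm_le {x : ℂ} : 1 - ‖x‖ ≤ ‖1 - x‖ := by
  have := norm_sub_norm_le (1 : ℂ) x
  rwa [norm_one] at this

theorem norm_expTwoPi_pow_succ_le (τ : ℍ) (n : ℕ) :
    ‖expTwoPi τ ^ (n + 1)‖ ≤ ‖expTwoPi (τ : ℂ)‖ := by
  rw [norm_pow]
  exact pow_le_of_le_one (norm_nonneg _) (norm_expTwoPi_coe_lt_one τ).le (Nat.succ_ne_zero n)

theorem one_sub_ne_zero_of_norm_lt_one {x : ℂ} (hx : ‖x‖ < 1) : 1 - x ≠ 0 := fun h => by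
  rw [← sub_eq_zero.1 h, norm_one] at hx
  exact lt_irrefl _ hx

theorem norm_mul_qpow_lt_one (hz : ‖z‖ = 1) (n : ℕ) : ‖z * expTwoPi τ ^ (n + 1)‖ < 1 := by
  rw [norm_mul, hz, one_mul]
  exact (norm_expTwoPi_pow_succ_le τ n).trans_lt (norm_expTwoPi_coe_lt_one τ)

theorem lambertCoeff_neg_succ (hz : ‖z‖ = 1) (n : ℕ) : lambertCoeff τ z (-((n : ℤ) + 1)) =
    -(z⁻¹ * expTwoPi τ ^ (n + 1)) * (1 - z⁻¹ * expTwoPi τ ^ (n + 1))⁻¹ := by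
  have hz0 : z ≠ 0 := fun h => by simp [h] at hz
  have hq := pow_ne_zero (n + 1) (expTwoPi_ne_zero (τ : ℂ))
  have h1 := one_sub_ne_zero_of_norm_lt_one
    (norm_mul_qpow_lt_one (τ := τ) (z := z⁻¹) (by rw [norm_inv, hz, inv_one]) n)
  have h2 : (expTwoPi τ : ℂ) ^ (-((n : ℤ) + 1)) = (expTwoPi τ ^ (n + 1))⁻¹ := by
    rw [zpow_neg, ← zpow_natCast]; push_cast; rfl
  rw [lambertCoeff, h2]
  set x := expTwoPi (τ : ℂ) ^ (n + 1)
  have h3 : z * x⁻¹ ≠ 0 := mul_ne_zero hz0 (inv_ne_zero hq)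
  have h4 : 1 - z * x⁻¹ = -(z * x⁻¹) * (1 - z⁻¹ * x) := by field_simp; ring
  rw [h4, mul_inv]
  congr 1
  field_simp

theorem one_sub_mul_qzpow_ne_zero (hz : ‖z‖ = 1) (hz1 : z ≠ 1) (k : ℤ) :
    1 - z * expTwoPi τ ^ k ≠ 0 := by
  intro h
  have h1 : z * expTwoPi τ ^ k = 1 := (sub_eq_zero.1 h).symm
  have h2 : ‖expTwoPi (τ : ℂ)‖ ^ k = 1 := by
    have := congrArg norm h1
    rwa [norm_mul, hz, one_mul, norm_zpow, norm_one] at this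
  have h3 : k = 0 := by
    rcases (zpow_eq_one_iff_right₀ (norm_nonneg _) (norm_expTwoPi_coe_lt_one τ).ne).1 h2 with h
    exact h
  subst h3
  exact hz1 (by simpa using h1)

/-- For positive `k` the coefficients are only bounded, which needs `|w| < 1`; for negative `k` they
decay like `|q|^|k|`, which needs `|q| < |w|`. -/
theorem summable_lambert (hz : ‖z‖ = 1) {w : ℂ} (hw : ‖expTwoPi (τ : ℂ)‖ < ‖w‖) (hw1 : ‖w‖ < 1) :
    Summable fun k : ℤ => ‖lambertCoeff τ z k * w ^ k‖ := by
  set ρ := ‖expTwoPi (τ : ℂ)‖ with hρ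
  have hρ1 : ρ < 1 := norm_expTwoPi_coe_lt_one τ
  have hρ0 : 0 < ρ := norm_pos_iff.2 (expTwoPi_ne_zero _)
  have hw0 : 0 < ‖w‖ := hρ0.trans hw
  have hbound : ∀ (y : ℂ) (n : ℕ), ‖y‖ = 1 → ‖(1 - y * expTwoPi τ ^ (n + 1))⁻¹‖ ≤ (1 - ρ)⁻¹ := by
    intro y n hy
    rw [norm_inv]
    refine inv_anti₀ (by linarith) (le_trans ?_ one_sub_norm_le)
    rw [norm_mul, hy, one_mul]
    linarith [norm_expTwoPi_pow_succ_le τ n]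
  have hg : Summable fun n : ℕ => (1 - ρ)⁻¹ * ‖w‖ ^ (n + 1) :=
    ((summable_nat_add_iff 1).2 (summable_geometric_of_lt_one hw0.le hw1)).mul_left _
  have hg' : Summable fun n : ℕ => (1 - ρ)⁻¹ * (ρ / ‖w‖) ^ (n + 1) :=
    ((summable_nat_add_iff 1).2 (summable_geometric_of_lt_one (by positivity)
      ((div_lt_one hw0).2 hw))).mul_left _
  refine Summable.of_add_one_of_neg_add_one ?_ ?_
  · refine Summable.of_nonneg_of_le (fun _ => norm_nonneg _) (fun n => ?_) hg
    have e : ((n : ℤ) + 1) = ((n + 1 : ℕ) : ℤ) := by push_cast; rfl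
    rw [e, lambertCoeff, zpow_natCast, zpow_natCast, norm_mul, norm_pow]
    exact mul_le_mul_of_nonneg_right (hbound z n hz) (by positivity)
  · refine Summable.of_nonneg_of_le (fun _ => norm_nonneg _) (fun n => ?_) hg'
    have e : w ^ (-((n : ℤ) + 1)) = (w ^ (n + 1))⁻¹ := by
      rw [zpow_neg, ← zpow_natCast]; push_cast; rfl
    rw [lambertCoeff_neg_succ hz, e, norm_mul, norm_mul, norm_neg, norm_mul, norm_inv z, hz,
      inv_one, one_mul, norm_pow, norm_inv (w ^ (n + 1)), norm_pow, mul_right_comm, div_pow,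
      mul_comm,
      ← div_eq_mul_inv]
    exact mul_le_mul_of_nonneg_right
      (hbound z⁻¹ n (by rw [norm_inv, hz, inv_one])) (by positivity)

/-- The coefficients of the product of the theta series with the Lambert series. -/
noncomputable def thetaLambertCoeff (τ : ℍ) (z : ℂ) (m : ℤ) : ℂ :=
  ∑' k : ℤ, thetaCoeff τ (m - k) * lambertCoeff τ z k

/-- The bijection `(m, k) ↦ (m - k, k)`. -/
def subShear : ℤ × ℤ ≃ ℤ × ℤ where
  toFun x := (x.1 - x.2, x.2)
  invFun x := (x.1 + x.2, x.2)
  left_inv x := by simp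
  right_inv x := by simp

theorem exists_norm_between (τ : ℍ) : ∃ α : ℂ, ‖expTwoPi (τ : ℂ)‖ < ‖expTwoPi α‖ ∧
    ‖expTwoPi α‖ < 1 := by
  refine ⟨(τ : ℂ) / 2, ?_, ?_⟩
  · rw [norm_expTwoPi, norm_expTwoPi, Real.exp_lt_exp, Complex.div_ofNat_im, UpperHalfPlane.coe_im]
    nlinarith [τ.im_pos, Real.pi_pos]
  · rw [norm_expTwoPi, Real.exp_lt_one_iff, Complex.div_ofNat_im, UpperHalfPlane.coe_im]
    nlinarith [τ.im_pos, Real.pi_pos]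

theorem summable_thetaLambert_prod (hz : ‖z‖ = 1) {α : ℂ}
    (hw : ‖expTwoPi (τ : ℂ)‖ < ‖expTwoPi α‖) (hw1 : ‖expTwoPi α‖ < 1) :
    Summable fun x : ℤ × ℤ =>
      thetaCoeff τ (x.1 - x.2) * lambertCoeff τ z x.2 * expTwoPi α ^ x.1 := by
  have h := summable_mul_of_summable_norm (summable_thetaCoeff_mul_zpow τ α).norm
    (summable_lambert (z := z) hz hw hw1)
  rw [← subShear.summable_iff] at h
  refine h.congr fun x => ?_
  simp only [subShear, Function.comp_apply, Equiv.coe_fn_mk]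
  rw [zpow_sub₀ (expTwoPi_ne_zero _)]
  have := zpow_ne_zero x.2 (expTwoPi_ne_zero α)
  field_simp

theorem summable_thetaLambertCoeff (hz : ‖z‖ = 1) (m : ℤ) :
    Summable fun k : ℤ => thetaCoeff τ (m - k) * lambertCoeff τ z k := by
  obtain ⟨α, hw, hw1⟩ := exists_norm_between τ
  have h := (summable_thetaLambert_prod hz hw hw1).prod_factor m
  refine (h.mul_right (expTwoPi α ^ m)⁻¹).congr fun k => ?_
  have := zpow_ne_zero m (expTwoPi_ne_zero α)
  field_simp

/-- In the combined sum the factor `1 - z q^k` cancels the Lambert denominator, and what remains is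
`-q` times the theta series at `ξ = τ`, which vanishes. -/
theorem thetaLambertCoeff_succ (hz : ‖z‖ = 1) (hz1 : z ≠ 1) (m : ℤ) :
    thetaLambertCoeff τ z (m + 1) =
      -(z * expTwoPi τ ^ (m + 1) * thetaLambertCoeff τ z m) := by
  have hq := expTwoPi_ne_zero (τ : ℂ)
  rw [eq_neg_iff_add_eq_zero, thetaLambertCoeff, thetaLambertCoeff, ← tsum_mul_left,
    ← (summable_thetaLambertCoeff hz (m + 1)).tsum_add
      ((summable_thetaLambertCoeff hz m).mul_left _)]
  have h : ∀ k : ℤ, thetaCoeff τ (m + 1 - k) * lambertCoeff τ z k +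
      z * expTwoPi τ ^ (m + 1) * (thetaCoeff τ (m - k) * lambertCoeff τ z k) =
      -expTwoPi τ * (thetaCoeff τ (m - k) * expTwoPi τ ^ (m - k)) := by
    intro k
    have h1 : (1 - z * expTwoPi τ ^ k) * lambertCoeff τ z k = 1 :=
      mul_inv_cancel₀ (one_sub_mul_qzpow_ne_zero (τ := τ) hz hz1 k)
    have h2 : expTwoPi (τ : ℂ) ^ m = expTwoPi τ ^ (m - k) * expTwoPi τ ^ k := by
      rw [← zpow_add₀ hq, sub_add_cancel]
    rw [show m + 1 - k = m - k + 1 by ring, thetaCoeff_succ, zpow_add₀ hq, zpow_add₀ hq, zpow_one]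
    linear_combination -(expTwoPi τ * thetaCoeff τ (m - k) * expTwoPi τ ^ (m - k)) * h1 +
      z * expTwoPi τ * thetaCoeff τ (m - k) * lambertCoeff τ z k * h2
  simp only [h]
  rw [tsum_mul_left]
  have h' := (Equiv.subLeft m).tsum_eq fun j : ℤ => thetaCoeff τ j * expTwoPi τ ^ j
  simp only [Equiv.subLeft_apply] at h'
  rw [h', tsum_thetaCoeff_mul_qpow, mul_zero]

/-- Both sides obey the same first-order recursion, whose multiplier never vanishes, so it can be
run in both directions from `m = 0`. -/
theorem thetaLambertCoeff_eq (hz : ‖z‖ = 1) (hz1 : z ≠ 1) (m : ℤ) :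
    thetaLambertCoeff τ z m =
      thetaLambertCoeff τ z 0 / thetaCoeff τ 0 * (thetaCoeff τ m * z ^ m) := by
  have hz0 : z ≠ 0 := fun h => by simp [h] at hz
  have h0 := thetaCoeff_ne_zero τ 0
  have hq := expTwoPi_ne_zero (τ : ℂ)
  have step : ∀ m : ℤ, thetaLambertCoeff τ z m =
      thetaLambertCoeff τ z 0 / thetaCoeff τ 0 * (thetaCoeff τ m * z ^ m) ↔
      thetaLambertCoeff τ z (m + 1) =
      thetaLambertCoeff τ z 0 / thetaCoeff τ 0 * (thetaCoeff τ (m + 1) * z ^ (m + 1)) := by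
    intro m
    have h1 : z * expTwoPi τ ^ (m + 1) ≠ 0 := mul_ne_zero hz0 (zpow_ne_zero _ hq)
    rw [thetaLambertCoeff_succ hz hz1, thetaCoeff_succ, zpow_add₀ hz0, zpow_one,
      ← mul_right_inj' h1]
    constructor <;> intro h <;> linear_combination -h
  induction m using Int.induction_on with
  | zero => field_simp
  | succ i ih => exact (step _).1 ih
  | pred i ih =>
    refine (step _).2 ?_
    rwa [sub_add_cancel]

/-- The product of the theta series with the Lambert series is a multiple of a translate of the
theta series. -/
theorem theta_mul_lambert (hz : ‖z‖ = 1) (hz1 : z ≠ 1) : ∃ C : ℂ, ∀ α : ℂ,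
    ‖expTwoPi (τ : ℂ)‖ < ‖expTwoPi α‖ → ‖expTwoPi α‖ < 1 →
    (∑' j : ℤ, thetaCoeff τ j * expTwoPi α ^ j) * ∑' k : ℤ, lambertCoeff τ z k * expTwoPi α ^ k =
      C * ∑' j : ℤ, thetaCoeff τ j * (z * expTwoPi α) ^ j := by
  refine ⟨thetaLambertCoeff τ z 0 / thetaCoeff τ 0, fun α hw hw1 => ?_⟩
  rw [tsum_mul_tsum_of_summable_norm (summable_thetaCoeff_mul_zpow τ α).norm
    (summable_lambert (z := z) hz hw hw1), ← subShear.tsum_eq]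
  have h : ∀ x : ℤ × ℤ, thetaCoeff τ (subShear x).1 * expTwoPi α ^ (subShear x).1 *
      (lambertCoeff τ z (subShear x).2 * expTwoPi α ^ (subShear x).2) =
      thetaCoeff τ (x.1 - x.2) * lambertCoeff τ z x.2 * expTwoPi α ^ x.1 := fun x => by
    simp only [subShear, Equiv.coe_fn_mk]
    rw [zpow_sub₀ (expTwoPi_ne_zero _)]
    have := zpow_ne_zero x.2 (expTwoPi_ne_zero α)
    field_simp
  simp only [h]
  rw [(summable_thetaLambert_prod hz hw hw1).tsum_prod, ← tsum_mul_left]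
  refine tsum_congr fun m => ?_
  simp only [tsum_mul_right]
  change thetaLambertCoeff τ z m * _ = _
  rw [thetaLambertCoeff_eq hz hz1, mul_zpow]
  ring

end ThetaLambert

/-! ### The expansion of the Kronecker function -/

section KroneckerExpansion

theorem hasSum_intervalIntegral_of_norm_le {ι : Type*} [Countable ι] {F : ι → ℝ → ℂ} {u : ι → ℝ}
    {a b : ℝ} (hu : Summable u) (hF : ∀ i, Continuous (F i))
    (h : ∀ i, ∀ t ∈ Set.uIoc a b, ‖F i t‖ ≤ u i) :
    HasSum (fun i => ∫ t in a..b, F i t) (∫ t in a..b, ∑' i, F i t) := by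
  refine intervalIntegral.hasSum_integral_of_dominated_convergence (fun i _ => u i)
    (fun i => (hF i).aestronglyMeasurable) (fun i => Eventually.of_forall fun t ht => h i t ht)
    (Eventually.of_forall fun t _ => hu) intervalIntegrable_const
    (Eventually.of_forall fun t ht => ?_)
  exact (Summable.of_norm_bounded hu fun i => h i t ht).hasSum

theorem continuous_expTwoPi_mul_ofReal (m : ℂ) : Continuous fun t : ℝ => expTwoPi (m * t) :=
  differentiable_expTwoPi.continuous.comp (continuous_const.mul Complex.continuous_ofReal)

theorem expTwoPi_int (m : ℤ) : expTwoPi m = 1 := by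
  rw [expTwoPi, mul_comm]; exact Complex.exp_int_mul_two_pi_mul_I m

theorem integral_expTwoPi_int_mul {m : ℤ} (hm : m ≠ 0) :
    ∫ t in (0 : ℝ)..1, expTwoPi (m * t) = 0 := by
  have hc : (2 * π * I * m : ℂ) ≠ 0 := by simp [Real.pi_ne_zero, hm]
  have h := integral_exp_mul_complex (a := 0) (b := 1) hc
  have e := expTwoPi_int m
  simp only [expTwoPi] at e ⊢
  simp only [← mul_assoc]
  rw [h]
  simp [e]

/-- Otherwise the zeroth Fourier coefficient of the series over a period, `thetaCoeff τ 0`, would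
vanish. -/
theorem oddTheta_ne_zero_fun (τ : ℍ) : ¬ ∀ ξ : ℂ, oddTheta ξ τ = 0 := by
  intro h0
  have h1 : ∀ t : ℝ, ∑' j : ℤ, thetaCoeff τ j * expTwoPi (j * t) = 0 := fun t => by
    have := h0 t
    rw [oddTheta_eq_tsum] at this
    simp only [expTwoPi_int_mul]
    exact (mul_eq_zero.1 this).resolve_left (expTwoPi_ne_zero _)
  have hs : Summable fun j : ℤ => ‖thetaCoeff τ j‖ := by
    have := (summable_thetaCoeff_mul_zpow τ 0).norm
    simpa [expTwoPi_zero] using this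
  have h2 := hasSum_intervalIntegral_of_norm_le (a := 0) (b := 1)
    (F := fun (j : ℤ) (t : ℝ) => thetaCoeff τ j * expTwoPi (j * t)) hs
    (fun j => continuous_const.mul (continuous_expTwoPi_mul_ofReal j)) (fun j t _ => by
      rw [norm_mul, norm_expTwoPi]
      simp)
  simp only [h1, intervalIntegral.integral_zero, intervalIntegral.integral_const_mul] at h2
  have h3 := hasSum_single (f := fun j : ℤ =>
    thetaCoeff τ j * ∫ t in (0 : ℝ)..1, expTwoPi (j * t)) 0 fun j hj => by
      rw [integral_expTwoPi_int_mul hj, mul_zero]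
  have h4 := h2.unique h3
  simp [expTwoPi_zero] at h4
  exact thetaCoeff_ne_zero τ 0 h4.symm

theorem oddTheta_not_eventually_zero (τ : ℍ) (x : ℂ) :
    ¬ ∀ᶠ ξ in 𝓝 x, oddTheta ξ τ = 0 := by
  intro h
  have han : AnalyticOnNhd ℂ (fun ξ => oddTheta ξ τ) Set.univ :=
    (differentiable_oddTheta τ).differentiableOn.analyticOnNhd isOpen_univ
  have := han.eqOn_zero_of_preconnected_of_eventuallyEq_zero isPreconnected_univ
    (Set.mem_univ x) h
  exact oddTheta_ne_zero_fun τ fun ξ => this (Set.mem_univ ξ)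

/-! ### Continuation of the Lambert series to `α = 0` -/

variable (τ : ℍ) (z : ℂ)

/-- The coefficients of the part of the Lambert series which converges near the unit circle. -/
noncomputable def tailCoeff (k : ℤ) : ℂ := lambertCoeff τ z k - if 0 < k then 1 else 0

/-- The `j`-th derivative of the part of the Lambert series which converges near the unit
circle. -/
noncomputable def lambertTail (j : ℕ) (α : ℂ) : ℂ :=
  ∑' k : ℤ, tailCoeff τ z k * (2 * π * I * k) ^ j * expTwoPi (k * α)

variable {τ z}

theorem tailCoeff_succ (hz : ‖z‖ = 1) (n : ℕ) : tailCoeff τ z (n + 1) =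
    z * expTwoPi τ ^ (n + 1) * (1 - z * expTwoPi τ ^ (n + 1))⁻¹ := by
  have h1 := one_sub_ne_zero_of_norm_lt_one (norm_mul_qpow_lt_one (τ := τ) hz n)
  rw [tailCoeff, lambertCoeff, if_pos (by positivity),
    show (n : ℤ) + 1 = ((n + 1 : ℕ) : ℤ) by push_cast; rfl, zpow_natCast]
  field_simp
  ring

theorem tailCoeff_neg_succ (hz : ‖z‖ = 1) (n : ℕ) : tailCoeff τ z (-((n : ℤ) + 1)) =
    -(z⁻¹ * expTwoPi τ ^ (n + 1) * (1 - z⁻¹ * expTwoPi τ ^ (n + 1))⁻¹) := by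
  rw [tailCoeff, if_neg (by omega), sub_zero, lambertCoeff_neg_succ hz, neg_mul]

/-- Subtracting `1` for `k > 0` removes the limit of the coefficients, so that they decay
geometrically in both directions. -/
theorem exists_norm_tailCoeff_le (hz : ‖z‖ = 1) :
    ∃ C : ℝ, 0 ≤ C ∧ ∀ k : ℤ, ‖tailCoeff τ z k‖ ≤ C * ‖expTwoPi (τ : ℂ)‖ ^ k.natAbs := by
  set ρ := ‖expTwoPi (τ : ℂ)‖ with hρ
  have hρ1 : ρ < 1 := norm_expTwoPi_coe_lt_one τ
  have hρ1' : 0 < 1 - ρ := by linarith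
  have hρ0 : 0 ≤ ρ := norm_nonneg _
  have hb : ∀ (y : ℂ) (n : ℕ), ‖y‖ = 1 →
      ‖y * expTwoPi τ ^ (n + 1) * (1 - y * expTwoPi τ ^ (n + 1))⁻¹‖ ≤
        (1 - ρ)⁻¹ * ρ ^ (n + 1) := by
    intro y n hy
    rw [norm_mul, norm_mul, hy, one_mul, norm_pow, mul_comm, norm_inv]
    refine mul_le_mul_of_nonneg_right (inv_anti₀ hρ1' (le_trans ?_ one_sub_norm_le))
      (by positivity)
    rw [norm_mul, hy, one_mul]
    linarith [norm_expTwoPi_pow_succ_le τ n]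
  refine ⟨(1 - ρ)⁻¹ + ‖tailCoeff τ z 0‖, by positivity, fun k => ?_⟩
  have hmono : ∀ n : ℕ, (1 - ρ)⁻¹ * ρ ^ (n + 1) ≤
      ((1 - ρ)⁻¹ + ‖tailCoeff τ z 0‖) * ρ ^ (n + 1) := fun n =>
    mul_le_mul_of_nonneg_right (le_add_of_nonneg_right (norm_nonneg _)) (by positivity)
  rcases Int.lt_trichotomy k 0 with h | h | h
  · obtain ⟨n, rfl⟩ : ∃ n : ℕ, k = -((n : ℤ) + 1) := ⟨(-k - 1).toNat, by omega⟩
    rw [tailCoeff_neg_succ hz, norm_neg, show (-((n : ℤ) + 1)).natAbs = n + 1 by omega]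
    exact (hb z⁻¹ n (by rw [norm_inv, hz, inv_one])).trans (hmono n)
  · subst h
    simp only [Int.natAbs_zero, pow_zero, mul_one]
    exact le_add_of_nonneg_left (by positivity)
  · obtain ⟨n, rfl⟩ : ∃ n : ℕ, k = (n : ℤ) + 1 := ⟨(k - 1).toNat, by omega⟩
    rw [tailCoeff_succ hz, show ((n : ℤ) + 1).natAbs = n + 1 by omega]
    exact (hb z n hz).trans (hmono n)

/-- The strip in which the tail of the Lambert series is differentiated. -/
def halfStrip (τ : ℍ) : Set ℂ := {α : ℂ | |α.im| < τ.im / 2}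

theorem isOpen_halfStrip (τ : ℍ) : IsOpen (halfStrip τ) :=
  isOpen_lt (continuous_abs.comp Complex.continuous_im) continuous_const

theorem zero_mem_halfStrip (τ : ℍ) : (0 : ℂ) ∈ halfStrip τ := by
  have := τ.im_pos
  simp [halfStrip, this]

theorem norm_expTwoPi_int_mul_le {α : ℂ} (hα : α ∈ halfStrip τ) (k : ℤ) :
    ‖expTwoPi (k * α)‖ ≤ Real.exp (π * τ.im) ^ k.natAbs := by
  have hα' : |α.im| < τ.im / 2 := hα
  rw [norm_expTwoPi, ← Real.exp_nat_mul, Real.exp_le_exp]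
  have h1 : ((k : ℂ) * α).im = k * α.im := by simp
  have h2 : (k.natAbs : ℝ) = |(k : ℝ)| := by rw [Nat.cast_natAbs, Int.cast_abs]
  rw [h1, h2]
  have h3 : -(k * α.im) ≤ |(k : ℝ)| * (τ.im / 2) := by
    calc -(k * α.im) ≤ |(k : ℝ) * α.im| := neg_le_abs _
      _ = |(k : ℝ)| * |α.im| := abs_mul _ _
      _ ≤ _ := mul_le_mul_of_nonneg_left hα'.le (abs_nonneg _)
  nlinarith [Real.pi_pos]

/-- In the half strip the exponentials grow at most like `e^(π Im τ |k|)`, while the coefficients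
decay like `e^(-2π Im τ |k|)`; polynomial factors are harmless. -/
theorem exists_lambertTail_bound (hz : ‖z‖ = 1) (j : ℕ) : ∃ u : ℤ → ℝ, Summable u ∧
    ∀ k : ℤ, ∀ α ∈ halfStrip τ,
      ‖tailCoeff τ z k * (2 * π * I * k) ^ j * expTwoPi (k * α)‖ ≤ u k := by
  obtain ⟨C, hC, h⟩ := exists_norm_tailCoeff_le (τ := τ) hz
  set r := ‖expTwoPi (τ : ℂ)‖ * Real.exp (π * τ.im) with hr
  have hr0 : 0 ≤ r := by positivity
  have hr1 : r < 1 := by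
    rw [hr, norm_expTwoPi, ← Real.exp_add, Real.exp_lt_one_iff, UpperHalfPlane.coe_im]
    nlinarith [τ.im_pos, Real.pi_pos]
  have hs : Summable fun n : ℕ => C * (2 * π) ^ j * ((n : ℝ) ^ j * r ^ n) :=
    (summable_pow_mul_geometric_of_norm_lt_one j
      (show ‖r‖ < 1 by rwa [Real.norm_of_nonneg hr0])).mul_left _
  refine ⟨fun k => C * (2 * π) ^ j * ((k.natAbs : ℝ) ^ j * r ^ k.natAbs),
    Summable.of_nat_of_neg (by simpa using hs) (by simpa using hs), fun k α hα => ?_⟩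
  have h2 : ‖(2 * π * I * k : ℂ) ^ j‖ = (2 * π) ^ j * (k.natAbs : ℝ) ^ j := by
    rw [norm_pow, ← mul_pow]
    congr 1
    rw [Nat.cast_natAbs, Int.cast_abs]
    simp [abs_of_pos Real.pi_pos]
  rw [norm_mul, norm_mul, h2]
  calc ‖tailCoeff τ z k‖ * ((2 * π) ^ j * (k.natAbs : ℝ) ^ j) * ‖expTwoPi (k * α)‖
      ≤ C * ‖expTwoPi (τ : ℂ)‖ ^ k.natAbs * ((2 * π) ^ j * (k.natAbs : ℝ) ^ j) *
        Real.exp (π * τ.im) ^ k.natAbs := by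
        have := Real.pi_pos
        gcongr
        · exact h k
        · exact norm_expTwoPi_int_mul_le hα k
    _ = _ := by rw [hr, mul_pow]; ring

theorem hasDerivAt_lambertTail (hz : ‖z‖ = 1) (j : ℕ) {α : ℂ} (hα : α ∈ halfStrip τ) :
    HasDerivAt (lambertTail τ z j) (lambertTail τ z (j + 1) α) α := by
  obtain ⟨u, hu, h⟩ := exists_lambertTail_bound (τ := τ) hz j
  have hder : ∀ (k : ℤ) (α : ℂ), HasDerivAt
      (fun α => tailCoeff τ z k * (2 * π * I * k) ^ j * expTwoPi (k * α))
      (tailCoeff τ z k * (2 * π * I * k) ^ (j + 1) * expTwoPi (k * α)) α := fun k α =>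
    ((hasDerivAt_expTwoPi_mul k α).const_mul _).congr_deriv (by ring)
  have hdiff : ∀ k : ℤ, DifferentiableOn ℂ
      (fun α => tailCoeff τ z k * (2 * π * I * k) ^ j * expTwoPi (k * α)) (halfStrip τ) :=
    fun k α _ => (hder k α).differentiableAt.differentiableWithinAt
  have h1 := (differentiableOn_tsum_of_summable_norm hu hdiff (isOpen_halfStrip τ)
    h).differentiableAt ((isOpen_halfStrip τ).mem_nhds hα)
  have h2 := hasSum_deriv_of_summable_norm hu hdiff (isOpen_halfStrip τ) h hα
  simp only [(hder _ _).deriv] at h2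
  have h3 := h1.hasDerivAt
  rw [← h2.tsum_eq] at h3
  exact h3

theorem differentiableOn_lambertTail (hz : ‖z‖ = 1) (j : ℕ) :
    DifferentiableOn ℂ (lambertTail τ z j) (halfStrip τ) := fun _ hα =>
  (hasDerivAt_lambertTail hz j hα).differentiableAt.differentiableWithinAt

/-- Leibniz rule for a linear factor. For `n = 0` the truncated index `n - 1` is multiplied by `0`.
-/
theorem iteratedDeriv_mul_lambertTail (hz : ‖z‖ = 1) (n : ℕ) {α : ℂ} (hα : α ∈ halfStrip τ) :
    iteratedDeriv n (fun α => α * lambertTail τ z 0 α) α =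
      α * lambertTail τ z n α + n * lambertTail τ z (n - 1) α := by
  induction n generalizing α with
  | zero => simp
  | succ n ih =>
    have hev : iteratedDeriv n (fun α => α * lambertTail τ z 0 α) =ᶠ[𝓝 α]
        fun α => α * lambertTail τ z n α + n * lambertTail τ z (n - 1) α := by
      filter_upwards [(isOpen_halfStrip τ).mem_nhds hα] with β hβ using ih hβ
    have h1 := (hasDerivAt_id α).mul (hasDerivAt_lambertTail hz n hα)
    have h2 := (hasDerivAt_lambertTail hz (n - 1) hα).const_mul (n : ℂ)
    have h3 := (h1.add h2).deriv
    rw [iteratedDeriv_succ, hev.deriv_eq]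
    refine h3.trans ?_
    cases n with
    | zero => simp; ring
    | succ n => simp; ring

/-- The removed part is the geometric series `∑_{k>0} w^k`; it alone carries the pole at `α = 0` and
forces `Im α > 0`. -/
theorem tsum_lambert_eq (hz : ‖z‖ = 1) {α : ℂ} (hα : α ∈ halfStrip τ) (hα0 : 0 < α.im) :
    ∑' k : ℤ, lambertCoeff τ z k * expTwoPi α ^ k =
      lambertTail τ z 0 α + expTwoPi α / (1 - expTwoPi α) := by
  obtain ⟨u, hu, h⟩ := exists_lambertTail_bound (τ := τ) hz 0
  have hw1 : ‖expTwoPi α‖ < 1 := by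
    rw [norm_expTwoPi, Real.exp_lt_one_iff]
    nlinarith [Real.pi_pos]
  have h1 : HasSum (fun k : ℤ => tailCoeff τ z k * (2 * π * I * k) ^ 0 * expTwoPi (k * α))
      (lambertTail τ z 0 α) := (Summable.of_norm_bounded hu fun k => h k α hα).hasSum
  have h2 : HasSum (fun n : ℕ => expTwoPi α ^ (n + 1)) (expTwoPi α / (1 - expTwoPi α)) := by
    have := (hasSum_geometric_of_norm_lt_one hw1).mul_left (expTwoPi α)
    simpa [pow_succ', div_eq_mul_inv] using this
  have h3 : HasSum (fun k : ℤ => (if 0 < k then 1 else 0) * expTwoPi α ^ k)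
      (expTwoPi α / (1 - expTwoPi α)) := by
    have := HasSum.of_add_one_of_neg_add_one
      (f := fun k : ℤ => (if 0 < k then 1 else 0) * expTwoPi α ^ k)
      (m := expTwoPi α / (1 - expTwoPi α)) (m' := 0) ?_ ?_
    · simpa using this
    · refine h2.congr_fun fun n => ?_
      rw [if_pos (by positivity), one_mul, ← zpow_natCast]
      push_cast
      rfl
    · refine hasSum_zero.congr_fun fun n => ?_
      rw [if_neg (by omega), zero_mul]
  refine HasSum.tsum_eq ((h1.add h3).congr_fun fun k => ?_)
  rw [expTwoPi_int_mul, tailCoeff]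
  ring

/-- The function `α w / (1 - w)` with `w = e(α)` and its singularity at `α = 0` removed. -/
noncomputable def geomReg (α : ℂ) : ℂ := -expTwoPi α / dslope expTwoPi 0 α

theorem deriv_expTwoPi_zero : deriv expTwoPi 0 = 2 * π * I := by
  have := (hasDerivAt_expTwoPi_mul 1 0).deriv
  simpa [expTwoPi_zero] using this

theorem analyticAt_dslope_zero {f : ℂ → ℂ} (hf : Differentiable ℂ f) :
    AnalyticAt ℂ (dslope f 0) 0 :=
  ((Complex.differentiableOn_dslope univ_mem).2 hf.differentiableOn).analyticAt univ_mem

theorem analyticAt_geomReg : AnalyticAt ℂ geomReg 0 := by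
  have h1 : AnalyticAt ℂ (fun α => -expTwoPi α) 0 :=
    (differentiable_expTwoPi.neg).analyticAt 0
  refine h1.fun_div (analyticAt_dslope_zero differentiable_expTwoPi) ?_
  rw [dslope_same, deriv_expTwoPi_zero]
  simp [Real.pi_ne_zero]

theorem geomReg_zero : geomReg 0 = -(2 * π * I)⁻¹ := by
  rw [geomReg, dslope_same, deriv_expTwoPi_zero, expTwoPi_zero, neg_div, one_div]

theorem geomReg_of_ne {α : ℂ} (hα : α ≠ 0) :
    geomReg α = α * (expTwoPi α / (1 - expTwoPi α)) := by
  rw [geomReg, dslope_of_ne _ hα, slope_def_field, expTwoPi_zero, sub_zero,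
    ← neg_sub 1 (expTwoPi α), neg_div, neg_div, div_neg, neg_neg, div_div_eq_mul_div]
  ring

theorem norm_expTwoPi_ofReal (t : ℝ) : ‖expTwoPi t‖ = 1 := by
  rw [norm_expTwoPi]; simp

theorem expTwoPi_ofReal_ne_one {t : ℝ} (ht : t ∈ Set.Ioo (0 : ℝ) 1) : expTwoPi t ≠ 1 := by
  intro h
  rw [expTwoPi, Complex.exp_eq_one_iff] at h
  obtain ⟨n, hn⟩ := h
  have h2 : (2 * π * I : ℂ) ≠ 0 := by simp [Real.pi_ne_zero]
  have h3 : (t : ℂ) = n := mul_left_cancel₀ h2 (by rw [hn]; ring)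
  have h4 : t = (n : ℝ) := by exact_mod_cast h3
  obtain ⟨h5, h6⟩ := ht
  rw [h4] at h5 h6
  have h7 : 0 < n := by exact_mod_cast h5
  have h8 : n < 1 := by exact_mod_cast h6
  omega

/-- The regular part `α ↦ α F / (-2πi)` of the Kronecker function, as a Lambert series. -/
noncomputable def lambertReg (τ : ℍ) (z α : ℂ) : ℂ := geomReg α + α * lambertTail τ z 0 α

theorem analyticAt_mul_lambertTail (hz : ‖z‖ = 1) :
    AnalyticAt ℂ (fun α => α * lambertTail τ z 0 α) 0 :=
  (differentiableOn_id.mul (differentiableOn_lambertTail hz 0)).analyticAt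
    ((isOpen_halfStrip τ).mem_nhds (zero_mem_halfStrip τ))

theorem analyticAt_lambertReg (hz : ‖z‖ = 1) : AnalyticAt ℂ (lambertReg τ z) 0 :=
  analyticAt_geomReg.add (analyticAt_mul_lambertTail hz)

/-- `theta_mul_lambert` gives the identity for small `α` on the positive imaginary axis. These
points accumulate at `0`, where both sides are analytic. -/
theorem dslope_oddTheta_mul_lambertReg (τ : ℍ) {t : ℝ} (ht : t ∈ Set.Ioo (0 : ℝ) 1) :
    ∃ C : ℂ, ∀ᶠ α in 𝓝 (0 : ℂ),
      dslope (fun ξ => oddTheta ξ τ) 0 α * lambertReg τ (expTwoPi t) α =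
        C * oddTheta (t + α) τ := by
  have hz := norm_expTwoPi_ofReal t
  have hz1 := expTwoPi_ofReal_ne_one ht
  obtain ⟨C, hC⟩ := theta_mul_lambert (τ := τ) hz hz1
  -- The half-integral exponents put a prefactor `e((t + α)/2)` into `θ(t + α)`; its part `e(t/2)`
  -- is absorbed in the constant.
  refine ⟨C * (expTwoPi (t / 2))⁻¹, ?_⟩
  have han1 : AnalyticAt ℂ (fun α => dslope (fun ξ => oddTheta ξ τ) 0 α *
      lambertReg τ (expTwoPi t) α) 0 :=
    (analyticAt_dslope_zero (differentiable_oddTheta τ)).mul (analyticAt_lambertReg hz)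
  have han2 : AnalyticAt ℂ (fun α => C * (expTwoPi (t / 2))⁻¹ * oddTheta (t + α) τ) 0 := by
    have : Differentiable ℂ fun α : ℂ => C * (expTwoPi (t / 2))⁻¹ * oddTheta (t + α) τ :=
      ((differentiable_oddTheta τ).comp (differentiable_id.const_add (t : ℂ))).const_mul _
    exact this.analyticAt 0
  refine (han1.frequently_eq_iff_eventually_eq han2).1 ?_
  have htend : Tendsto (fun x : ℝ => (x : ℂ) * I) (𝓝[>] 0) (𝓝[≠] 0) := by
    refine tendsto_nhdsWithin_iff.2 ⟨?_, ?_⟩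
    · have : Tendsto (fun x : ℝ => (x : ℂ) * I) (𝓝 0) (𝓝 ((0 : ℝ) * I)) :=
        (Complex.continuous_ofReal.mul continuous_const).tendsto 0
      rw [Complex.ofReal_zero, zero_mul] at this
      exact this.mono_left nhdsWithin_le_nhds
    · filter_upwards [self_mem_nhdsWithin] with x hx
      have hx' : x ≠ 0 := ne_of_gt hx
      simp [hx']
  refine htend.frequently (Eventually.frequently ?_)
  have hτ : (0 : ℝ) < τ.im / 2 := half_pos τ.im_pos
  filter_upwards [Ioo_mem_nhdsGT hτ] with x hx
  set α : ℂ := (x : ℂ) * I with hα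
  have him : α.im = x := by simp [hα]
  have hα0 : α ≠ 0 := fun h => by
    rw [h] at him
    exact hx.1.ne (by simpa using him)
  have hmem : α ∈ halfStrip τ := by
    change |α.im| < _
    rw [him, abs_of_pos hx.1]
    exact hx.2
  have hw1 : ‖expTwoPi α‖ < 1 := by
    rw [norm_expTwoPi, Real.exp_lt_one_iff, him]
    nlinarith [hx.1, Real.pi_pos]
  have hw : ‖expTwoPi (τ : ℂ)‖ < ‖expTwoPi α‖ := by
    rw [norm_expTwoPi, norm_expTwoPi, Real.exp_lt_exp, him, UpperHalfPlane.coe_im]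
    nlinarith [hx.1, hx.2, Real.pi_pos, τ.im_pos]
  have h1 := hC α hw hw1
  rw [tsum_lambert_eq hz hmem (by rw [him]; exact hx.1)] at h1
  rw [dslope_of_ne _ hα0, slope_def_field, oddTheta_zero, sub_zero, sub_zero, lambertReg,
    geomReg_of_ne hα0, oddTheta_eq_tsum, oddTheta_eq_tsum (t + α), expTwoPi_add, add_div,
    expTwoPi_add]
  have h2 := expTwoPi_ne_zero ((t : ℂ) / 2)
  rw [show C * (expTwoPi (t / 2))⁻¹ * (expTwoPi (t / 2) * expTwoPi (α / 2) *
      ∑' j : ℤ, thetaCoeff τ j * (expTwoPi t * expTwoPi α) ^ j) = expTwoPi (α / 2) *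
      (C * ∑' j : ℤ, thetaCoeff τ j * (expTwoPi t * expTwoPi α) ^ j) by field_simp, ← h1]
  field_simp
  ring

/-- If `θ'(0) = 0`, the previous identity at `α = 0` gives `C θ(t) = 0`. Were `C = 0`, theta would
vanish near `0`; hence `θ(t) = 0` on `(0, 1)`, against the identity theorem. -/
theorem deriv_oddTheta_zero_ne_zero (τ : ℍ) : oddThetaDerivZero τ ≠ 0 := by
  intro h0
  have key : ∀ t : ℝ, t ∈ Set.Ioo (0 : ℝ) 1 → oddTheta t τ = 0 := by
    intro t ht
    obtain ⟨C, hC⟩ := dslope_oddTheta_mul_lambertReg τ ht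
    have h1 := hC.self_of_nhds
    rw [dslope_same, add_zero] at h1
    change oddThetaDerivZero τ * _ = _ at h1
    rw [h0, zero_mul] at h1
    rcases mul_eq_zero.1 h1.symm with h2 | h2
    · exfalso
      have hne : ∀ᶠ α in 𝓝 (0 : ℂ), lambertReg τ (expTwoPi t) α ≠ 0 := by
        refine (analyticAt_lambertReg (norm_expTwoPi_ofReal t)).continuousAt.eventually_ne ?_
        rw [lambertReg, geomReg_zero]
        simp [Real.pi_ne_zero]
      refine oddTheta_not_eventually_zero τ 0 ?_
      filter_upwards [hC, hne] with α h3 h4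
      rw [h2, zero_mul] at h3
      have h5 := (mul_eq_zero.1 h3).resolve_right h4
      have h6 := sub_smul_dslope (fun ξ => oddTheta ξ τ) 0 α
      rw [h5, smul_zero, oddTheta_zero, sub_zero] at h6
      exact h6.symm
    · exact h2
  have han : AnalyticAt ℂ (fun ξ => oddTheta ξ τ) ((1 / 2 : ℝ) : ℂ) :=
    (differentiable_oddTheta τ).analyticAt _
  refine oddTheta_not_eventually_zero τ _ (han.frequently_zero_iff_eventually_zero.1 ?_)
  have htend : Tendsto (fun x : ℝ => (x : ℂ)) (𝓝[>] (1 / 2 : ℝ)) (𝓝[≠] ((1 / 2 : ℝ) : ℂ)) := by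
    refine tendsto_nhdsWithin_iff.2
      ⟨(Complex.continuous_ofReal.tendsto _).mono_left nhdsWithin_le_nhds, ?_⟩
    filter_upwards [self_mem_nhdsWithin] with x hx
    exact fun h => (ne_of_gt hx) (Complex.ofReal_injective h)
  refine htend.frequently (Eventually.frequently ?_)
  filter_upwards [Ioo_mem_nhdsGT (show (1 / 2 : ℝ) < 1 by norm_num)] with x hx
  exact key x ⟨by linarith [hx.1], hx.2⟩

/-- Kronecker's formula. -/
theorem kroneckerReg_eventuallyEq (τ : ℍ) {t : ℝ} (ht : t ∈ Set.Ioo (0 : ℝ) 1) :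
    kroneckerReg t τ =ᶠ[𝓝 0] fun α => -(2 * π * I) * lambertReg τ (expTwoPi t) α := by
  have hd := deriv_oddTheta_zero_ne_zero τ
  obtain ⟨C, hC⟩ := dslope_oddTheta_mul_lambertReg τ ht
  have hpi : (2 * π * I : ℂ) ≠ 0 := by simp [Real.pi_ne_zero]
  -- Evaluation at `α = 0` determines `C θ(t)` from `θ'(0)` and shows that neither factor vanishes.
  have h1 := hC.self_of_nhds
  rw [dslope_same, add_zero, lambertReg, geomReg_zero, zero_mul, add_zero] at h1
  change oddThetaDerivZero τ * _ = _ at h1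
  have hne : oddThetaDerivZero τ * -(2 * π * I)⁻¹ ≠ 0 :=
    mul_ne_zero hd (neg_ne_zero.2 (inv_ne_zero hpi))
  rw [h1] at hne
  have hC0 : C ≠ 0 := left_ne_zero_of_mul hne
  have ht0 : oddTheta t τ ≠ 0 := right_ne_zero_of_mul hne
  have hds : ∀ᶠ α in 𝓝 (0 : ℂ), dslope (fun ξ => oddTheta ξ τ) 0 α ≠ 0 := by
    refine (analyticAt_dslope_zero (differentiable_oddTheta τ)).continuousAt.eventually_ne ?_
    rw [dslope_same]
    exact hd
  have h2 : oddThetaDerivZero τ = -(2 * π * I) * (C * oddTheta t τ) := by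
    rw [← h1]; field_simp
  filter_upwards [hC, hds] with α h3 h4
  rw [kroneckerReg, h2, div_eq_iff (mul_ne_zero ht0 h4)]
  linear_combination (2 * π * I) * oddTheta t τ * h3

theorem kroneckerCoeff_eq (n : ℕ) (τ : ℍ) {t : ℝ} (ht : t ∈ Set.Ioo (0 : ℝ) 1) :
    kroneckerCoeff n t τ = (2 * π * I) ^ (1 - (n : ℤ)) * (-(2 * π * I) *
      (iteratedDeriv n geomReg 0 + n * lambertTail τ (expTwoPi t) (n - 1) 0) / (n ! : ℂ)) := by
  have hz := norm_expTwoPi_ofReal t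
  rw [kroneckerCoeff, (kroneckerReg_eventuallyEq τ ht).iteratedDeriv_eq n,
    iteratedDeriv_const_mul_field]
  have h1 : iteratedDeriv n (lambertReg τ (expTwoPi t)) 0 = iteratedDeriv n geomReg 0 +
      iteratedDeriv n (fun α => α * lambertTail τ (expTwoPi t) 0 α) 0 :=
    iteratedDeriv_fun_add analyticAt_geomReg.contDiffAt
      (analyticAt_mul_lambertTail hz).contDiffAt
  rw [h1, iteratedDeriv_mul_lambertTail hz n (zero_mem_halfStrip τ), zero_mul, zero_add]

end KroneckerExpansion

/-! ### Fourier expansion of `ω_n` on the real line -/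

section Omega

variable {τ : ℍ} {z : ℂ}

theorem summable_lambert_double (hz : ‖z‖ = 1) (j : ℕ) : Summable fun x : ℕ+ × ℕ+ =>
    (x.2 : ℂ) ^ j * z ^ (x.1 : ℕ) * expTwoPi τ ^ (x.1 * x.2 : ℕ) := by
  refine Summable.of_norm_bounded (summable_prod_mul_pow j (norm_expTwoPi_coe_lt_one τ)).norm
    fun x => ?_
  rw [norm_mul, norm_mul, norm_mul, norm_pow z, hz, one_pow, mul_one]

/-- Each `z q^k / (1 - z q^k)` is a geometric series in `m`. -/
theorem hasSum_lambert_double (hz : ‖z‖ = 1) (j : ℕ) :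
    HasSum (fun n : ℕ => ((n : ℂ) + 1) ^ j *
      (z * expTwoPi τ ^ (n + 1) * (1 - z * expTwoPi τ ^ (n + 1))⁻¹))
      (∑' x : ℕ+ × ℕ+, (x.2 : ℂ) ^ j * z ^ (x.1 : ℕ) * expTwoPi τ ^ (x.1 * x.2 : ℕ)) := by
  have hs := summable_lambert_double (τ := τ) hz j
  have h1 := (Equiv.hasSum_iff (Equiv.prodComm ℕ+ ℕ+)).2 hs.hasSum
  have hinner : ∀ k : ℕ+, HasSum (fun m : ℕ+ =>
      (k : ℂ) ^ j * z ^ (m : ℕ) * expTwoPi τ ^ (m * k : ℕ))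
      ((k : ℂ) ^ j * (z * expTwoPi τ ^ (k : ℕ) * (1 - z * expTwoPi τ ^ (k : ℕ))⁻¹)) := by
    intro k
    have hk : ((k : ℕ) - 1) + 1 = k := Nat.sub_add_cancel k.pos
    have hlt := norm_mul_qpow_lt_one (τ := τ) hz ((k : ℕ) - 1)
    rw [hk] at hlt
    have hg := ((hasSum_geometric_of_norm_lt_one hlt).mul_left
      (z * expTwoPi (τ : ℂ) ^ (k : ℕ))).mul_left ((k : ℂ) ^ j)
    refine (Equiv.hasSum_iff Equiv.pnatEquivNat.symm).1 (hg.congr_fun fun n => ?_)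
    simp only [Function.comp_apply, Equiv.pnatEquivNat_symm_apply, Nat.succPNat_coe]
    rw [Nat.succ_eq_add_one, mul_comm (n + 1) (k : ℕ), pow_mul, pow_succ, pow_succ, mul_pow]
    ring
  have h2 := h1.prod_fiberwise hinner
  have h3 := (Equiv.hasSum_iff Equiv.pnatEquivNat.symm).2 h2
  refine h3.congr_fun fun n => ?_
  simp [Nat.succ_eq_add_one]

/-- The Fourier series `∑_{m,k} k^(n-1) (e(mt) + (-1)^n e(-mt)) q^(mk)`. -/
noncomputable def omegaSeries (n : ℕ) (τ : ℍ) (t : ℝ) : ℂ :=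
  ∑' x : ℕ+ × ℕ+, (x.2 : ℂ) ^ (n - 1) *
    (expTwoPi ((x.1 : ℤ) * t) + (-1) ^ n * expTwoPi ((-(x.1 : ℤ) : ℤ) * t)) *
    expTwoPi τ ^ (x.1 * x.2 : ℕ)

theorem norm_omegaSeries_term_le (n : ℕ) (τ : ℍ) (t : ℝ) (x : ℕ+ × ℕ+) :
    ‖(x.2 : ℂ) ^ (n - 1) *
      (expTwoPi ((x.1 : ℤ) * t) + (-1) ^ n * expTwoPi ((-(x.1 : ℤ) : ℤ) * t)) *
      expTwoPi τ ^ (x.1 * x.2 : ℕ)‖ ≤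
      2 * ‖(x.2 : ℂ) ^ (n - 1) * expTwoPi τ ^ (x.1 * x.2 : ℕ)‖ := by
  have h : ∀ m : ℤ, ‖expTwoPi (m * t)‖ = 1 := fun m => by
    have := norm_expTwoPi_ofReal (m * t)
    push_cast at this
    exact this
  have h2 : ‖expTwoPi ((x.1 : ℤ) * t) + (-1) ^ n * expTwoPi ((-(x.1 : ℤ) : ℤ) * t)‖ ≤ 2 := by
    refine (norm_add_le _ _).trans ?_
    rw [norm_mul, norm_pow, norm_neg, norm_one, one_pow, one_mul, h, h]
    norm_num
  rw [mul_right_comm, norm_mul, mul_comm]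
  exact mul_le_mul_of_nonneg_right h2 (norm_nonneg _)

theorem summable_omegaSeries_bound (n : ℕ) (τ : ℍ) : Summable fun x : ℕ+ × ℕ+ =>
    2 * ‖(x.2 : ℂ) ^ (n - 1) * expTwoPi τ ^ (x.1 * x.2 : ℕ)‖ :=
  (summable_prod_mul_pow (n - 1) (norm_expTwoPi_coe_lt_one τ)).norm.mul_left 2

theorem continuous_omegaSeries (n : ℕ) (τ : ℍ) : Continuous (omegaSeries n τ) := by
  refine continuous_tsum (fun x => ?_) (summable_omegaSeries_bound n τ)
    fun x t => norm_omegaSeries_term_le n τ t x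
  have h := fun m : ℤ => continuous_expTwoPi_mul_ofReal m
  exact (continuous_const.mul ((h _).add (continuous_const.mul (h _)))).mul continuous_const

/-- Positive indices give the terms `e(mt)`, negative ones `e(-mt)` with sign `(-1)^(n+1)`. The
index `k = 0` survives only for `n = 0`, because of the factor `k^n`. -/
theorem lambertTail_zero_eq (n : ℕ) (τ : ℍ) (t : ℝ) :
    lambertTail τ (expTwoPi t) n 0 = (if n = 0 then (1 - expTwoPi t)⁻¹ else 0) +
      (2 * π * I) ^ n * omegaSeries (n + 1) τ t := by
  have hz := norm_expTwoPi_ofReal t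
  have hz' : ‖(expTwoPi t)⁻¹‖ = 1 := by rw [norm_inv, hz, inv_one]
  have h1 := (hasSum_lambert_double (τ := τ) hz n).mul_left ((2 * π * I) ^ n)
  have h2 := (hasSum_lambert_double (τ := τ) hz' n).mul_left (-(-(2 * π * I)) ^ n)
  have h3 := HasSum.of_add_one_of_neg_add_one
    (f := fun k : ℤ => tailCoeff τ (expTwoPi t) k * (2 * π * I * k) ^ n * expTwoPi (k * 0))
    (h1.congr_fun fun k => by
      rw [mul_zero, expTwoPi_zero, tailCoeff_succ hz]
      push_cast
      rw [mul_pow _ ((k : ℂ) + 1)]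
      ring) (h2.congr_fun fun k => by
      rw [mul_zero, expTwoPi_zero, tailCoeff_neg_succ hz]
      push_cast
      rw [show (2 * π * I * -((k : ℂ) + 1)) = -(2 * π * I) * ((k : ℂ) + 1) by ring, mul_pow]
      ring)
  rw [lambertTail, h3.tsum_eq, omegaSeries, Nat.add_sub_cancel, ← tsum_mul_left, ← tsum_mul_left,
    add_right_comm, ← Summable.tsum_add ((summable_lambert_double hz n).mul_left _)
      ((summable_lambert_double hz' n).mul_left _), ← tsum_mul_left, add_comm]
  congr 1
  · rcases Nat.eq_zero_or_pos n with rfl | hn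
    · simp [tailCoeff, lambertCoeff, expTwoPi_zero]
    · simp [hn.ne']
  · refine tsum_congr fun x => ?_
    rw [expTwoPi_int_mul, expTwoPi_int_mul, zpow_neg, zpow_natCast, inv_pow, neg_pow (2 * π * I)]
    ring

theorem kroneckerOmega_ofReal (n : ℕ) (t : ℝ) (τ : ℍ) :
    kroneckerOmega n t τ = kroneckerCoeff n t τ := by
  rw [kroneckerOmega, Finset.sum_eq_single 0]
  · simp
  · intro k _ hk
    simp [rTau, hk]
  · simp

theorem kroneckerOmega_zero {t : ℝ} (ht : t ∈ Set.Ioo (0 : ℝ) 1) (τ : ℍ) :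
    kroneckerOmega 0 t τ = 2 * π * I := by
  rw [kroneckerOmega_ofReal, kroneckerCoeff_eq 0 τ ht]
  have hpi : (2 * π * I : ℂ) ≠ 0 := by simp [Real.pi_ne_zero]
  simp [geomReg_zero, field]

/-- The contribution of `w / (1 - w)` to `ω_n`. -/
noncomputable def omegaConst (n : ℕ) : ℂ :=
  (2 * π * I) ^ (1 - (n : ℤ)) * (-(2 * π * I) * iteratedDeriv n geomReg 0 / (n ! : ℂ))

/-- Only `ω_1` has a pole at the end points, and the polar term is independent of `τ`. -/
theorem kroneckerOmega_succ (n : ℕ) {t : ℝ} (ht : t ∈ Set.Ioo (0 : ℝ) 1) (τ : ℍ) :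
    kroneckerOmega (n + 1) t τ = omegaConst (n + 1) +
      (if n = 0 then -(2 * π * I) * (1 - expTwoPi t)⁻¹ else 0) +
      -(2 * π * I) / (n ! : ℂ) * omegaSeries (n + 1) τ t := by
  rw [kroneckerOmega_ofReal, kroneckerCoeff_eq _ τ ht, Nat.add_sub_cancel, lambertTail_zero_eq,
    omegaConst]
  have hpi : (2 * π * I : ℂ) ≠ 0 := by simp [Real.pi_ne_zero]
  have h1 : (2 * π * I : ℂ) ^ (1 - ((n + 1 : ℕ) : ℤ)) = ((2 * π * I) ^ n)⁻¹ := by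
    rw [← zpow_natCast, ← zpow_neg]; congr 1; push_cast; ring
  have h2 : ((n + 1)! : ℂ) = (n + 1) * n ! := by push_cast [Nat.factorial_succ]; ring
  have h3 : (n ! : ℂ) ≠ 0 := Nat.cast_ne_zero.2 (Nat.factorial_ne_zero n)
  have h4 : (n : ℂ) + 1 ≠ 0 := Nat.cast_add_one_ne_zero n
  rw [h1, h2]
  rcases Nat.eq_zero_or_pos n with rfl | hn
  · simp; ring
  · rw [if_neg hn.ne', if_neg hn.ne']
    push_cast
    field_simp
    ring

/-! ### Moments of exponentials against polynomials -/

/-- Repeated integration by parts: each boundary term brings one more power of `1/m`, with a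
coefficient independent of `m`. The first coefficient is recorded because it multiplies the weight
two term when `n = 1`. -/
theorem exists_moment_coeff (N : ℕ) (p : ℂ[X]) (hp : p.natDegree ≤ N) :
    ∃ c : ℕ → ℂ, c 0 = (p.eval 1 - p.eval 0) / (2 * π * I) ∧ ∀ m : ℤ, m ≠ 0 →
      ∫ t in (0 : ℝ)..1, p.eval (t : ℂ) * expTwoPi (m * t) =
        ∑ b ∈ Finset.range N, c b * ((m : ℂ) ^ (b + 1))⁻¹ := by
  induction N generalizing p with
  | zero =>
    obtain ⟨a, rfl⟩ := Polynomial.natDegree_eq_zero.1 (Nat.le_zero.1 hp)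
    refine ⟨0, by simp, fun m hm => ?_⟩
    simp [integral_expTwoPi_int_mul hm]
  | succ N ih =>
    obtain ⟨c, -, hc⟩ := ih p.derivative ((Polynomial.natDegree_derivative_le p).trans (by omega))
    refine ⟨fun b => Nat.casesOn b ((p.eval 1 - p.eval 0) / (2 * π * I))
      fun b => -(2 * π * I)⁻¹ * c b, rfl, fun m hm => ?_⟩
    have hpi : (2 * π * I : ℂ) ≠ 0 := by simp [Real.pi_ne_zero]
    have hm' : (m : ℂ) ≠ 0 := Int.cast_ne_zero.2 hm
    have hu : ∀ t ∈ Set.uIcc (0 : ℝ) 1, HasDerivAt (fun t : ℝ => p.eval (t : ℂ))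
        (p.derivative.eval (t : ℂ)) t := fun t _ => (p.hasDerivAt (t : ℂ)).comp_ofReal
    have hv : ∀ t ∈ Set.uIcc (0 : ℝ) 1,
        HasDerivAt (fun t : ℝ => (2 * π * I * m)⁻¹ * expTwoPi (m * t)) (expTwoPi (m * t)) t :=
      fun t _ => by
        have := ((hasDerivAt_expTwoPi_mul m t).comp_ofReal).const_mul (2 * π * I * m : ℂ)⁻¹
        exact this.congr_deriv (by field_simp)
    have hcp : ∀ p : ℂ[X], Continuous fun t : ℝ => p.eval (t : ℂ) := fun p =>
      p.continuous.comp Complex.continuous_ofReal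
    have h := intervalIntegral.integral_mul_deriv_eq_deriv_mul hu hv
      ((hcp _).intervalIntegrable _ _) ((continuous_expTwoPi_mul_ofReal m).intervalIntegrable _ _)
    have h1 : ∫ t in (0 : ℝ)..1, p.derivative.eval (t : ℂ) *
        ((2 * π * I * m)⁻¹ * expTwoPi (m * t)) = (2 * π * I * m)⁻¹ *
        ∫ t in (0 : ℝ)..1, p.derivative.eval (t : ℂ) * expTwoPi (m * t) := by
      rw [← intervalIntegral.integral_const_mul]
      congr 1
      ext t
      ring
    rw [h, h1, hc m hm, Finset.sum_range_succ', Finset.mul_sum]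
    simp only [Complex.ofReal_one, Complex.ofReal_zero, mul_one, mul_zero, expTwoPi_zero,
      expTwoPi_int]
    rw [sub_eq_neg_add, ← Finset.sum_neg_distrib]
    congr 1
    · refine Finset.sum_congr rfl fun b _ => ?_
      rw [pow_succ (m : ℂ) (b + 1), mul_inv, mul_inv]
      ring
    · change _ = (p.eval 1 - p.eval 0) / (2 * π * I) * _
      simp only [zero_add, pow_one]
      field_simp

/-- The moments of `omegaSeries` against a polynomial are Eichler integrals. -/
theorem exists_integral_omegaSeries (N : ℕ) (p : ℂ[X]) (hp : p.natDegree ≤ N) (n : ℕ) :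
    ∃ c : ℕ → ℂ, c 0 = (p.eval 1 - p.eval 0) / (2 * π * I) ∧ ∀ τ : ℍ,
      ∫ t in (0 : ℝ)..1, omegaSeries n τ t * p.eval (t : ℂ) =
        ∑ b ∈ Finset.range N, c b * (1 + (-1) ^ (n + b + 1)) *
          qSeries (eichlerCoeff (n - 1) (b + 1)) τ := by
  obtain ⟨c, hc0, hc⟩ := exists_moment_coeff N p hp
  refine ⟨c, hc0, fun τ => ?_⟩
  have hcp : Continuous fun t : ℝ => p.eval (t : ℂ) := p.continuous.comp Complex.continuous_ofReal
  obtain ⟨M, hM⟩ := isCompact_uIcc.exists_bound_of_continuousOn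
    (s := Set.uIcc (0 : ℝ) 1) hcp.continuousOn
  have hM0 : 0 ≤ M := (norm_nonneg _).trans (hM 0 (by simp))
  have he := fun m : ℤ => continuous_expTwoPi_mul_ofReal m
  have h1 := hasSum_intervalIntegral_of_norm_le (a := 0) (b := 1)
    (F := fun (x : ℕ+ × ℕ+) (t : ℝ) => (x.2 : ℂ) ^ (n - 1) *
      (expTwoPi ((x.1 : ℤ) * t) + (-1) ^ n * expTwoPi ((-(x.1 : ℤ) : ℤ) * t)) *
      expTwoPi τ ^ (x.1 * x.2 : ℕ) * p.eval (t : ℂ))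
    ((summable_omegaSeries_bound n τ).mul_right M)
    (fun x => ((continuous_const.mul ((he _).add (continuous_const.mul (he _)))).mul
      continuous_const).mul hcp)
    (fun x t ht => by
      rw [norm_mul]
      exact mul_le_mul (norm_omegaSeries_term_le n τ t x)
        (hM t (Set.uIoc_subset_uIcc ht)) (norm_nonneg _) (by positivity))
  simp only [tsum_mul_right] at h1
  refine h1.unique (HasSum.congr_fun (hasSum_sum fun b _ =>
    (hasSum_eichler (n - 1) (b + 1) τ).mul_left (c b * (1 + (-1) ^ (n + b + 1)))) fun x => ?_)
  have hx : ((x.1 : ℕ) : ℤ) ≠ 0 := by have := x.1.pos; omega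
  have e : ∀ t : ℝ, (x.2 : ℂ) ^ (n - 1) *
      (expTwoPi ((x.1 : ℤ) * t) + (-1) ^ n * expTwoPi ((-(x.1 : ℤ) : ℤ) * t)) *
      expTwoPi τ ^ (x.1 * x.2 : ℕ) * p.eval (t : ℂ) =
      (x.2 : ℂ) ^ (n - 1) * expTwoPi τ ^ (x.1 * x.2 : ℕ) *
        (p.eval (t : ℂ) * expTwoPi (((x.1 : ℕ) : ℤ) * t) +
          (-1) ^ n * (p.eval (t : ℂ) * expTwoPi ((-((x.1 : ℕ) : ℤ) : ℤ) * t))) := fun t => by ring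
  have hi : ∀ m : ℤ, IntervalIntegrable (fun t : ℝ => p.eval (t : ℂ) * expTwoPi (m * t))
      MeasureTheory.volume 0 1 := fun m => (hcp.mul (he m)).intervalIntegrable _ _
  simp only [e]
  rw [intervalIntegral.integral_const_mul,
    intervalIntegral.integral_add (hi _) ((hi _).const_mul _),
    intervalIntegral.integral_const_mul, hc _ hx, hc _ (neg_ne_zero.2 hx), Finset.mul_sum,
    ← Finset.sum_add_distrib, Finset.mul_sum]
  refine Finset.sum_congr rfl fun b _ => ?_
  push_cast
  -- Replacing `m` by `-m` changes `m^(-(b+1))` by `(-1)^(b+1)`; together with the sign `(-1)^n`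
  -- this is the parity factor.
  rw [neg_pow ((x.1 : ℕ) : ℂ), mul_inv, show n + b + 1 = n + (b + 1) by ring,
    pow_add (-1 : ℂ) n (b + 1)]
  have : ((-1 : ℂ) ^ (b + 1))⁻¹ = (-1) ^ (b + 1) := by
    rw [← inv_pow]; norm_num
  rw [this]
  ring

end Omega

/-! ### Iterated integrals and their regularization -/

section IterIntegral

open Set MeasureTheory

theorem iterIntegral_map_congr {a b : ℝ} {f g : ℕ → ℝ → ℂ} {l : List ℕ}
    (h : ∀ n ∈ l, EqOn (f n) (g n) (Icc a b)) :
    EqOn (iterIntegral a (l.map f)) (iterIntegral a (l.map g)) (Icc a b) := by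
  induction l with
  | nil => exact fun _ _ => rfl
  | cons n l ih =>
    intro x hx
    simp only [List.map_cons, iterIntegral]
    refine intervalIntegral.integral_congr fun t ht => ?_
    rw [uIcc_of_le hx.1] at ht
    have ht' : t ∈ Icc a b := ⟨ht.1, ht.2.trans hx.2⟩
    rw [h n (by simp) ht', ih (fun m hm => h m (by simp [hm])) ht']

theorem iterIntegral_replicate_const (a : ℝ) (c : ℂ) (q : ℕ) (x : ℝ) :
    iterIntegral a (List.replicate q fun _ => c) x =
      c ^ q * (((x - a : ℝ) : ℂ) ^ q / (q ! : ℂ)) := by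
  induction q generalizing x with
  | zero => simp [iterIntegral]
  | succ q ih =>
    have hq : ((q + 1)! : ℂ) ≠ 0 := Nat.cast_ne_zero.2 (Nat.factorial_ne_zero _)
    have hq' : (q ! : ℂ) ≠ 0 := Nat.cast_ne_zero.2 (Nat.factorial_ne_zero _)
    have hq1 : (q : ℂ) + 1 ≠ 0 := Nat.cast_add_one_ne_zero q
    have hd : ∀ t ∈ uIcc a x, HasDerivAt
        (fun t : ℝ => c ^ (q + 1) * (((t - a : ℝ) : ℂ) ^ (q + 1) / ((q + 1)! : ℂ)))
        (c * (c ^ q * (((t - a : ℝ) : ℂ) ^ q / (q ! : ℂ)))) t := fun t _ => by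
      have h1 : HasDerivAt (fun t : ℝ => ((t - a : ℝ) : ℂ)) 1 t := by
        simpa using ((hasDerivAt_id t).sub_const a).ofReal_comp
      refine (((h1.pow (q + 1)).div_const ((q + 1)! : ℂ)).const_mul (c ^ (q + 1))).congr_deriv ?_
      rw [Nat.factorial_succ]
      push_cast
      field_simp
      ring
    have hc : Continuous fun t : ℝ => c * (c ^ q * (((t - a : ℝ) : ℂ) ^ q / (q ! : ℂ))) := by
      fun_prop
    simp only [List.replicate_succ, iterIntegral, ih]
    rw [intervalIntegral.integral_eq_sub_of_hasDerivAt hd (hc.intervalIntegrable _ _)]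
    simp

/-- The `(s + 1)`-fold primitive of `h` with base point `a`. -/
noncomputable def repeatedIntegral (a : ℝ) (s : ℕ) (h : ℝ → ℂ) (x : ℝ) : ℂ :=
  ∫ u in a..x, h u * (((x - u : ℝ) : ℂ) ^ s / (s ! : ℂ))

/-- Integration by parts; the kernel vanishes at `u = x` and the primitive at `u = a`. -/
theorem repeatedIntegral_succ (a : ℝ) (s : ℕ) {h : ℝ → ℂ} (hh : Continuous h) (x : ℝ) :
    repeatedIntegral a (s + 1) h x = repeatedIntegral a s (fun t => ∫ u in a..t, h u) x := by
  have hs : (s ! : ℂ) ≠ 0 := Nat.cast_ne_zero.2 (Nat.factorial_ne_zero _)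
  have hs1 : (s : ℂ) + 1 ≠ 0 := Nat.cast_add_one_ne_zero s
  have hu : ∀ t ∈ uIcc a x, HasDerivAt (fun t => ∫ u in a..t, h u) (h t) t := fun t _ =>
    intervalIntegral.integral_hasDerivAt_right (hh.intervalIntegrable _ _)
      (hh.stronglyMeasurableAtFilter _ _) hh.continuousAt
  have hv : ∀ t ∈ uIcc a x, HasDerivAt
      (fun u : ℝ => ((x - u : ℝ) : ℂ) ^ (s + 1) / ((s + 1)! : ℂ))
      (-(((x - t : ℝ) : ℂ) ^ s / (s ! : ℂ))) t := fun t _ => by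
    have h1 : HasDerivAt (fun t : ℝ => ((x - t : ℝ) : ℂ)) (-1) t := by
      simpa using ((hasDerivAt_id t).const_sub x).ofReal_comp
    refine ((h1.pow (s + 1)).div_const ((s + 1)! : ℂ)).congr_deriv ?_
    rw [Nat.factorial_succ]
    push_cast
    field_simp
  have hc : Continuous fun t : ℝ => -(((x - t : ℝ) : ℂ) ^ s / (s ! : ℂ)) := by fun_prop
  have key := intervalIntegral.integral_mul_deriv_eq_deriv_mul hu hv (hh.intervalIntegrable _ _)
    (hc.intervalIntegrable _ _)
  simp only [mul_neg, intervalIntegral.integral_neg] at key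
  rw [repeatedIntegral, repeatedIntegral]
  simp only [sub_self, Complex.ofReal_zero, ne_eq, Nat.succ_ne_zero, not_false_eq_true, zero_pow,
    zero_div, mul_zero, intervalIntegral.integral_same, zero_mul, zero_sub] at key
  exact (neg_injective key).symm

/-- Cauchy's formula for repeated integration. The induction runs over all `h` at once, passing from
`h` to its primitive, so no exchange of integrals is needed. -/
theorem integral_repeatedIntegral (a : ℝ) (s : ℕ) {h : ℝ → ℂ} (hh : Continuous h) (x : ℝ) :
    ∫ t in a..x, repeatedIntegral a s h t = repeatedIntegral a (s + 1) h x := by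
  induction s generalizing h with
  | zero =>
    rw [repeatedIntegral_succ a 0 hh]
    simp [repeatedIntegral]
  | succ s ih =>
    have hc : Continuous fun t => ∫ u in a..t, h u :=
      intervalIntegral.continuous_primitive (fun _ _ => hh.intervalIntegrable _ _) a
    rw [repeatedIntegral_succ a (s + 1) hh, ← ih hc]
    exact intervalIntegral.integral_congr fun t _ => repeatedIntegral_succ a s hh t

/-- The inner constants integrate to `(u - a)^q / q!`, the outer ones to the kernel `(x - u)^s /
s!`: the simplex integral becomes a single weighted integral. -/
theorem iterIntegral_replicate_append (a : ℝ) (c : ℂ) (s q : ℕ) {H : ℝ → ℂ} (hH : Continuous H)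
    (x : ℝ) :
    iterIntegral a (List.replicate s (fun _ => c) ++ H :: List.replicate q fun _ => c) x =
      c ^ s * repeatedIntegral a s
        (fun u => H u * (c ^ q * (((u - a : ℝ) : ℂ) ^ q / (q ! : ℂ)))) x := by
  induction s generalizing x with
  | zero => simp [iterIntegral, iterIntegral_replicate_const, repeatedIntegral]
  | succ s ih =>
    simp only [List.replicate_succ, List.cons_append, iterIntegral, ih]
    rw [intervalIntegral.integral_const_mul, intervalIntegral.integral_const_mul,
      integral_repeatedIntegral a s (by fun_prop), pow_succ]
    ring

theorem abs_pow_sub_pow_le_mul (q : ℕ) {u v : ℝ} (hu0 : 0 ≤ u) (hu : u ≤ 1) (hv0 : 0 ≤ v)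
    (hv : v ≤ 1) : |u ^ q - v ^ q| ≤ q * |u - v| := by
  induction q with
  | zero => simp
  | succ q ih =>
    have e : u ^ (q + 1) - v ^ (q + 1) = u * (u ^ q - v ^ q) + (u - v) * v ^ q := by ring
    rw [e]
    refine (abs_add_le _ _).trans ?_
    rw [abs_mul, abs_mul, abs_of_nonneg hu0, abs_of_nonneg (pow_nonneg hv0 q)]
    have h1 := mul_le_of_le_one_left (abs_nonneg (u ^ q - v ^ q)) hu
    have h2 := mul_le_of_le_one_right (abs_nonneg (u - v)) (pow_le_one₀ hv0 hv (n := q))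
    push_cast
    linarith

theorem abs_weight_sub_le (q s : ℕ) {ε t : ℝ} (hε : 0 < ε) (ht : ε ≤ t) (ht1 : t ≤ 1 - ε) :
    |(t - ε) ^ q * (1 - ε - t) ^ s - t ^ q * (1 - t) ^ s| ≤ (q + s) * ε := by
  have e : (t - ε) ^ q * (1 - ε - t) ^ s - t ^ q * (1 - t) ^ s =
      ((t - ε) ^ q - t ^ q) * (1 - ε - t) ^ s + t ^ q * ((1 - ε - t) ^ s - (1 - t) ^ s) := by ring
  have h1 := abs_pow_sub_pow_le_mul q (u := t - ε) (v := t) (by linarith) (by linarith)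
    (by linarith)
    (by linarith)
  have h2 := abs_pow_sub_pow_le_mul s (u := 1 - ε - t) (v := 1 - t) (by linarith) (by linarith)
    (by linarith) (by linarith)
  rw [show t - ε - t = -ε by ring, abs_neg, abs_of_pos hε] at h1
  rw [show 1 - ε - t - (1 - t) = -ε by ring, abs_neg, abs_of_pos hε] at h2
  have h3 : (0 : ℝ) ≤ (1 - ε - t) ^ s := pow_nonneg (by linarith) s
  have h4 : (1 - ε - t) ^ s ≤ 1 := pow_le_one₀ (by linarith) (by linarith)
  have h5 : (0 : ℝ) ≤ t ^ q := pow_nonneg (by linarith) q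
  have h6 : t ^ q ≤ 1 := pow_le_one₀ (by linarith) (by linarith)
  rw [e]
  refine (abs_add_le _ _).trans ?_
  rw [abs_mul, abs_mul, abs_of_nonneg h3, abs_of_nonneg h5]
  have h7 := mul_le_of_le_one_right (abs_nonneg ((t - ε) ^ q - t ^ q)) h4
  have h8 := mul_le_of_le_one_left (abs_nonneg ((1 - ε - t) ^ s - (1 - t) ^ s)) h6
  linarith

theorem norm_integral_zero_le_sqrt {H : ℝ → ℂ} {M ε : ℝ} (hε : 0 < ε)
    (hH : ∀ t ∈ Ioc 0 ε, ‖H t‖ ≤ M * t ^ (-(1 / 2) : ℝ)) :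
    ‖∫ t in (0 : ℝ)..ε, H t‖ ≤ 2 * M * ε ^ (1 / 2 : ℝ) := by
  have hi : IntervalIntegrable (fun t : ℝ => M * t ^ (-(1 / 2) : ℝ)) volume 0 ε :=
    (intervalIntegral.intervalIntegrable_rpow' (by norm_num)).const_mul M
  refine (intervalIntegral.norm_integral_le_of_norm_le hε.le
    (Eventually.of_forall fun t ht => hH t ht) hi).trans_eq ?_
  rw [intervalIntegral.integral_const_mul, integral_rpow (Or.inl (by norm_num))]
  norm_num
  ring

/-- Truncating a weighted integral at distance `ε` from both end points costs `O(√ε)`, if the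
integrand is `O(t^(-1/2))` at both end points. -/
theorem isBigO_truncated_integral {H : ℝ → ℂ} (hi : IntervalIntegrable H volume 0 1) {M : ℝ}
    (h0 : ∀ t ∈ Ioc (0 : ℝ) (1 / 2), ‖H t‖ ≤ M * t ^ (-(1 / 2) : ℝ))
    (h1 : ∀ t ∈ Ioc (0 : ℝ) (1 / 2), ‖H (1 - t)‖ ≤ M * t ^ (-(1 / 2) : ℝ)) (q s : ℕ) :
    (fun ε : ℝ => (∫ t in ε..(1 - ε), H t * (((t - ε) ^ q * (1 - ε - t) ^ s : ℝ) : ℂ)) -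
      ∫ t in (0 : ℝ)..1, H t * ((t ^ q * (1 - t) ^ s : ℝ) : ℂ)) =O[𝓝[>] 0]
        fun ε : ℝ => ε ^ (1 / 2 : ℝ) := by
  have hw : ∀ {t : ℝ}, t ∈ Icc (0 : ℝ) 1 → |t ^ q * (1 - t) ^ s| ≤ 1 := fun {t} ht => by
    rw [abs_of_nonneg (mul_nonneg (pow_nonneg ht.1 _) (pow_nonneg (by linarith [ht.2]) _))]
    exact mul_le_one₀ (pow_le_one₀ ht.1 ht.2) (pow_nonneg (by linarith [ht.2]) _)
      (pow_le_one₀ (by linarith [ht.2]) (by linarith [ht.1]))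
  have hwc : ∀ ε : ℝ, Continuous fun t : ℝ => (((t - ε) ^ q * (1 - ε - t) ^ s : ℝ) : ℂ) := fun ε =>
    by fun_prop
  have hwc0 : Continuous fun t : ℝ => ((t ^ q * (1 - t) ^ s : ℝ) : ℂ) := by fun_prop
  refine IsBigO.of_bound (2 * M + 2 * M + (q + s) * ∫ t in (0 : ℝ)..1, ‖H t‖) ?_
  filter_upwards [Ioo_mem_nhdsGT (show (0 : ℝ) < 1 / 2 by norm_num)] with ε hε
  have hε0 : 0 < ε := hε.1
  have hεs : ε ≤ ε ^ (1 / 2 : ℝ) := by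
    conv_lhs => rw [← Real.rpow_one ε]
    exact Real.rpow_le_rpow_of_exponent_ge hε0 (by linarith [hε.2]) (by norm_num)
  have hsub : ∀ {a b : ℝ}, a ∈ Icc (0 : ℝ) 1 → b ∈ Icc (0 : ℝ) 1 →
      IntervalIntegrable H volume a b := fun ha hb =>
    hi.mono_set (by rw [uIcc_of_le zero_le_one]; exact uIcc_subset_Icc ha hb)
  have m0 : (0 : ℝ) ∈ Icc (0 : ℝ) 1 := by simp
  have m1 : (1 : ℝ) ∈ Icc (0 : ℝ) 1 := by simp
  have mε : ε ∈ Icc (0 : ℝ) 1 := ⟨hε0.le, by linarith [hε.2]⟩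
  have mε' : 1 - ε ∈ Icc (0 : ℝ) 1 := ⟨by linarith [hε.2], by linarith⟩
  have I0 := (hsub m0 mε).mul_continuousOn hwc0.continuousOn
  have I1 := (hsub mε mε').mul_continuousOn hwc0.continuousOn
  have I2 := (hsub mε' m1).mul_continuousOn hwc0.continuousOn
  have I3 := (hsub mε mε').mul_continuousOn (hwc ε).continuousOn
  have hsplit := intervalIntegral.integral_add_adjacent_intervals (I0.trans I1) I2
  rw [← intervalIntegral.integral_add_adjacent_intervals I0 I1] at hsplit
  have hdiff := intervalIntegral.integral_sub I3 I1
  have T0 : ‖∫ t in (0 : ℝ)..ε, H t * ((t ^ q * (1 - t) ^ s : ℝ) : ℂ)‖ ≤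
      2 * M * ε ^ (1 / 2 : ℝ) := norm_integral_zero_le_sqrt hε0 fun t ht => by
    rw [norm_mul, Complex.norm_real, Real.norm_eq_abs]
    exact (mul_le_of_le_one_right (norm_nonneg _)
      (hw ⟨ht.1.le, ht.2.trans mε.2⟩)).trans (h0 t ⟨ht.1, ht.2.trans hε.2.le⟩)
  have T2 : ‖∫ t in (1 - ε)..1, H t * ((t ^ q * (1 - t) ^ s : ℝ) : ℂ)‖ ≤
      2 * M * ε ^ (1 / 2 : ℝ) := by
    have e := intervalIntegral.integral_comp_sub_left (a := 0) (b := ε)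
      (fun t : ℝ => H t * ((t ^ q * (1 - t) ^ s : ℝ) : ℂ)) 1
    rw [sub_zero] at e
    rw [← e]
    refine norm_integral_zero_le_sqrt hε0 fun t ht => ?_
    rw [norm_mul, Complex.norm_real, Real.norm_eq_abs]
    exact (mul_le_of_le_one_right (norm_nonneg _)
      (hw ⟨by linarith [ht.2, hε.2], by linarith [ht.1]⟩)).trans (h1 t ⟨ht.1, ht.2.trans hε.2.le⟩)
  have T1 : ‖∫ t in ε..(1 - ε), (H t * (((t - ε) ^ q * (1 - ε - t) ^ s : ℝ) : ℂ) -
      H t * ((t ^ q * (1 - t) ^ s : ℝ) : ℂ))‖ ≤ (q + s) * ε * ∫ t in (0 : ℝ)..1, ‖H t‖ := by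
    have hle : ε ≤ 1 - ε := by linarith [hε.2]
    have hb : ∀ t ∈ Ioc ε (1 - ε), ‖H t * (((t - ε) ^ q * (1 - ε - t) ^ s : ℝ) : ℂ) -
        H t * ((t ^ q * (1 - t) ^ s : ℝ) : ℂ)‖ ≤ (q + s) * ε * ‖H t‖ := fun t ht => by
      rw [← mul_sub, ← Complex.ofReal_sub, norm_mul, Complex.norm_real, Real.norm_eq_abs, mul_comm]
      exact mul_le_mul_of_nonneg_right (abs_weight_sub_le q s hε0 ht.1.le ht.2) (norm_nonneg _)
    refine (intervalIntegral.norm_integral_le_of_norm_le hle (Eventually.of_forall hb)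
      ((hsub mε mε').norm.const_mul _)).trans ?_
    rw [intervalIntegral.integral_const_mul]
    refine mul_le_mul_of_nonneg_left ?_ (by positivity)
    exact intervalIntegral.integral_mono_interval mε.1 hle mε'.2
      (Eventually.of_forall fun _ => norm_nonneg _) hi.norm
  have hn : 0 ≤ ∫ t in (0 : ℝ)..1, ‖H t‖ :=
    intervalIntegral.integral_nonneg zero_le_one fun _ _ => norm_nonneg _
  rw [← hsplit, show ∀ A B C D : ℂ, A - (B + C + D) = (A - C) - B - D by intros; ring, ← hdiff]
  refine (norm_sub_le _ _).trans ((add_le_add (norm_sub_le _ _) le_rfl).trans ?_)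
  rw [Real.norm_eq_abs, abs_of_nonneg (by positivity : (0 : ℝ) ≤ ε ^ (1 / 2 : ℝ))]
  have h3 : (q + s) * ε * ∫ t in (0 : ℝ)..1, ‖H t‖ ≤
      (q + s) * ε ^ (1 / 2 : ℝ) * ∫ t in (0 : ℝ)..1, ‖H t‖ := by gcongr
  linarith

/-- The bound `t^(-1/2)` is meant to cover logarithmic singularities as well; bounded functions
satisfy it since `t^(-1/2) ≥ 1`. -/
theorem exists_bound_rpow_of_continuous {H : ℝ → ℂ} (hH : Continuous H) : ∃ M : ℝ,
    (∀ t ∈ Ioc (0 : ℝ) (1 / 2), ‖H t‖ ≤ M * t ^ (-(1 / 2) : ℝ)) ∧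
    ∀ t ∈ Ioc (0 : ℝ) (1 / 2), ‖H (1 - t)‖ ≤ M * t ^ (-(1 / 2) : ℝ) := by
  obtain ⟨M, hM⟩ := (isCompact_Icc (a := (0 : ℝ)) (b := 1)).exists_bound_of_continuousOn
    hH.continuousOn
  have hM0 : 0 ≤ M := (norm_nonneg _).trans (hM 0 (by simp))
  have h : ∀ t ∈ Ioc (0 : ℝ) (1 / 2), M ≤ M * t ^ (-(1 / 2) : ℝ) := fun t ht =>
    le_mul_of_one_le_right hM0
      (Real.one_le_rpow_of_pos_of_le_one_of_nonpos ht.1 (by linarith [ht.2]) (by norm_num))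
  exact ⟨M, fun t ht => (hM t ⟨ht.1.le, by linarith [ht.2]⟩).trans (h t ht),
    fun t ht => (hM _ ⟨by linarith [ht.2], by linarith [ht.1]⟩).trans (h t ht)⟩

end IterIntegral

/-! ### The logarithmic end point divergence of `ω_1` -/

section LogSin

open Set MeasureTheory

/-- A primitive of `(1 - e(t))⁻¹` on `(0, 1)`. -/
noncomputable def logSinPrimitive (t : ℝ) : ℂ :=
  (t : ℂ) / 2 + I / (2 * π) * (Real.log (Real.sin (π * t)) : ℝ)

theorem sin_pi_mul_pos {t : ℝ} (ht : t ∈ Ioo (0 : ℝ) 1) : 0 < Real.sin (π * t) :=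
  Real.sin_pos_of_pos_of_lt_pi (mul_pos Real.pi_pos ht.1)
    (mul_lt_of_lt_one_right Real.pi_pos ht.2)

theorem inv_one_sub_expTwoPi {t : ℝ} (ht : t ∈ Ioo (0 : ℝ) 1) : (1 - expTwoPi t)⁻¹ =
    1 / 2 + I / 2 * ((Real.cos (π * t) / Real.sin (π * t) : ℝ) : ℂ) := by
  have hs : (Real.sin (π * t) : ℂ) ≠ 0 := Complex.ofReal_ne_zero.2 (sin_pi_mul_pos ht).ne'
  have h1 : (1 - expTwoPi t) ≠ 0 := sub_ne_zero.2 (expTwoPi_ofReal_ne_one ht).symm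
  have he : expTwoPi t = ((Real.cos (π * t) : ℂ) + Real.sin (π * t) * I) ^ 2 := by
    rw [Complex.ofReal_cos, Complex.ofReal_sin, ← Complex.exp_mul_I, ← Complex.exp_nat_mul,
      expTwoPi]
    congr 1
    push_cast
    ring
  have hcs : (Real.sin (π * t) : ℂ) ^ 2 + (Real.cos (π * t) : ℂ) ^ 2 = 1 := by
    exact_mod_cast Real.sin_sq_add_cos_sq (π * t)
  refine inv_eq_of_mul_eq_one_right ?_
  rw [he]
  push_cast
  push_cast at hs hcs
  set S := Complex.sin (π * t)
  set C := Complex.cos (π * t)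
  field_simp
  linear_combination (S - I * C) * hcs + (-(S ^ 2 * (S + I * C)) - 2 * S * C ^ 2) * Complex.I_sq

theorem hasDerivAt_logSinPrimitive {t : ℝ} (ht : t ∈ Ioo (0 : ℝ) 1) :
    HasDerivAt logSinPrimitive (1 - expTwoPi t)⁻¹ t := by
  have h1 : HasDerivAt (fun t : ℝ => Real.log (Real.sin (π * t)))
      (Real.cos (π * t) * π / Real.sin (π * t)) t := by
    have := ((Real.hasDerivAt_sin (π * t)).comp t ((hasDerivAt_id t).const_mul π)).log
      (sin_pi_mul_pos ht).ne'
    simpa using this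
  have h2 := ((hasDerivAt_id t).ofReal_comp.div_const (2 : ℂ)).add
    (h1.ofReal_comp.const_mul (I / (2 * π)))
  refine h2.congr_deriv ?_
  have hpi : (π : ℂ) ≠ 0 := Complex.ofReal_ne_zero.2 Real.pi_ne_zero
  have hs : Complex.sin (π * t) ≠ 0 := by
    exact_mod_cast Complex.ofReal_ne_zero.2 (sin_pi_mul_pos ht).ne'
  rw [inv_one_sub_expTwoPi ht]
  push_cast
  field_simp

theorem intervalIntegrable_logSinPrimitive : IntervalIntegrable logSinPrimitive volume 0 1 := by
  have h := (intervalIntegrable_log_sin (a := 0) (b := π)).comp_mul_left (c := π)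
  rw [zero_div, div_self Real.pi_ne_zero] at h
  have h' : IntervalIntegrable (fun t : ℝ => ((Real.log (Real.sin (π * t)) : ℝ) : ℂ)) volume 0 1 :=
    ⟨h.1.ofReal, h.2.ofReal⟩
  have hc : Continuous fun t : ℝ => (t : ℂ) / 2 := by fun_prop
  exact (hc.intervalIntegrable _ _).add (h'.const_mul _)

/-- Jordan's inequality `sin(πt) ≥ 2t`, combined with `log x ≤ 2 x^(1/2)` at `x = 1/t`. -/
theorem abs_log_sin_le {t : ℝ} (ht : t ∈ Ioc (0 : ℝ) (1 / 2)) :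
    |Real.log (Real.sin (π * t))| ≤ 2 * t ^ (-(1 / 2) : ℝ) := by
  have h0 : 0 < 2 * t := by linarith [ht.1]
  have h1 : 2 * t ≤ Real.sin (π * t) := by
    have := Real.mul_le_sin (x := π * t) (mul_nonneg Real.pi_pos.le ht.1.le)
      (by nlinarith [ht.2, Real.pi_pos])
    refine le_trans (le_of_eq ?_) this
    field_simp
  have h2 : Real.log (2 * t) ≤ Real.log (Real.sin (π * t)) := Real.log_le_log h0 h1
  have h3 : Real.log (Real.sin (π * t)) ≤ 0 :=
    Real.log_nonpos (h0.le.trans h1) (Real.sin_le_one _)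
  have h4 := Real.log_le_rpow_div (inv_pos.2 ht.1).le (show (0 : ℝ) < 1 / 2 by norm_num)
  have h5 : Real.log t ≤ Real.log (2 * t) := Real.log_le_log ht.1 (by linarith [ht.1])
  rw [Real.log_inv, Real.inv_rpow ht.1.le, ← Real.rpow_neg ht.1.le] at h4
  rw [abs_of_nonpos h3]
  linarith

theorem norm_logSinPrimitive_le {t : ℝ} (ht : t ∈ Icc (0 : ℝ) 1) :
    ‖logSinPrimitive t‖ ≤ 1 / 2 + |Real.log (Real.sin (π * t))| / 2 := by
  refine (norm_add_le _ _).trans (add_le_add ?_ ?_)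
  · rw [norm_div, Complex.norm_real, Real.norm_eq_abs, abs_of_nonneg ht.1, Complex.norm_ofNat]
    linarith [ht.2]
  · rw [norm_mul, norm_div, norm_mul, Complex.norm_I, Complex.norm_real, Complex.norm_real,
      Complex.norm_ofNat, Real.norm_eq_abs, Real.norm_eq_abs, abs_of_pos Real.pi_pos, mul_comm,
      div_eq_mul_one_div _ (2 : ℝ)]
    refine mul_le_mul_of_nonneg_left ?_ (abs_nonneg _)
    rw [div_le_div_iff₀ (by positivity) (by norm_num)]
    linarith [Real.pi_gt_three]

theorem norm_logSinPrimitive_le_rpow {t : ℝ} (ht : t ∈ Ioc (0 : ℝ) (1 / 2)) :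
    ‖logSinPrimitive t‖ ≤ 2 * t ^ (-(1 / 2) : ℝ) ∧
      ‖logSinPrimitive (1 - t)‖ ≤ 2 * t ^ (-(1 / 2) : ℝ) := by
  have h1 := abs_log_sin_le ht
  have h2 : (1 : ℝ) ≤ t ^ (-(1 / 2) : ℝ) :=
    Real.one_le_rpow_of_pos_of_le_one_of_nonpos ht.1 (by linarith [ht.2]) (by norm_num)
  have h3 := norm_logSinPrimitive_le (t := t) ⟨ht.1.le, by linarith [ht.2]⟩
  have h4 := norm_logSinPrimitive_le (t := 1 - t) ⟨by linarith [ht.2], by linarith [ht.1]⟩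
  rw [show π * (1 - t) = π - π * t by ring, Real.sin_pi_sub] at h4
  exact ⟨by linarith, by linarith⟩

theorem abs_log_sin_sub_log_le {x : ℝ} (h0 : 0 < x) (h1 : x ≤ 1) :
    |Real.log (Real.sin x) - Real.log x| ≤ x := by
  have hs : 0 < Real.sin x := Real.sin_pos_of_pos_of_lt_pi h0 (by linarith [Real.pi_gt_three])
  have h2 : Real.log (Real.sin x) ≤ Real.log x := Real.log_le_log hs (Real.sin_le h0.le)
  have h3 := Real.one_sub_inv_le_log_of_pos (div_pos hs h0)
  rw [Real.log_div hs.ne' h0.ne', inv_div] at h3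
  have h4 := Real.sin_gt_sub_cube h0
  have h5 : x / Real.sin x ≤ 1 + x := by
    rw [div_le_iff₀ hs]
    nlinarith [mul_pos h0 hs, pow_pos h0 2, pow_pos h0 3, mul_nonneg h0.le (sub_nonneg.2 h1)]
  rw [abs_of_nonpos (by linarith)]
  linarith

theorem log_neg_two_pi_I_mul {ε : ℝ} (hε : 0 < ε) : Complex.log (-(2 * π * I * ε)) =
    (Real.log 2 + Real.log (π * ε) : ℝ) - π / 2 * I := by
  have h : (0 : ℝ) < π * ε := mul_pos Real.pi_pos hε
  rw [show -(2 * π * I * (ε : ℂ)) = ((2 * (π * ε) : ℝ) : ℂ) * -I by push_cast; ring,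
    Complex.log_ofReal_mul (by positivity) (neg_ne_zero.2 Complex.I_ne_zero), Complex.log_neg_I,
    Real.log_mul two_ne_zero h.ne']
  ring

/-- By symmetry `sin(π(1 - ε)) = sin(πε)`, whose logarithm is `log(πε)` up to `O(ε)`. The constants
`πi/2` and `-log 2` convert this into the principal `log(-2πiε)`. -/
theorem isBigO_logSinPrimitive_one_sub :
    (fun ε : ℝ => logSinPrimitive (1 - ε) - (1 / 2 + I / (2 * π) * (π / 2 * I - Real.log 2) +
      I / (2 * π) * Complex.log (-(2 * π * I * ε)))) =O[𝓝[>] 0] fun ε : ℝ => ε ^ (1 / 2 : ℝ) := by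
  refine IsBigO.of_bound 1 ?_
  filter_upwards [Ioo_mem_nhdsGT (show (0 : ℝ) < 1 / 4 by norm_num)] with ε hε
  have hε0 : 0 < ε := hε.1
  have hεs : ε ≤ ε ^ (1 / 2 : ℝ) := by
    conv_lhs => rw [← Real.rpow_one ε]
    exact Real.rpow_le_rpow_of_exponent_ge hε0 (by linarith [hε.2]) (by norm_num)
  have h1 := abs_log_sin_sub_log_le (mul_pos Real.pi_pos hε0)
    (by nlinarith [hε.2, Real.pi_pos, Real.pi_le_four])
  have e : logSinPrimitive (1 - ε) - (1 / 2 + I / (2 * π) * (π / 2 * I - Real.log 2) +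
      I / (2 * π) * Complex.log (-(2 * π * I * ε))) =
      -((ε : ℂ) / 2) + I / (2 * π) *
        ((Real.log (Real.sin (π * ε)) - Real.log (π * ε) : ℝ) : ℂ) := by
    rw [log_neg_two_pi_I_mul hε0, logSinPrimitive, show π * (1 - ε) = π - π * ε by ring,
      Real.sin_pi_sub]
    push_cast
    ring
  rw [e, Real.norm_eq_abs, abs_of_nonneg (by positivity : (0 : ℝ) ≤ ε ^ (1 / 2 : ℝ)), one_mul]
  refine le_trans ((norm_add_le _ _).trans ?_) hεs
  rw [norm_neg, norm_div, norm_mul, norm_div, norm_mul, Complex.norm_I, Complex.norm_real,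
    Complex.norm_real, Complex.norm_real, Complex.norm_ofNat, Real.norm_eq_abs, Real.norm_eq_abs,
    Real.norm_eq_abs, abs_of_pos Real.pi_pos, abs_of_pos hε0]
  have h2 : 1 / (2 * π) * |Real.log (Real.sin (π * ε)) - Real.log (π * ε)| ≤
      1 / (2 * π) * (π * ε) := mul_le_mul_of_nonneg_left h1 (by positivity)
  have h3 : 1 / (2 * π) * (π * ε) = ε / 2 := by field_simp
  linarith

theorem isBigO_pow_sub_one_mul_logSinPrimitive (q : ℕ) :
    (fun ε : ℝ => (((1 - 2 * ε) ^ q - 1 : ℝ) : ℂ) * logSinPrimitive (1 - ε)) =O[𝓝[>] 0]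
      fun ε : ℝ => ε ^ (1 / 2 : ℝ) := by
  refine IsBigO.of_bound (q * 2 * 2) ?_
  filter_upwards [Ioo_mem_nhdsGT (show (0 : ℝ) < 1 / 2 by norm_num)] with ε hε
  have hε0 : 0 < ε := hε.1
  have h1 := abs_pow_sub_pow_le_mul q (u := 1 - 2 * ε) (v := 1) (by linarith [hε.2])
    (by linarith) zero_le_one le_rfl
  rw [one_pow, show 1 - 2 * ε - 1 = -(2 * ε) by ring, abs_neg,
    abs_of_pos (mul_pos two_pos hε0)] at h1
  have h2 := (norm_logSinPrimitive_le_rpow ⟨hε0, hε.2.le⟩).2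
  rw [norm_mul, Complex.norm_real, Real.norm_eq_abs, Real.norm_eq_abs,
    abs_of_nonneg (by positivity : (0 : ℝ) ≤ ε ^ (1 / 2 : ℝ))]
  refine (mul_le_mul h1 h2 (norm_nonneg _) (by positivity)).trans_eq ?_
  have : ε ^ (1 / 2 : ℝ) = ε * ε ^ (-(1 / 2) : ℝ) := by
    conv_rhs => rw [← Real.rpow_one_add' hε0.le (by norm_num)]
    norm_num
  rw [this]
  ring

/-- Integration by parts against the logarithmic primitive. As `q ≥ 1`, the weight vanishes at the
lower end, so only the upper end contributes a logarithm, to the first power; the remaining integral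
converges. -/
theorem exists_isBigO_integral_inv_one_sub {q : ℕ} (hq : q ≠ 0) : ∃ c₀ c₁ : ℂ,
    (fun ε : ℝ => (∫ t in ε..(1 - ε), (1 - expTwoPi t)⁻¹ * (((t - ε : ℝ) : ℂ) ^ q)) -
      (c₀ + c₁ * Complex.log (-(2 * π * I * ε)))) =O[𝓝[>] 0] fun ε : ℝ => ε ^ (1 / 2 : ℝ) := by
  obtain ⟨q, rfl⟩ := Nat.exists_eq_succ_of_ne_zero hq
  have hT := isBigO_truncated_integral intervalIntegrable_logSinPrimitive
    (fun t ht => (norm_logSinPrimitive_le_rpow ht).1)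
    (fun t ht => (norm_logSinPrimitive_le_rpow ht).2) q 0
  refine ⟨1 / 2 + I / (2 * π) * (π / 2 * I - Real.log 2) -
    (q + 1) * ∫ t in (0 : ℝ)..1, logSinPrimitive t * ((t ^ q * (1 - t) ^ 0 : ℝ) : ℂ),
    I / (2 * π), ?_⟩
  refine (((isBigO_pow_sub_one_mul_logSinPrimitive (q + 1)).add
    isBigO_logSinPrimitive_one_sub).sub (hT.const_mul_left ((q : ℂ) + 1))).congr' ?_
    EventuallyEq.rfl
  filter_upwards [Ioo_mem_nhdsGT (show (0 : ℝ) < 1 / 2 by norm_num)] with ε hε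
  have hle : ε ≤ 1 - ε := by linarith [hε.2]
  have hmem : ∀ t ∈ uIcc ε (1 - ε), t ∈ Ioo (0 : ℝ) 1 := fun t ht => by
    rw [uIcc_of_le hle] at ht
    exact ⟨hε.1.trans_le ht.1, by linarith [ht.2, hε.1]⟩
  have hu : ∀ t ∈ uIcc ε (1 - ε), HasDerivAt (fun t : ℝ => ((t - ε : ℝ) : ℂ) ^ (q + 1))
      ((q + 1) * ((t - ε : ℝ) : ℂ) ^ q) t := fun t _ => by
    have h1 : HasDerivAt (fun t : ℝ => ((t - ε : ℝ) : ℂ)) 1 t := by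
      simpa using ((hasDerivAt_id t).sub_const ε).ofReal_comp
    exact (h1.pow (q + 1)).congr_deriv (by push_cast; simp)
  have hv : ∀ t ∈ uIcc ε (1 - ε), HasDerivAt logSinPrimitive (1 - expTwoPi t)⁻¹ t :=
    fun t ht => hasDerivAt_logSinPrimitive (hmem t ht)
  have hu' : Continuous fun t : ℝ => ((q : ℂ) + 1) * ((t - ε : ℝ) : ℂ) ^ q := by fun_prop
  have hv' : ContinuousOn (fun t : ℝ => (1 - expTwoPi t)⁻¹) (uIcc ε (1 - ε)) :=
    ContinuousOn.inv₀ (continuous_const.sub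
      (differentiable_expTwoPi.continuous.comp Complex.continuous_ofReal)).continuousOn
      fun t ht => sub_ne_zero.2 (expTwoPi_ofReal_ne_one (hmem t ht)).symm
  have key := intervalIntegral.integral_mul_deriv_eq_deriv_mul hu hv
    (hu'.intervalIntegrable _ _) hv'.intervalIntegrable
  have e1 : ∫ t in ε..(1 - ε), (1 - expTwoPi t)⁻¹ * (((t - ε : ℝ) : ℂ) ^ (q + 1)) =
      ∫ t in ε..(1 - ε), ((t - ε : ℝ) : ℂ) ^ (q + 1) * (1 - expTwoPi t)⁻¹ := by
    simp only [mul_comm]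
  have e2 : ∫ t in ε..(1 - ε), ((q : ℂ) + 1) * ((t - ε : ℝ) : ℂ) ^ q * logSinPrimitive t =
      (q + 1) * ∫ t in ε..(1 - ε),
        logSinPrimitive t * (((t - ε) ^ q * (1 - ε - t) ^ 0 : ℝ) : ℂ) := by
    rw [← intervalIntegral.integral_const_mul]
    congr 1
    ext t
    push_cast
    ring
  rw [Nat.succ_eq_add_one, e1, key, e2, sub_self, show 1 - ε - ε = 1 - 2 * ε by ring]
  push_cast
  simp only [ne_eq, Nat.add_eq_zero_iff, one_ne_zero, and_false, not_false_eq_true, zero_pow,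
    zero_mul, sub_zero]
  ring

end LogSin

/-! ### Elliptic multiple zeta values of depth one -/

section DepthOne

open Set MeasureTheory

theorem ellMZVA_eq {l : List ℕ} {τ : ℍ} {a : ℂ} (h : IsRegularizedValue l.length
    (fun ε : ℝ => iterIntegral ε
      (l.map fun (n : ℕ) (t : ℝ) => kroneckerOmega n (t : ℂ) τ) (1 - ε)) a) :
    ellMZVA l τ = a := by
  have h' : ∃ a : ℂ, IsRegularizedValue l.length
    (fun ε : ℝ => iterIntegral ε
      (l.map fun (n : ℕ) (t : ℝ) => kroneckerOmega n (t : ℂ) τ) (1 - ε)) a := ⟨a, h⟩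
  rw [ellMZVA, dif_pos h']
  exact h'.choose_spec.unique h

theorem iterIntegral_kroneckerOmega {n : ℕ} (hn : n ≠ 0) (s q : ℕ) {τ : ℍ} {H : ℝ → ℂ}
    (hH : ∀ t ∈ Ioo (0 : ℝ) 1, kroneckerOmega n t τ = H t) {ε : ℝ}
    (hε : ε ∈ Ioo (0 : ℝ) (1 / 2)) :
    iterIntegral ε ((List.replicate s 0 ++ n :: List.replicate q 0).map
      fun (n : ℕ) (t : ℝ) => kroneckerOmega n (t : ℂ) τ) (1 - ε) =
    iterIntegral ε (List.replicate s (fun _ => 2 * π * I) ++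
      H :: List.replicate q fun _ => 2 * π * I) (1 - ε) := by
  have hsub : ∀ t ∈ Icc ε (1 - ε), t ∈ Ioo (0 : ℝ) 1 := fun t ht =>
    ⟨hε.1.trans_le ht.1, by linarith [ht.2, hε.1]⟩
  have h := iterIntegral_map_congr (a := ε) (b := 1 - ε)
    (f := fun (n : ℕ) (t : ℝ) => kroneckerOmega n (t : ℂ) τ)
    (g := fun m => if m = 0 then fun _ => 2 * π * I else H)
    (l := List.replicate s 0 ++ n :: List.replicate q 0) (fun m hm t ht => by
      have hm' : m = 0 ∨ m = n := by
        simp only [List.mem_append, List.mem_cons, List.mem_replicate] at hm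
        tauto
      rcases hm' with rfl | rfl
      · simpa using kroneckerOmega_zero (hsub t ht) τ
      · simpa [hn] using hH t (hsub t ht)) (x := 1 - ε) ⟨by linarith [hε.2], le_rfl⟩
  simpa [hn] using h

/-- When `ω_n` extends continuously to the end points, no logarithms occur: the regularizing
polynomial is constant and the value is the convergent integral. -/
theorem ellMZVA_eq_integral {n : ℕ} (hn : n ≠ 0) (s q : ℕ) {τ : ℍ} {H : ℝ → ℂ}
    (hHc : Continuous H) (hH : ∀ t ∈ Ioo (0 : ℝ) 1, kroneckerOmega n t τ = H t) :
    ellMZVA (List.replicate s 0 ++ n :: List.replicate q 0) τ =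
      (2 * π * I) ^ (s + q) / (s ! * q !) *
        ∫ t in (0 : ℝ)..1, H t * ((t ^ q * (1 - t) ^ s : ℝ) : ℂ) := by
  obtain ⟨M, h0, h1⟩ := exists_bound_rpow_of_continuous hHc
  have hT := (isBigO_truncated_integral (hHc.intervalIntegrable 0 1) h0 h1 q s).const_mul_left
    ((2 * π * I : ℂ) ^ (s + q) / (s ! * q !))
  refine ellMZVA_eq ⟨Polynomial.C _, (Polynomial.natDegree_C _).trans_le zero_le,
    Polynomial.coeff_C_zero, 1 / 2, by norm_num, ?_⟩
  refine hT.congr' ?_ EventuallyEq.rfl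
  filter_upwards [Ioo_mem_nhdsGT (show (0 : ℝ) < 1 / 2 by norm_num)] with ε hε
  rw [Polynomial.eval_C, iterIntegral_kroneckerOmega hn s q hH hε,
    iterIntegral_replicate_append _ _ _ _ hHc, repeatedIntegral, mul_sub,
    ← intervalIntegral.integral_const_mul ((2 * π * I : ℂ) ^ s),
    ← intervalIntegral.integral_const_mul]
  refine congrArg (· - _) (intervalIntegral.integral_congr fun t _ => ?_)
  push_cast
  rw [pow_add]
  ring

theorem ofReal_weight_eq_eval (q s : ℕ) (t : ℝ) : ((t ^ q * (1 - t) ^ s : ℝ) : ℂ) =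
    ((Polynomial.X ^ q * (1 - Polynomial.X) ^ s : ℂ[X])).eval (t : ℂ) := by
  simp

theorem natDegree_weight_le (q s : ℕ) :
    (Polynomial.X ^ q * (1 - Polynomial.X) ^ s : ℂ[X]).natDegree ≤ s + q := by
  compute_degree
  exact (add_comm q s).le

theorem integral_const_mul_add_const_mul {a b : ℝ} {f g : ℝ → ℂ}
    (hf : IntervalIntegrable f volume a b) (hg : IntervalIntegrable g volume a b) (c d : ℂ) :
    ∫ t in a..b, (c * f t + d * g t) = c * (∫ t in a..b, f t) + d * ∫ t in a..b, g t := by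
  rw [intervalIntegral.integral_add (hf.const_mul c) (hg.const_mul d),
    intervalIntegral.integral_const_mul, intervalIntegral.integral_const_mul]

/-- A depth-one value with entry `n ≥ 2` is a combination of a constant and Eichler integrals. -/
theorem exists_ellMZVA_eq_sum {n : ℕ} (hn : 2 ≤ n) (s q : ℕ) : ∃ (K : ℂ) (c : ℕ → ℂ), ∀ τ : ℍ,
    ellMZVA (List.replicate s 0 ++ n :: List.replicate q 0) τ =
      K + ∑ b ∈ Finset.range (s + q), c b * (1 + (-1) ^ (n + b + 1)) *
        qSeries (eichlerCoeff (n - 1) (b + 1)) τ := by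
  obtain ⟨c, -, hc⟩ := exists_integral_omegaSeries (s + q) _ (natDegree_weight_le q s) n
  obtain ⟨m, rfl⟩ := Nat.exists_eq_add_of_le' hn
  set A : ℂ := (2 * π * I) ^ (s + q) / (s ! * q !)
  set d : ℂ := -(2 * π * I) / ((m + 1)! : ℂ)
  refine ⟨A * (omegaConst (m + 2) * ∫ t in (0 : ℝ)..1, ((t ^ q * (1 - t) ^ s : ℝ) : ℂ)),
    fun b => A * d * c b, fun τ => ?_⟩
  have hcont := continuous_omegaSeries (m + 2) τ
  rw [ellMZVA_eq_integral (H := fun t => omegaConst (m + 2) + d * omegaSeries (m + 2) τ t)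
    (by omega) s q (by fun_prop) fun t ht => by
      rw [show m + 2 = m + 1 + 1 from rfl, kroneckerOmega_succ (m + 1) ht τ]
      simp [d]]
  have hw : Continuous fun t : ℝ => ((t ^ q * (1 - t) ^ s : ℝ) : ℂ) := by fun_prop
  have hcw : Continuous fun t : ℝ =>
      omegaSeries (m + 2) τ t * ((t ^ q * (1 - t) ^ s : ℝ) : ℂ) := hcont.mul hw
  simp only [add_mul, mul_assoc d]
  rw [integral_const_mul_add_const_mul (hw.intervalIntegrable _ _) (hcw.intervalIntegrable _ _)]
  simp only [ofReal_weight_eq_eval q s]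
  rw [hc τ, mul_add, ← mul_assoc A d, Finset.mul_sum]
  congr 1
  exact Finset.sum_congr rfl fun b _ => by ring

theorem hasTameTranslates_zero (p : ℕ) : HasTameTranslates (-(p : ℤ)) 0 :=
  HasTameTranslates.const p 0

theorem hasTameTranslates_sum_qSeries {s p : ℕ} (c : ℕ → ℂ)
    (hc : ∀ b < p, c b = 0 ∨ 3 ≤ s + (b + 1) + 1 ∧ Even (s + (b + 1) + 1)) :
    HasTameTranslates (-(p : ℤ)) fun τ =>
      ∑ b ∈ Finset.range p, c b * qSeries (eichlerCoeff s (b + 1)) τ := by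
  have h := HasTameTranslates.sum (Finset.range p) (hasTameTranslates_zero p)
    (f := fun b => c b • qSeries (eichlerCoeff s (b + 1))) fun b hb => by
      rcases hc b (Finset.mem_range.1 hb) with h | ⟨h1, h2⟩
      · rw [h, zero_smul]
        exact hasTameTranslates_zero p
      · exact (eichler_hasTameTranslates (Finset.mem_range.1 hb) h1 h2).smul _
  convert h using 1
  ext τ
  simp

theorem hasTameTranslates_ellMZVA {n : ℕ} (hn : 2 ≤ n) (s q : ℕ) :
    HasTameTranslates (-((s + q : ℕ) : ℤ))
      (ellMZVA (List.replicate s 0 ++ n :: List.replicate q 0)) := by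
  obtain ⟨K, c, hc⟩ := exists_ellMZVA_eq_sum hn s q
  rw [funext hc]
  refine (HasTameTranslates.const (s + q) K).add (hasTameTranslates_sum_qSeries _ fun b _ => ?_)
  -- The weight needed for the series is exactly `n + b + 1`: if it is even, it is at least `4`; if
  -- it is odd, the parity factor vanishes.
  rcases Nat.even_or_odd (n + b + 1) with h | h
  · right
    exact ⟨by omega, by rwa [show n - 1 + (b + 1) + 1 = n + b + 1 by omega]⟩
  · left
    simp [h.neg_one_pow]

theorem depthOneA_eq (n : ℕ) {r : ℕ} :
    depthOneA n r = ellMZVA (List.replicate 0 0 ++ n :: List.replicate (r - 1) 0) := by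
  simp [depthOneA]

theorem hasTameTranslates_depthOneA {n r : ℕ} (hn : 2 ≤ n) (hr : 1 ≤ r) :
    HasTameTranslates (1 - (r : ℤ)) (depthOneA n r) := by
  rw [depthOneA_eq, show (1 - (r : ℤ)) = -((0 + (r - 1) : ℕ) : ℤ) by omega]
  exact hasTameTranslates_ellMZVA hn 0 (r - 1)

/-- The pole of `ω_1` adds a multiple of `log(-2πiε)`, which regularization discards, and a constant
independent of `τ`, which goes into `K`. -/
theorem exists_depthOneA_one_eq (q : ℕ) : ∃ K : ℂ, ∀ τ : ℍ, depthOneA 1 (q + 2) τ =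
    K + (2 * π * I) ^ (q + 1) / ((q + 1)! : ℂ) * (-(2 * π * I) *
      ∫ t in (0 : ℝ)..1, omegaSeries 1 τ t * ((t ^ (q + 1) * (1 - t) ^ 0 : ℝ) : ℂ)) := by
  obtain ⟨c₀, c₁, hlog⟩ := exists_isBigO_integral_inv_one_sub (Nat.succ_ne_zero q)
  set A : ℂ := (2 * π * I) ^ (q + 1) / ((q + 1)! : ℂ)
  refine ⟨A * (omegaConst 1 * (∫ t in (0 : ℝ)..1, ((t ^ (q + 1) * (1 - t) ^ 0 : ℝ) : ℂ)) +
    -(2 * π * I) * c₀), fun τ => ?_⟩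
  rw [depthOneA_eq]
  have hcont := continuous_omegaSeries 1 τ
  set S : ℝ → ℂ := fun t => omegaConst 1 + -(2 * π * I) * omegaSeries 1 τ t
  have hS : Continuous S := by fun_prop
  obtain ⟨M, h0, h1⟩ := exists_bound_rpow_of_continuous hS
  have hT := isBigO_truncated_integral (hS.intervalIntegrable 0 1) h0 h1 (q + 1) 0
  have hw : Continuous fun t : ℝ => ((t ^ (q + 1) * (1 - t) ^ 0 : ℝ) : ℂ) := by fun_prop
  have hint : ∫ t in (0 : ℝ)..1, S t * ((t ^ (q + 1) * (1 - t) ^ 0 : ℝ) : ℂ) =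
      omegaConst 1 * (∫ t in (0 : ℝ)..1, ((t ^ (q + 1) * (1 - t) ^ 0 : ℝ) : ℂ)) +
      -(2 * π * I) *
        ∫ t in (0 : ℝ)..1, omegaSeries 1 τ t * ((t ^ (q + 1) * (1 - t) ^ 0 : ℝ) : ℂ) := by
    simp only [S, add_mul, mul_assoc (-(2 * π * I))]
    exact integral_const_mul_add_const_mul (hw.intervalIntegrable _ _)
      ((hcont.mul hw).intervalIntegrable _ _) _ _
  refine ellMZVA_eq ⟨Polynomial.C (A * ((∫ t in (0 : ℝ)..1,
    S t * ((t ^ (q + 1) * (1 - t) ^ 0 : ℝ) : ℂ)) + -(2 * π * I) * c₀)) +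
      Polynomial.C (A * (-(2 * π * I) * c₁)) * Polynomial.X, ?_, ?_, 1 / 2, by norm_num, ?_⟩
  · refine (Polynomial.natDegree_add_le _ _).trans (max_le ?_ ?_)
    · exact (Polynomial.natDegree_C _).trans_le zero_le
    · refine (Polynomial.natDegree_C_mul_le _ _).trans (Polynomial.natDegree_X_le.trans ?_)
      simp
  · rw [hint, Polynomial.coeff_add, Polynomial.coeff_C_zero, Polynomial.coeff_C_mul_X]
    simp only [zero_ne_one, if_false]
    ring
  refine ((hT.add (hlog.const_mul_left (-(2 * π * I)))).const_mul_left A).congr' ?_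
    EventuallyEq.rfl
  filter_upwards [Ioo_mem_nhdsGT (show (0 : ℝ) < 1 / 2 by norm_num)] with ε hε
  have hle : ε ≤ 1 - ε := by linarith [hε.2]
  have hv : ContinuousOn (fun t : ℝ => (1 - expTwoPi t)⁻¹) (uIcc ε (1 - ε)) :=
    ContinuousOn.inv₀ (continuous_const.sub
      (differentiable_expTwoPi.continuous.comp Complex.continuous_ofReal)).continuousOn
      fun t ht => by
        rw [uIcc_of_le hle] at ht
        exact sub_ne_zero.2
          (expTwoPi_ofReal_ne_one ⟨hε.1.trans_le ht.1, by linarith [ht.2, hε.1]⟩).symm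
  have hp : Continuous fun t : ℝ => (((t - ε : ℝ) : ℂ) ^ (q + 1)) := by fun_prop
  have hp' : Continuous fun t : ℝ => (((t - ε) ^ (q + 1) * (1 - ε - t) ^ 0 : ℝ) : ℂ) := by
    fun_prop
  rw [iterIntegral_kroneckerOmega (H := fun t => S t + -(2 * π * I) * (1 - expTwoPi t)⁻¹)
    one_ne_zero 0 _ (fun t ht => by
      refine (kroneckerOmega_succ 0 ht τ).trans ?_
      simp only [S, if_true, Nat.factorial_zero, Nat.cast_one, div_one, zero_add]
      ring) hε]
  simp only [List.replicate_zero, List.nil_append, iterIntegral, iterIntegral_replicate_const]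
  have e : ∫ t in ε..(1 - ε), (S t + -(2 * π * I) * (1 - expTwoPi t)⁻¹) *
      ((2 * π * I) ^ (q + 1) * (((t - ε : ℝ) : ℂ) ^ (q + 1) / ((q + 1)! : ℂ))) =
      A * ((∫ t in ε..(1 - ε), S t * (((t - ε) ^ (q + 1) * (1 - ε - t) ^ 0 : ℝ) : ℂ)) +
        -(2 * π * I) * ∫ t in ε..(1 - ε), (1 - expTwoPi t)⁻¹ * (((t - ε : ℝ) : ℂ) ^ (q + 1))) := by
    rw [mul_add, ← mul_assoc A, ← integral_const_mul_add_const_mul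
      (f := fun t : ℝ => S t * (((t - ε) ^ (q + 1) * (1 - ε - t) ^ 0 : ℝ) : ℂ))
      (g := fun t : ℝ => (1 - expTwoPi t)⁻¹ * (((t - ε : ℝ) : ℂ) ^ (q + 1)))
      ((hS.mul hp').intervalIntegrable _ _)
      (ContinuousOn.intervalIntegrable (hv.mul hp.continuousOn))]
    refine intervalIntegral.integral_congr fun t _ => ?_
    simp only [A]
    push_cast
    ring
  rw [show q + 2 - 1 = q + 1 from rfl, e]
  simp only [Polynomial.eval_add, Polynomial.eval_mul, Polynomial.eval_C, Polynomial.eval_X]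
  ring

/-- The term that would need weight two is split off with its explicit coefficient: the weight
`t^(q+1)` changes by `1` over the interval, and the parity factor is `2`. -/
theorem exists_depthOneA_one_eq_sum (q : ℕ) : ∃ (K : ℂ) (c : ℕ → ℂ), ∀ τ : ℍ,
    depthOneA 1 (q + 2) τ =
      K + -(2 * (2 * π * I) ^ (q + 1) / ((q + 1)! : ℂ)) * qSeries (eichlerCoeff 0 1) τ +
        ∑ b ∈ Finset.range q, c b * (1 + (-1) ^ (b + 1)) * qSeries (eichlerCoeff 0 (b + 2)) τ := by
  obtain ⟨K, hK⟩ := exists_depthOneA_one_eq q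
  have hdeg := natDegree_weight_le (q + 1) 0
  rw [zero_add] at hdeg
  obtain ⟨c, hc0, hc⟩ := exists_integral_omegaSeries (q + 1) _ hdeg 1
  have hpi : (2 * π * I : ℂ) ≠ 0 := by simp [Real.pi_ne_zero]
  refine ⟨K, fun b => (2 * π * I) ^ (q + 1) / ((q + 1)! : ℂ) * -(2 * π * I) * c (b + 1),
    fun τ => ?_⟩
  rw [hK τ]
  simp only [ofReal_weight_eq_eval]
  rw [hc τ, Finset.sum_range_succ', hc0]
  simp only [Polynomial.eval_pow, Polynomial.eval_X, pow_zero, mul_one,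
    one_pow, ne_eq, Nat.succ_ne_zero, not_false_eq_true, zero_pow, sub_zero]
  rw [mul_add, mul_add, Finset.mul_sum, Finset.mul_sum, add_assoc K, add_comm _ (∑ b ∈ _, _)]
  refine congrArg (K + ·) (congrArg₂ (· + ·) ?_ ?_)
  · refine Finset.sum_congr rfl fun b _ => ?_
    rw [show 1 + (b + 1) + 1 = (b + 1) + 2 by ring, pow_add (-1 : ℂ) (b + 1) 2]
    norm_num
    ring
  · norm_num
    field_simp
    rw [Complex.I_sq]
    ring

theorem hasTameTranslates_depthOneHatA {r : ℕ} (hr : 2 ≤ r) :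
    HasTameTranslates (1 - (r : ℤ)) (depthOneHatA r) := by
  obtain ⟨q, rfl⟩ := Nat.exists_eq_add_of_le' hr
  obtain ⟨K, c, hc⟩ := exists_depthOneA_one_eq_sum q
  obtain ⟨K', c', hc'⟩ := exists_depthOneA_one_eq_sum 0
  have hpi : (2 * π * I : ℂ) ≠ 0 := by simp [Real.pi_ne_zero]
  -- The coefficient of the weight two term for `q` is `(2πi)^q / (q+1)!` times the one for `q = 0`,
  -- so the correction in `Â` sets the entry `b = 0` to zero.
  have hfun : depthOneHatA (q + 2) = fun τ => (K - (2 * π * I) ^ q / ((q + 1)! : ℂ) * K') +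
      ∑ b ∈ Finset.range (q + 1), (if b = 0 then 0 else c (b - 1) * (1 + (-1) ^ b)) *
        qSeries (eichlerCoeff 0 (b + 1)) τ := by
    ext τ
    rw [depthOneHatA, hc τ, hc' τ, Finset.sum_range_succ']
    rw [show ((q + 2 : ℕ) : ℤ) - 2 = (q : ℤ) by push_cast; ring, zpow_natCast,
      show q + 2 - 1 = q + 1 from rfl]
    simp only [Finset.range_zero, Finset.sum_empty, add_zero, zero_add, pow_one,
      Nat.factorial_one, Nat.cast_one, div_one, if_true, zero_mul, Nat.succ_ne_zero, if_false,
      Nat.add_sub_cancel, add_assoc, Nat.reduceAdd]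
    rw [pow_succ]
    ring
  rw [hfun, show (1 - ((q + 2 : ℕ) : ℤ)) = -((q + 1 : ℕ) : ℤ) by push_cast; ring]
  refine (HasTameTranslates.const (q + 1) _).add (hasTameTranslates_sum_qSeries _ fun b _ => ?_)
  rcases b with _ | b
  · exact Or.inl (if_pos rfl)
  -- The entry `b + 1` belongs to weight `b + 3`, which has the same parity as `b + 1`; if even, it
  -- is at least `4`.
  rcases Nat.even_or_odd (b + 1) with h | h
  · right
    obtain ⟨k, hk⟩ := h
    exact ⟨by omega, ⟨k + 1, by omega⟩⟩
  · left
    simp [h.neg_one_pow]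

end DepthOne

theorem mainTheorem7 :
    (∀ n r : ℕ, 2 ≤ n → 1 ≤ r →
      FiniteDimensional ℂ (slashSpan (1 - (r : ℤ)) (depthOneA n r))) ∧
    (∀ r : ℕ, 2 ≤ r →
      FiniteDimensional ℂ (slashSpan (1 - (r : ℤ)) (depthOneHatA r))) ∧
    (∀ n r : ℕ, 2 ≤ n → 1 ≤ r →
      IsComponentOfVVMF (1 - (r : ℤ)) (depthOneA n r)) ∧
    (∀ n s t : ℕ, 2 ≤ n →
      IsComponentOfVVMF (1 - ((s + 1 + t : ℕ) : ℤ))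
        (ellMZVA (List.replicate s 0 ++ n :: List.replicate t 0))) ∧
    (∀ r : ℕ, 2 ≤ r →
      IsComponentOfVVMF (1 - (r : ℤ)) (depthOneHatA r)) := by
  refine ⟨fun n r hn hr => (hasTameTranslates_depthOneA hn hr).finiteDimensional,
    fun r hr => (hasTameTranslates_depthOneHatA hr).finiteDimensional,
    fun n r hn hr => (hasTameTranslates_depthOneA hn hr).isComponentOfVVMF,
    fun n s t hn => ?_, fun r hr => (hasTameTranslates_depthOneHatA hr).isComponentOfVVMF⟩
  rw [show (1 - ((s + 1 + t : ℕ) : ℤ)) = -((s + t : ℕ) : ℤ) by push_cast; ring]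
  exact (hasTameTranslates_ellMZVA hn s t).isComponentOfVVMF
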